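/- Let $T^2=\mathbb R^2/\mathbb Z^2$ be the two-dimensional torus. Metrics, functions and vector fields on $T^2$ are $C^\infty$. A Lorentzian metric $g$ on $T^2$ is \emph{flat} if its curvature tensor vanishes, and \emph{conformally flat} if $g=\Omega g_0$ on all of $T^2$ for some flat Lorentzian metric $g_0$ on $T^2$ and some smooth function $\Omega>0$ on $T^2$. A vector field $K$ is \emph{conformal} if $\mathcal L_K g=2\sigma g$ for some $\sigma\in C^\infty(T^2)$; a tangent vector $v$ is timelike, lightlike or spacelike if $g(v,v)<0$; $g(v,v)=0$ and $v\neq 0$; or $g(v,v)>0$, respectively, and $K$ is timelike (spacelike) if it is so at every point. The metric $g$ is \emph{complete} if every geodesic of $g$ extends to a geodesic defined on all of $\mathbb R$; it is timelike (resp. lightlike, spacelike) \emph{incomplete} if some geodesic with timelike (resp. lightlike, spacelike) velocity does not so extend. For $0\le r\le\infty$, the $C^r$ topology on the set of Lorentzian metrics on $T^2$ is that of uniform convergence of the components in the standard coordinates together with all their partial derivatives of order at most $r$. (1) For every Lorentzian metric $g$ on $T^2$ the following are equivalent: $g$ is conformally flat; $g$ admits a timelike conformal vector field; $g$ admits a spacelike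 conformal vector field. Moreover, every conformally flat $g$ is complete. (2) Let $0\le r\le\infty$. Every conformally flat Lorentzian metric on $T^2$ lies in the $C^r$-closure of the set of lightlike incomplete Lorentzian metrics on $T^2$. Every flat Lorentzian metric on $T^2$ lies in the $C^r$-closure of the set of Lorentzian metrics on $T^2$ that are simultaneously timelike, lightlike and spacelike incomplete. -/

import Mathlib

open scoped ContDiff Topology UniformConvergence

noncomputable section

namespace LorentzTorus

/-- The torus `T² = (ℝ/ℤ)²`. -/
abbrev Torus : Type := UnitAddTorus (Fin 2)

/-- `ℝ²`, which is both the universal covering of `T²` and, by means of the global frame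
`∂₀, ∂₁` of coordinate vector fields, the tangent space of `T²` at each of its points. -/
abbrev Plane : Type := Fin 2 → ℝ

/-- The covering map `ℝ² → T²`; its local inverses are the charts of `T²`. -/
def proj (p : Plane) : Torus := fun i => (p i : UnitAddCircle)

/-- A function on `T²` is smooth if its lift to `ℝ²` is. -/
def IsSmooth (f : Torus → ℝ) : Prop := ContDiff ℝ ∞ (fun p : Plane => f (proj p))

/-- The derivative `∂ᵢ f` of a function on `T²` in the direction of the `i`-th coordinate field. -/
def partialDeriv (i : Fin 2) (f : Torus → ℝ) (x : Torus) : ℝ :=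
  deriv (fun s : ℝ => f (x + proj (Pi.single i s))) 0

/-- A smooth Lorentzian metric on `T²`, given by its components `g i j = g(∂ᵢ, ∂ⱼ)`.
A symmetric bilinear form on a plane is nondegenerate of index one iff its Gram determinant
is negative. -/
structure LorentzMetric where
  /-- the matrix of components at each point -/
  comp : Torus → Matrix (Fin 2) (Fin 2) ℝ
  smooth : ∀ i j, IsSmooth (fun x => comp x i j)
  symm : ∀ x, (comp x).IsSymm
  lorentzian : ∀ x, (comp x).det < 0

namespace LorentzMetric

/-- The scalar product `g_x(u, w)` of two tangent vectors at `x`. -/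
def inner (g : LorentzMetric) (x : Torus) (u w : Plane) : ℝ :=
  ∑ i, ∑ j, g.comp x i j * u i * w j

/-- The Christoffel symbols `Γᵏᵢⱼ` of the Levi-Civita connection. -/
def christoffel (g : LorentzMetric) (k i j : Fin 2) (x : Torus) : ℝ :=
  (1 / 2) * ∑ l, (g.comp x)⁻¹ k l *
    (partialDeriv i (fun y => g.comp y j l) x + partialDeriv j (fun y => g.comp y i l) x
      - partialDeriv l (fun y => g.comp y i j) x)

/-- The components of the curvature tensor: the `∂ₗ`-component of `R(∂ᵢ, ∂ⱼ)∂ₖ`, with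
`R(X, Y) = [∇_X, ∇_Y] - ∇_[X,Y]`. -/
def curvature (g : LorentzMetric) (l k i j : Fin 2) (x : Torus) : ℝ :=
  partialDeriv i (g.christoffel l j k) x - partialDeriv j (g.christoffel l i k) x
    + ∑ m, (g.christoffel l i m x * g.christoffel m j k x
      - g.christoffel l j m x * g.christoffel m i k x)

/-- A metric is flat if its curvature tensor vanishes. -/
def IsFlat (g : LorentzMetric) : Prop := ∀ l k i j x, g.curvature l k i j x = 0

/-- `h = Ω g` for some smooth function `Ω > 0` on the torus. -/
def IsConformalTo (h g : LorentzMetric) : Prop :=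
  ∃ Ω : Torus → ℝ, IsSmooth Ω ∧ (∀ x, 0 < Ω x) ∧ ∀ x, h.comp x = Ω x • g.comp x

/-- Globally conformal to a flat Lorentzian metric on the torus. -/
def IsConformallyFlat (g : LorentzMetric) : Prop :=
  ∃ g₀ : LorentzMetric, g₀.IsFlat ∧ g.IsConformalTo g₀

/-- The components `(L_K g)(∂ᵢ, ∂ⱼ)` of the Lie derivative of the metric. -/
def lieDeriv (g : LorentzMetric) (K : Torus → Plane) (i j : Fin 2) (x : Torus) : ℝ :=
  ∑ k, (K x k * partialDeriv k (fun y => g.comp y i j) x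
    + g.comp x k j * partialDeriv i (fun y => K y k) x
    + g.comp x i k * partialDeriv j (fun y => K y k) x)

/-- `K` is a smooth conformal (Killing) vector field: `L_K g = 2 σ g` for a smooth `σ`. -/
def IsConformalField (g : LorentzMetric) (K : Torus → Plane) : Prop :=
  (∀ k, IsSmooth (fun x => K x k)) ∧
    ∃ σ : Torus → ℝ, IsSmooth σ ∧ ∀ i j x, g.lieDeriv K i j x = 2 * σ x * g.comp x i j

/-- The tangent vector `v` at `x` is timelike. -/
def IsTimelike (g : LorentzMetric) (x : Torus) (v : Plane) : Prop := g.inner x v v < 0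

/-- The tangent vector `v` at `x` is spacelike. -/
def IsSpacelike (g : LorentzMetric) (x : Torus) (v : Plane) : Prop := 0 < g.inner x v v

/-- The tangent vector `v` at `x` is lightlike. -/
def IsLightlike (g : LorentzMetric) (x : Torus) (v : Plane) : Prop := g.inner x v v = 0 ∧ v ≠ 0

end LorentzMetric

/-- The curve `γ` in the torus is differentiable at `t` with velocity `v`: near `t` it is the
projection of a curve in `ℝ²` with derivative `v` at `t`. -/
def HasVelocityAt (γ : ℝ → Torus) (v : Plane) (t : ℝ) : Prop :=
  ∃ c : ℝ → Plane, HasDerivAt c v t ∧ ∀ᶠ s in 𝓝 t, proj (c s) = γ s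

namespace LorentzMetric

/-- On the (open) set `I` of parameters, `γ` is a geodesic with velocity `v`, that is,
`γ' = v` and `Dv/dt = 0`. -/
def IsGeodesicOn (g : LorentzMetric) (γ : ℝ → Torus) (v : ℝ → Plane) (I : Set ℝ) : Prop :=
  ∀ t ∈ I, HasVelocityAt γ (v t) t ∧
    ∀ k, HasDerivAt (fun s => v s k)
      (-∑ i, ∑ j, g.christoffel k i j (γ t) * v t i * v t j) t

/-- The curve `γ`, restricted to `I`, extends to a geodesic defined on the whole real line. -/
def ExtendsToLine (g : LorentzMetric) (γ : ℝ → Torus) (I : Set ℝ) : Prop :=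
  ∃ (γ' : ℝ → Torus) (v' : ℝ → Plane), g.IsGeodesicOn γ' v' Set.univ ∧ Set.EqOn γ' γ I

/-- Geodesic completeness: every geodesic on an open interval extends to the whole line. -/
def IsComplete (g : LorentzMetric) : Prop :=
  ∀ (I : Set ℝ) (γ : ℝ → Torus) (v : ℝ → Plane), IsOpen I → I.OrdConnected → I.Nonempty →
    g.IsGeodesicOn γ v I → g.ExtendsToLine γ I

/-- Some geodesic whose velocity is everywhere of the causal type `C` does not extend to the
whole line. -/
def IsIncompleteFor (g : LorentzMetric) (C : Torus → Plane → Prop) : Prop :=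
  ∃ (I : Set ℝ) (γ : ℝ → Torus) (v : ℝ → Plane), IsOpen I ∧ I.OrdConnected ∧ I.Nonempty ∧
    g.IsGeodesicOn γ v I ∧ (∀ t ∈ I, C (γ t) (v t)) ∧ ¬ g.ExtendsToLine γ I

/-- Timelike incompleteness. -/
def IsTimelikeIncomplete (g : LorentzMetric) : Prop := g.IsIncompleteFor g.IsTimelike

/-- Lightlike incompleteness. -/
def IsLightlikeIncomplete (g : LorentzMetric) : Prop := g.IsIncompleteFor g.IsLightlike

/-- Spacelike incompleteness. -/
def IsSpacelikeIncomplete (g : LorentzMetric) : Prop := g.IsIncompleteFor g.IsSpacelike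

/-- The `k`-th total derivative of the component `g i j` (lifted to `ℝ²`), as an element of a
function space with the topology of uniform convergence. -/
def jet (g : LorentzMetric) (k : ℕ) (i j : Fin 2) :
    Plane →ᵤ ContinuousMultilinearMap ℝ (fun _ : Fin k => Plane) ℝ :=
  UniformFun.ofFun (iteratedFDeriv ℝ k (fun p : Plane => g.comp (proj p) i j))

/-- The `C^r` topology (`0 ≤ r ≤ ∞`) on the set of Lorentzian metrics of the torus: uniform
convergence of the components with all their derivatives of order at most `r`. -/
@[reducible] def crTopology (r : ℕ∞) : TopologicalSpace LorentzMetric :=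
  TopologicalSpace.induced
    (fun g (k : {k : ℕ // (k : ℕ∞) ≤ r}) (i j : Fin 2) => g.jet k i j) inferInstance

end LorentzMetric

end LorentzTorus

end

open scoped ContDiff Topology UniformConvergence

noncomputable section

namespace LorentzTorus

/-! Everything passes through null coframes: expressions `g = Ω (a ⊗ b + b ⊗ a)` with `Ω > 0` and
`a`, `b` closed one-forms on the torus (`IsNullCoframe`). Conformal flatness is equivalent to having
one, and each claim is proved from one.

A flat metric has one with `Ω = 1` (`IsFlat.exists_isNullCoframe`). On the plane the null line
fields are spanned by global forms `a`, `b`; a metric connection can only give `∇a = ν ⊗ a`, `∇b =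
-ν ⊗ b`, and flatness means `dν = 0`, so a rescaling makes `a = dξ` and `b = dη` parallel. Deck
translations multiply `a` by constants `c` and `b` by `c⁻¹`. If some `c ≠ 1`, then, after
subtracting constants, `ξ η` descends to the torus; its only critical points are the common zeros of
`ξ` and `η`, so its maximum and minimum are both `0`, and it vanishes identically, which is absurd
(`multiplier_eq_one`). Hence `a` and `b` descend. Conversely, closedness forces `ν = 0`, so `a ⊗ b +
b ⊗ a` is flat.

A vector field on which `a` and `b` take constant values `r`, `s` is conformal with square `2 Ω r
s`; this gives timelike and spacelike fields. In the other direction, if `n = g(K, K)` never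
vanishes, `K` is a unit Killing field of `g / n`; its dual form `θ` and the contraction `ψ` of `K`
with the area form are closed, and `g = n (θ² - ψ²)` factors
(`IsConformalField.exists_isNullCoframe`).

Completeness: along a geodesic the product with a conformal field has derivative `σ` times the
constant energy, hence grows at most linearly. The two null fields dual to the coframe are conformal
and control the whole velocity, so it cannot blow up in finite time
(`IsNullCoframe.exists_geodesic`).

Incompleteness: a small change of `a` makes its periods commensurable, so after rescaling `a = du`
with integral periods and any 1-periodic function of `u` lives on the torus. With `B = Ω b`, adding
`2 ε f(u) B ⊗ B`, where `f` has a simple zero at `u = 0`, creates explicit geodesics whose velocity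
blows up in finite time at the leaf `u = 0`; one parameter selects the causal type
(`exists_incomplete_geodesic`). Thus every conformally flat metric is a limit of metrics incomplete
in all three senses, which covers both closure statements. -/

/-! ### Calculus on the plane and on the torus -/

/-- The partial derivative of a function on the plane. -/
def pd (i : Fin 2) (F : Plane → ℝ) (p : Plane) : ℝ := fderiv ℝ F p (Pi.single i 1)

theorem proj_add (p q : Plane) : proj (p + q) = proj p + proj q := by
  ext i; simp [proj]

theorem proj_surjective : Function.Surjective proj := by
  intro x
  choose f hf using fun i => QuotientAddGroup.mk_surjective (x i)
  exact ⟨f, funext hf⟩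

theorem proj_eq_iff {p q : Plane} : proj p = proj q ↔ proj (p - q) = 0 := by
  have h : proj p = proj (p - q) + proj q := by rw [← proj_add, sub_add_cancel]
  rw [h]; simp

theorem proj_eq_zero_iff {n : Plane} : proj n = 0 ↔ ∀ i, ∃ z : ℤ, n i = z := by
  rw [funext_iff]
  refine forall_congr' fun i => ?_
  simp only [proj, Pi.zero_apply]
  rw [AddCircle.coe_eq_zero_iff]
  constructor
  · rintro ⟨z, hz⟩; exact ⟨z, by simpa using hz.symm⟩
  · rintro ⟨z, hz⟩; exact ⟨z, by simpa using hz.symm⟩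

theorem continuous_proj : Continuous proj := by
  refine continuous_pi fun i => ?_
  exact (AddCircle.continuous_mk' 1).comp (continuous_apply i)

theorem isOpenQuotientMap_proj : IsOpenQuotientMap proj := by
  have h : ∀ _ : Fin 2, IsOpenQuotientMap (fun s : ℝ => (s : UnitAddCircle)) := fun _ =>
    QuotientAddGroup.isOpenQuotientMap_mk
  exact IsOpenQuotientMap.piMap h

theorem exists_descent {X : Type*} {F : Plane → X} (hF : ∀ p n, proj n = 0 → F (p + n) = F p) :
    ∃ f : Torus → X, ∀ p, f (proj p) = F p := by
  refine ⟨fun x => F (Function.surjInv proj_surjective x), fun p => ?_⟩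
  have h : proj (Function.surjInv proj_surjective (proj p)) = proj p :=
    Function.surjInv_eq proj_surjective (proj p)
  have := hF p _ (proj_eq_iff.1 h)
  simpa using this

theorem pd_differentiableAt {F : Plane → ℝ} (hF : ContDiff ℝ ∞ F) (p : Plane) :
    DifferentiableAt ℝ F p := hF.contDiffAt.differentiableAt (by simp)

theorem contDiff_pd {F : Plane → ℝ} (hF : ContDiff ℝ ∞ F) (i : Fin 2) : ContDiff ℝ ∞ (pd i F) :=
  (hF.fderiv_right (m := ∞) (by simp)).clm_apply contDiff_const

theorem fderiv_eq_pd (F : Plane → ℝ) (p v : Plane) :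
    fderiv ℝ F p v = pd 0 F p * v 0 + pd 1 F p * v 1 := by
  have hv : v = v 0 • (Pi.single 0 1 : Plane) + v 1 • (Pi.single 1 1 : Plane) := by
    ext i; fin_cases i <;> simp
  conv_lhs => rw [hv]
  rw [map_add, map_smul, map_smul]
  simp only [pd, smul_eq_mul]; ring

theorem hasDerivAt_plane_comp {F : Plane → ℝ} (hF : ContDiff ℝ ∞ F) {c : ℝ → Plane} {v : Plane}
    {t : ℝ} (hc : HasDerivAt c v t) :
    HasDerivAt (fun s => F (c s)) (pd 0 F (c t) * v 0 + pd 1 F (c t) * v 1) t := by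
  rw [← fderiv_eq_pd]
  exact (pd_differentiableAt hF _).hasFDerivAt.comp_hasDerivAt t hc

theorem pd_add {F G : Plane → ℝ} (hF : ContDiff ℝ ∞ F) (hG : ContDiff ℝ ∞ G) (i p) :
    pd i (fun q => F q + G q) p = pd i F p + pd i G p := by
  simp only [pd]
  rw [fderiv_fun_add (pd_differentiableAt hF p) (pd_differentiableAt hG p)]; rfl

theorem pd_sub {F G : Plane → ℝ} (hF : ContDiff ℝ ∞ F) (hG : ContDiff ℝ ∞ G) (i p) :
    pd i (fun q => F q - G q) p = pd i F p - pd i G p := by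
  simp only [pd]
  rw [fderiv_fun_sub (pd_differentiableAt hF p) (pd_differentiableAt hG p)]; rfl

theorem pd_mul {F G : Plane → ℝ} (hF : ContDiff ℝ ∞ F) (hG : ContDiff ℝ ∞ G) (i p) :
    pd i (fun q => F q * G q) p = pd i F p * G p + F p * pd i G p := by
  simp only [pd]
  rw [fderiv_fun_mul (pd_differentiableAt hF p) (pd_differentiableAt hG p)]
  simp; ring

theorem pd_const (a : ℝ) (i p) : pd i (fun _ => a) p = 0 := by simp [pd]

theorem pd_comp {F : Plane → ℝ} (hF : ContDiff ℝ ∞ F) {φ : ℝ → ℝ} {φ' : ℝ} {p : Plane}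
    (hφ : HasDerivAt φ φ' (F p)) (i) : pd i (fun q => φ (F q)) p = φ' * pd i F p := by
  have := (hφ.comp_hasFDerivAt p (pd_differentiableAt hF p).hasFDerivAt).fderiv
  simp only [pd]
  change fderiv ℝ (φ ∘ F) p _ = _
  rw [this]; simp

theorem pd_comm {F : Plane → ℝ} (hF : ContDiff ℝ ∞ F) (i j p) :
    pd i (pd j F) p = pd j (pd i F) p := by
  have key : ∀ i j, pd i (pd j F) p
      = fderiv ℝ (fderiv ℝ F) p (Pi.single i 1) (Pi.single j 1) := by
    intro i j
    have hd : DifferentiableAt ℝ (fderiv ℝ F) p :=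
      (hF.fderiv_right (m := ∞) (by simp)).contDiffAt.differentiableAt (by simp)
    simp only [pd]
    change fderiv ℝ (fun q => fderiv ℝ F q (Pi.single j 1)) p _ = _
    rw [fderiv_clm_apply hd (differentiableAt_const _)]
    simp
  rw [key, key]
  exact (hF.contDiffAt.isSymmSndFDerivAt (by simpa using ENat.LEInfty.out)).eq _ _

/-- The bridge between the two derivatives: all rules on the torus are read off from those on the
plane. -/
theorem partialDeriv_proj {f : Torus → ℝ} (hf : IsSmooth f) (i p) :
    partialDeriv i f (proj p) = pd i (fun q => f (proj q)) p := by
  have h1 : HasDerivAt (fun s : ℝ => p + Pi.single i s) (Pi.single i 1) 0 := by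
    refine HasDerivAt.const_add _ ?_
    rw [hasDerivAt_pi]
    intro j
    by_cases h : j = i
    · subst h; simpa using hasDerivAt_id' (0 : ℝ)
    · simpa [h] using hasDerivAt_const (0 : ℝ) (0 : ℝ)
  have h2 : HasFDerivAt (fun q => f (proj q)) (fderiv ℝ (fun q => f (proj q)) p)
      (p + Pi.single i (0 : ℝ)) := by
    simpa using (pd_differentiableAt hf p).hasFDerivAt
  have := h2.comp_hasDerivAt (0 : ℝ) h1
  simp only [partialDeriv, ← proj_add]
  exact this.deriv

namespace IsSmooth

variable {f h : Torus → ℝ}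

theorem const (a : ℝ) : IsSmooth (fun _ => a) := contDiff_const
theorem add (hf : IsSmooth f) (hh : IsSmooth h) : IsSmooth (fun x => f x + h x) :=
  ContDiff.add hf hh
theorem sub (hf : IsSmooth f) (hh : IsSmooth h) : IsSmooth (fun x => f x - h x) :=
  ContDiff.sub hf hh
theorem neg (hf : IsSmooth f) : IsSmooth (fun x => - f x) := ContDiff.neg hf
theorem mul (hf : IsSmooth f) (hh : IsSmooth h) : IsSmooth (fun x => f x * h x) :=
  ContDiff.mul hf hh
theorem inv (hf : IsSmooth f) (h0 : ∀ x, f x ≠ 0) : IsSmooth (fun x => (f x)⁻¹) :=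
  ContDiff.inv hf fun _ => h0 _
theorem div (hf : IsSmooth f) (hh : IsSmooth h) (h0 : ∀ x, h x ≠ 0) :
    IsSmooth (fun x => f x / h x) := ContDiff.div hf hh fun _ => h0 _
theorem sqrt (hf : IsSmooth f) (h0 : ∀ x, 0 < f x) : IsSmooth (fun x => √(f x)) :=
  ContDiff.sqrt hf fun _ => (h0 _).ne'
theorem partialDeriv (hf : IsSmooth f) (i : Fin 2) : IsSmooth (partialDeriv i f) := by
  have := contDiff_pd hf i
  unfold IsSmooth
  convert this using 2 with p
  exact partialDeriv_proj hf i p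

theorem continuous (hf : IsSmooth f) : Continuous f := by
  have : Continuous (fun p => f (proj p)) := ContDiff.continuous hf
  exact (isOpenQuotientMap_proj.isQuotientMap.continuous_iff).2 this

end IsSmooth

section rules
variable {f h : Torus → ℝ}

theorem partialDeriv_add (hf : IsSmooth f) (hh : IsSmooth h) (i x) :
    partialDeriv i (fun y => f y + h y) x = partialDeriv i f x + partialDeriv i h x := by
  obtain ⟨p, rfl⟩ := proj_surjective x
  rw [partialDeriv_proj (hf.add hh), partialDeriv_proj hf, partialDeriv_proj hh]
  exact pd_add hf hh i p

theorem partialDeriv_sub (hf : IsSmooth f) (hh : IsSmooth h) (i x) :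
    partialDeriv i (fun y => f y - h y) x = partialDeriv i f x - partialDeriv i h x := by
  obtain ⟨p, rfl⟩ := proj_surjective x
  rw [partialDeriv_proj (hf.sub hh), partialDeriv_proj hf, partialDeriv_proj hh]
  exact pd_sub hf hh i p

theorem partialDeriv_mul (hf : IsSmooth f) (hh : IsSmooth h) (i x) :
    partialDeriv i (fun y => f y * h y) x
      = partialDeriv i f x * h x + f x * partialDeriv i h x := by
  obtain ⟨p, rfl⟩ := proj_surjective x
  rw [partialDeriv_proj (hf.mul hh), partialDeriv_proj hf, partialDeriv_proj hh]
  exact pd_mul hf hh i p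

theorem partialDeriv_const (a : ℝ) (i x) : partialDeriv i (fun _ => a) x = 0 := by
  simp [partialDeriv]

theorem partialDeriv_const_mul (hf : IsSmooth f) (a : ℝ) (i x) :
    partialDeriv i (fun y => a * f y) x = a * partialDeriv i f x := by
  rw [partialDeriv_mul (IsSmooth.const a) hf, partialDeriv_const]; ring

theorem partialDeriv_neg (hf : IsSmooth f) (i x) :
    partialDeriv i (fun y => - f y) x = - partialDeriv i f x := by
  have := partialDeriv_const_mul hf (-1) i x
  simpa using this

end rules

theorem exists_bound {f : Torus → ℝ} (hf : IsSmooth f) : ∃ M, 0 ≤ M ∧ ∀ x, |f x| ≤ M := by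
  obtain ⟨M, hM⟩ := (isCompact_range hf.continuous).isBounded.exists_norm_le
  refine ⟨max M 0, le_max_right _ _, fun x => ?_⟩
  exact (hM _ ⟨x, rfl⟩).trans (le_max_left _ _)

/-! ### The Levi-Civita connection -/

namespace LorentzMetric

variable (g : LorentzMetric)

theorem comp_symm (x i j) : g.comp x i j = g.comp x j i := (g.symm x).apply j i

theorem comp_det (x) : g.comp x 0 0 * g.comp x 1 1 - g.comp x 0 1 * g.comp x 0 1 < 0 := by
  have := g.lorentzian x
  rw [Matrix.det_fin_two, g.comp_symm x 1 0] at this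
  exact this

theorem christoffel_symm (k i j x) : g.christoffel k i j x = g.christoffel k j i x := by
  have : (fun y => g.comp y i j) = fun y => g.comp y j i := funext fun y => g.comp_symm y i j
  simp only [christoffel, this]
  congr 1
  refine Finset.sum_congr rfl fun l _ => ?_
  ring

theorem inv_smooth (i j) : IsSmooth (fun x => (g.comp x)⁻¹ i j) := by
  have hdet : IsSmooth (fun x => (g.comp x).det) := by
    simp only [Matrix.det_fin_two]
    exact ((g.smooth 0 0).mul (g.smooth 1 1)).sub ((g.smooth 0 1).mul (g.smooth 1 0))
  have hinv := hdet.inv fun x => (g.lorentzian x).ne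
  simp only [Matrix.inv_def, Ring.inverse_eq_inv', Matrix.adjugate_fin_two]
  fin_cases i <;> fin_cases j <;> simp only [Matrix.smul_apply, smul_eq_mul] <;>
    refine hinv.mul ?_ <;> simp
  exacts [g.smooth 1 1, (g.smooth 0 1).neg, (g.smooth 1 0).neg, g.smooth 0 0]

theorem christoffel_smooth (k i j) : IsSmooth (g.christoffel k i j) := by
  unfold christoffel
  simp only [Fin.sum_univ_two]
  have h : ∀ l, IsSmooth fun x => (g.comp x)⁻¹ k l *
    (partialDeriv i (fun y => g.comp y j l) x + partialDeriv j (fun y => g.comp y i l) x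
      - partialDeriv l (fun y => g.comp y i j) x) := fun l =>
    (g.inv_smooth k l).mul ((((g.smooth j l).partialDeriv i).add
      ((g.smooth i l).partialDeriv j)).sub ((g.smooth i j).partialDeriv l))
  exact (IsSmooth.const _).mul ((h 0).add (h 1))

/-- Lowering the index of the Christoffel symbols. -/
theorem sum_comp_mul_christoffel (l i j x) :
    ∑ k, g.comp x l k * g.christoffel k i j x = (1 / 2) *
      (partialDeriv i (fun y => g.comp y j l) x + partialDeriv j (fun y => g.comp y i l) x
        - partialDeriv l (fun y => g.comp y i j) x) := by
  have hinv : g.comp x * (g.comp x)⁻¹ = 1 :=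
    Matrix.mul_nonsing_inv _ (isUnit_iff_ne_zero.2 (g.lorentzian x).ne)
  have h : ∀ a b, ∑ k, g.comp x a k * (g.comp x)⁻¹ k b = (1 : Matrix (Fin 2) (Fin 2) ℝ) a b := by
    intro a b; rw [← hinv, Matrix.mul_apply]
  have h0 := h l 0
  have h1 := h l 1
  simp only [Fin.sum_univ_two] at h0 h1
  simp only [christoffel, Fin.sum_univ_two]
  set A := fun m : Fin 2 =>
    (partialDeriv i (fun y => g.comp y j m) x + partialDeriv j (fun y => g.comp y i m) x
      - partialDeriv m (fun y => g.comp y i j) x) with hA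
  have e : (1 / 2) * A l = (1 / 2) * ((1 : Matrix (Fin 2) (Fin 2) ℝ) l 0 * A 0
      + (1 : Matrix (Fin 2) (Fin 2) ℝ) l 1 * A 1) := by
    fin_cases l <;> simp [Matrix.one_apply]
  change _ = 1 / 2 * A l
  rw [e, ← h0, ← h1]
  ring

/-- The Levi-Civita connection is metric. -/
theorem partialDeriv_comp (l i j x) :
    partialDeriv l (fun y => g.comp y i j) x =
      ∑ k, (g.christoffel k l i x * g.comp x k j + g.christoffel k l j x * g.comp x i k) := by
  have h1 := g.sum_comp_mul_christoffel j l i x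
  have h2 := g.sum_comp_mul_christoffel i l j x
  have e : ∀ a b, (fun y => g.comp y a b) = fun y => g.comp y b a :=
    fun a b => funext fun y => g.comp_symm y a b
  rw [e i j] at h1
  rw [e l j, e j i] at h2
  rw [e l i] at h1
  rw [Finset.sum_add_distrib]
  have h3 : ∑ k, g.christoffel k l i x * g.comp x k j
      = ∑ k, g.comp x j k * g.christoffel k l i x :=
    Finset.sum_congr rfl fun k _ => by rw [g.comp_symm x k j]; ring
  have h4 : ∑ k, g.christoffel k l j x * g.comp x i k
      = ∑ k, g.comp x i k * g.christoffel k l j x :=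
    Finset.sum_congr rfl fun k _ => by ring
  rw [h3, h4, h1, h2, e j i, e l j, e l i]
  ring

end LorentzMetric

/-- If the symmetric product of `a` and `b` is annihilated by a derivation sending `a` to `S` and
`b` to `T`, then `S` and `T` are opposite multiples of `a` and `b`. -/
theorem exists_opposite_multiples {a b S T : Fin 2 → ℝ} (hw : a 0 * b 1 - a 1 * b 0 ≠ 0)
    (h : ∀ i j, S i * b j + S j * b i + a i * T j + a j * T i = 0) :
    (∀ i, S i = (S 0 * b 1 - S 1 * b 0) / (a 0 * b 1 - a 1 * b 0) * a i) ∧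
    (∀ i, T i = -((S 0 * b 1 - S 1 * b 0) / (a 0 * b 1 - a 1 * b 0)) * b i) := by
  have h00 := h 0 0
  have h01 := h 0 1
  have h11 := h 1 1
  -- `S` vanishes on the kernel of `a`, and `T` on the kernel of `b`
  have hS : S 0 * a 1 = S 1 * a 0 := by
    apply mul_right_cancel₀ hw
    linear_combination -(a 1 * a 1 / 2) * h00 + a 0 * a 1 * h01 - (a 0 * a 0 / 2) * h11
  have hT : T 0 * b 1 = T 1 * b 0 := by
    apply mul_right_cancel₀ hw
    linear_combination (b 1 * b 1 / 2) * h00 - b 0 * b 1 * h01 + (b 0 * b 0 / 2) * h11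
  have key : T 0 * a 1 - T 1 * a 0 = S 0 * b 1 - S 1 * b 0 := by
    apply mul_right_cancel₀ hw
    linear_combination a 1 * b 1 * h00 - (a 0 * b 1 + a 1 * b 0) * h01 + a 0 * b 0 * h11
  constructor
  · intro i
    rw [div_mul_eq_mul_div, eq_div_iff hw]
    fin_cases i
    · simp; linear_combination -b 0 * hS
    · simp; linear_combination -b 1 * hS
  · intro i
    rw [← key, ← neg_div, div_mul_eq_mul_div, eq_div_iff hw]
    fin_cases i
    · simp; linear_combination a 0 * hT
    · simp; linear_combination a 1 * hT

/-! ### Null coframes -/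

/-- A smooth closed one-form on the torus. -/
structure IsClosedForm (a : Torus → Plane) : Prop where
  smooth : ∀ i, IsSmooth fun x => a x i
  closed : ∀ x, partialDeriv 0 (fun y => a y 1) x = partialDeriv 1 (fun y => a y 0) x

theorem IsClosedForm.partialDeriv_comm {a : Torus → Plane} (ha : IsClosedForm a) (i j x) :
    partialDeriv i (fun y => a y j) x = partialDeriv j (fun y => a y i) x := by
  fin_cases i <;> fin_cases j
  exacts [rfl, ha.closed x, (ha.closed x).symm, rfl]

theorem IsClosedForm.pd_comm {a : Torus → Plane} (ha : IsClosedForm a) (i j p) :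
    pd i (fun q => a (proj q) j) p = pd j (fun q => a (proj q) i) p := by
  rw [← partialDeriv_proj (ha.smooth j), ← partialDeriv_proj (ha.smooth i)]
  exact ha.partialDeriv_comm i j _

/-- The metric is `Ω` times the symmetric product of the closed one-forms `a` and `b`. -/
structure LorentzMetric.IsNullCoframe (g : LorentzMetric) (Ω : Torus → ℝ) (a b : Torus → Plane) :
    Prop where
  smooth : IsSmooth Ω
  pos : ∀ x, 0 < Ω x
  left : IsClosedForm a
  right : IsClosedForm b
  comp_eq : ∀ x i j, g.comp x i j = Ω x * (a x i * b x j + a x j * b x i)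

namespace LorentzMetric

variable {g : LorentzMetric}

/-- A null coframe is parallel up to opposite connection forms. -/
theorem exists_connection_form {a b : Plane → Plane} (ha : ∀ i, ContDiff ℝ ∞ fun p => a p i)
    (hb : ∀ i, ContDiff ℝ ∞ fun p => b p i)
    (hg : ∀ p i j, g.comp (proj p) i j = a p i * b p j + a p j * b p i) :
    ∃ ν : Plane → Plane, (∀ l, ContDiff ℝ ∞ fun p => ν p l) ∧ ∀ p l i,
      pd l (fun q => a q i) p = ∑ k, g.christoffel k l i (proj p) * a p k + ν p l * a p i ∧
      pd l (fun q => b q i) p = ∑ k, g.christoffel k l i (proj p) * b p k - ν p l * b p i := by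
  have hw : ∀ p, a p 0 * b p 1 - a p 1 * b p 0 ≠ 0 := by
    intro p h0
    have := g.comp_det (proj p)
    rw [hg, hg, hg] at this
    nlinarith
  have hΓ : ∀ k l i, ContDiff ℝ ∞ fun p => g.christoffel k l i (proj p) :=
    fun k l i => g.christoffel_smooth k l i
  set S : Plane → Fin 2 → Fin 2 → ℝ := fun p l i =>
    pd l (fun q => a q i) p - ∑ k, g.christoffel k l i (proj p) * a p k with hS
  set T : Plane → Fin 2 → Fin 2 → ℝ := fun p l i =>
    pd l (fun q => b q i) p - ∑ k, g.christoffel k l i (proj p) * b p k with hT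
  -- Here `S` and `T` are the covariant derivatives of `a` and `b`; metric compatibility is the
  -- derivation identity that makes them opposite multiples.
  have hST : ∀ p l i j, S p l i * b p j + S p l j * b p i + a p i * T p l j + a p j * T p l i
      = 0 := by
    intro p l i j
    have h := g.partialDeriv_comp l i j (proj p)
    rw [partialDeriv_proj (g.smooth i j)] at h
    simp only [hg] at h
    rw [pd_add ((ha i).mul (hb j)) ((ha j).mul (hb i)), pd_mul (ha i) (hb j),
      pd_mul (ha j) (hb i)] at h
    simp only [hS, hT, Fin.sum_univ_two] at h ⊢
    linear_combination h
  have hSs : ∀ l i, ContDiff ℝ ∞ fun p => S p l i := by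
    intro l i
    refine (contDiff_pd (ha i) l).sub (ContDiff.sum fun k _ => (hΓ k l i).mul (ha k))
  refine ⟨fun p l => (S p l 0 * b p 1 - S p l 1 * b p 0) / (a p 0 * b p 1 - a p 1 * b p 0),
    fun l => ContDiff.div ?_ ?_ hw, fun p l i => ?_⟩
  · exact ((hSs l 0).mul (hb 1)).sub ((hSs l 1).mul (hb 0))
  · exact ((ha 0).mul (hb 1)).sub ((ha 1).mul (hb 0))
  · obtain ⟨h1, h2⟩ := exists_opposite_multiples (hw p) (hST p l)
    have h1 := h1 i
    have h2 := h2 i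
    constructor
    · rw [← h1]; simp [hS]
    · rw [sub_eq_add_neg, ← neg_mul, ← h2]; simp [hT]

/-- Equality of mixed second derivatives of a parallel form says that the curvature contracted with
it vanishes; two independent forms leave no room for curvature. -/
theorem isFlat_of_parallel {a b : Plane → Plane} (ha : ∀ i, ContDiff ℝ ∞ fun p => a p i)
    (hb : ∀ i, ContDiff ℝ ∞ fun p => b p i) (hw : ∀ p, a p 0 * b p 1 - a p 1 * b p 0 ≠ 0)
    (hpa : ∀ p l i, pd l (fun q => a q i) p = ∑ k, g.christoffel k l i (proj p) * a p k)
    (hpb : ∀ p l i, pd l (fun q => b q i) p = ∑ k, g.christoffel k l i (proj p) * b p k) :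
    g.IsFlat := by
  have hΓ : ∀ k l i, ContDiff ℝ ∞ fun p => g.christoffel k l i (proj p) :=
    fun k l i => g.christoffel_smooth k l i
  have key : ∀ {a : Plane → Plane}, (∀ i, ContDiff ℝ ∞ fun p => a p i) →
      (∀ p l i, pd l (fun q => a q i) p = ∑ k, g.christoffel k l i (proj p) * a p k) →
      ∀ p k i j, g.curvature 0 k i j (proj p) * a p 0 + g.curvature 1 k i j (proj p) * a p 1
        = 0 := by
    intro a ha hpa p k i j
    have e : ∀ l i, pd l (fun q => a q i) = fun p => g.christoffel 0 l i (proj p) * a p 0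
        + g.christoffel 1 l i (proj p) * a p 1 := by
      intro l i; funext p; rw [hpa, Fin.sum_univ_two]
    have h := pd_comm (ha k) i j p
    rw [e, e] at h
    rw [pd_add ((hΓ _ _ _).mul (ha _)) ((hΓ _ _ _).mul (ha _)),
      pd_add ((hΓ _ _ _).mul (ha _)) ((hΓ _ _ _).mul (ha _)),
      pd_mul (hΓ _ _ _) (ha _), pd_mul (hΓ _ _ _) (ha _),
      pd_mul (hΓ _ _ _) (ha _), pd_mul (hΓ _ _ _) (ha _)] at h
    simp only [hpa, Fin.sum_univ_two] at h
    simp only [curvature, Fin.sum_univ_two, partialDeriv_proj (g.christoffel_smooth _ _ _)]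
    linear_combination h
  intro l k i j x
  obtain ⟨p, rfl⟩ := proj_surjective x
  have h1 := key ha hpa p k i j
  have h2 := key hb hpb p k i j
  have hw := hw p
  fin_cases l
  · apply mul_right_cancel₀ hw
    simp only [Fin.zero_eta]
    linear_combination b p 1 * h1 - a p 1 * h2
  · apply mul_right_cancel₀ hw
    simp only [Fin.mk_one]
    linear_combination a p 0 * h2 - b p 0 * h1

theorem IsNullCoframe.wedge_ne_zero {Ω a b} (h : g.IsNullCoframe Ω a b) (x) :
    a x 0 * b x 1 - a x 1 * b x 0 ≠ 0 := by
  intro h0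
  have := g.comp_det x
  simp only [h.comp_eq] at this
  have e : Ω x * (a x 0 * b x 0 + a x 0 * b x 0) * (Ω x * (a x 1 * b x 1 + a x 1 * b x 1)) -
    Ω x * (a x 0 * b x 1 + a x 1 * b x 0) * (Ω x * (a x 0 * b x 1 + a x 1 * b x 0)) =
    - (Ω x)^2 * (a x 0 * b x 1 - a x 1 * b x 0)^2 := by ring
  rw [e, h0] at this
  simp at this

/-- The symmetric product of two closed one-forms is flat. -/
theorem IsNullCoframe.isFlat {a b} (h : g.IsNullCoframe (fun _ => 1) a b) : g.IsFlat := by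
  have ha := h.left.smooth
  have hb := h.right.smooth
  obtain ⟨ν, -, hν⟩ := exists_connection_form (g := g) (a := fun p => a (proj p))
    (b := fun p => b (proj p)) ha hb (fun p i j => by simpa using h.comp_eq (proj p) i j)
  -- The connection has no torsion, so closedness of `a` and `b` reads `ν ∧ a = 0` and `ν ∧ b = 0`;
  -- since `a` and `b` are independent, `ν = 0`.
  have hν0 : ∀ p l, ν p l = 0 := by
    intro p
    have h1 := (hν p 0 1).1
    have h2 := (hν p 1 0).1
    have h3 := (hν p 0 1).2
    have h4 := (hν p 1 0).2
    have hw := h.wedge_ne_zero (proj p)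
    simp only [Fin.sum_univ_two] at h1 h2 h3 h4
    rw [h.left.pd_comm, g.christoffel_symm 0 0 1, g.christoffel_symm 1 0 1] at h1
    rw [h.right.pd_comm, g.christoffel_symm 0 0 1, g.christoffel_symm 1 0 1] at h3
    have e1 : ν p 0 * a (proj p) 1 = ν p 1 * a (proj p) 0 := by linear_combination h2 - h1
    have e2 : ν p 0 * b (proj p) 1 = ν p 1 * b (proj p) 0 := by linear_combination h3 - h4
    intro l
    fin_cases l
    · apply mul_right_cancel₀ hw
      simp only [Fin.zero_eta]
      linear_combination a (proj p) 0 * e2 - b (proj p) 0 * e1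
    · apply mul_right_cancel₀ hw
      simp only [Fin.mk_one]
      linear_combination a (proj p) 1 * e2 - b (proj p) 1 * e1
  refine isFlat_of_parallel (a := fun p => a (proj p)) (b := fun p => b (proj p)) ha hb
    (fun p => h.wedge_ne_zero (proj p)) (fun p l i => ?_) (fun p l i => ?_)
  · rw [(hν p l i).1, hν0]; simp
  · rw [(hν p l i).2, hν0]; simp

/-- The metric with components `Ω g`. -/
def conformal (g : LorentzMetric) (Ω : Torus → ℝ) (hΩ : IsSmooth Ω) (h0 : ∀ x, 0 < Ω x) :
    LorentzMetric where
  comp x := Ω x • g.comp x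
  smooth i j := hΩ.mul (g.smooth i j)
  symm x := by
    have := g.symm x
    unfold Matrix.IsSymm at this ⊢
    rw [Matrix.transpose_smul, this]
  lorentzian x := by
    rw [Matrix.det_smul]
    exact mul_neg_of_pos_of_neg (pow_pos (h0 x) _) (g.lorentzian x)

theorem IsNullCoframe.isConformallyFlat {Ω a b} (h : g.IsNullCoframe Ω a b) :
    g.IsConformallyFlat := by
  have hne : ∀ x, Ω x ≠ 0 := fun x => (h.pos x).ne'
  set g₀ := g.conformal (fun x => (Ω x)⁻¹) (h.smooth.inv hne) (fun x => inv_pos.2 (h.pos x))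
    with hg₀
  have h₀ : g₀.IsNullCoframe (fun _ => 1) a b :=
    ⟨IsSmooth.const 1, fun _ => one_pos, h.left, h.right, fun x i j => by
      simp only [hg₀, conformal, Matrix.smul_apply, smul_eq_mul, h.comp_eq]
      rw [← mul_assoc, inv_mul_cancel₀ (hne x)]⟩
  refine ⟨g₀, h₀.isFlat, Ω, h.smooth, h.pos, fun x => ?_⟩
  simp only [hg₀, conformal]
  rw [smul_smul, mul_inv_cancel₀ (hne x), one_smul]

theorem IsConformalTo.isNullCoframe {g₀ : LorentzMetric} (h : g.IsConformalTo g₀) {a b}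
    (h₀ : g₀.IsNullCoframe (fun _ => 1) a b) : ∃ Ω, g.IsNullCoframe Ω a b := by
  obtain ⟨Ω, hs, hp, hΩ⟩ := h
  refine ⟨Ω, hs, hp, h₀.left, h₀.right, fun x i j => ?_⟩
  rw [hΩ, Matrix.smul_apply, smul_eq_mul, h₀.comp_eq, one_mul]

/-! ### Conformal fields dual to a null coframe -/

/-- The vector field on which the one-forms `a` and `b` take the constant values `r` and `s`. -/
def dualField (a b : Torus → Plane) (r s : ℝ) (x : Torus) : Plane :=
  ![(r * b x 1 - s * a x 1) / (a x 0 * b x 1 - a x 1 * b x 0),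
    (s * a x 0 - r * b x 0) / (a x 0 * b x 1 - a x 1 * b x 0)]

section dual
variable {Ω : Torus → ℝ} {a b : Torus → Plane}

theorem IsNullCoframe.dualField_smooth (h : g.IsNullCoframe Ω a b) (r s k) :
    IsSmooth fun x => dualField a b r s x k := by
  have ha := h.left.smooth
  have hb := h.right.smooth
  have hw : IsSmooth fun x => a x 0 * b x 1 - a x 1 * b x 0 :=
    ((ha 0).mul (hb 1)).sub ((ha 1).mul (hb 0))
  fin_cases k
  · exact ((((IsSmooth.const r).mul (hb 1)).sub ((IsSmooth.const s).mul (ha 1))).div hw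
      h.wedge_ne_zero)
  · exact ((((IsSmooth.const s).mul (ha 0)).sub ((IsSmooth.const r).mul (hb 0))).div hw
      h.wedge_ne_zero)

theorem IsNullCoframe.left_dualField (h : g.IsNullCoframe Ω a b) (r s x) :
    a x 0 * dualField a b r s x 0 + a x 1 * dualField a b r s x 1 = r := by
  have := h.wedge_ne_zero x
  simp only [dualField, Matrix.cons_val_zero, Matrix.cons_val_one]
  rw [mul_div_assoc', mul_div_assoc', ← add_div, div_eq_iff this]
  ring

theorem IsNullCoframe.right_dualField (h : g.IsNullCoframe Ω a b) (r s x) :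
    b x 0 * dualField a b r s x 0 + b x 1 * dualField a b r s x 1 = s := by
  have := h.wedge_ne_zero x
  simp only [dualField, Matrix.cons_val_zero, Matrix.cons_val_one]
  rw [mul_div_assoc', mul_div_assoc', ← add_div, div_eq_iff this]
  ring

theorem IsNullCoframe.inner_eq (h : g.IsNullCoframe Ω a b) (x u w) : g.inner x u w =
    Ω x * ((a x 0 * u 0 + a x 1 * u 1) * (b x 0 * w 0 + b x 1 * w 1)
      + (a x 0 * w 0 + a x 1 * w 1) * (b x 0 * u 0 + b x 1 * u 1)) := by
  simp only [inner, Fin.sum_univ_two, h.comp_eq]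
  ring

/-- By Cartan's formula `L_K a = d(a(K)) + ι_K da = 0`, and likewise for `b`, so `L_K` only
differentiates `Ω`. This is why `σ = K(Ω) / (2 Ω)`. -/
theorem IsNullCoframe.isConformalField_dualField (h : g.IsNullCoframe Ω a b) (r s) :
    g.IsConformalField (dualField a b r s) := by
  set K := dualField a b r s with hK
  have hKs := h.dualField_smooth r s
  have ha := h.left.smooth
  have hb := h.right.smooth
  refine ⟨hKs, fun x => (K x 0 * partialDeriv 0 Ω x + K x 1 * partialDeriv 1 Ω x) / (2 * Ω x),
    ?_, ?_⟩
  · exact (((hKs 0).mul (h.smooth.partialDeriv 0)).add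
      ((hKs 1).mul (h.smooth.partialDeriv 1))).div ((IsSmooth.const 2).mul h.smooth)
      (fun x => (mul_pos two_pos (h.pos x)).ne')
  · intro i j x
    have hd : ∀ {c : Torus → Plane} {r : ℝ}, (∀ i, IsSmooth fun x => c x i) →
        (∀ x, c x 0 * K x 0 + c x 1 * K x 1 = r) → ∀ i,
        c x 0 * partialDeriv i (fun y => K y 0) x + c x 1 * partialDeriv i (fun y => K y 1) x
          + (K x 0 * partialDeriv i (fun y => c y 0) x
            + K x 1 * partialDeriv i (fun y => c y 1) x) = 0 := by
      intro c r hc hcr i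
      have e : (fun x => c x 0 * K x 0 + c x 1 * K x 1) = fun _ => r := funext hcr
      have h1 := partialDeriv_add ((hc 0).mul (hKs 0)) ((hc 1).mul (hKs 1)) i x
      rw [e, partialDeriv_const, partialDeriv_mul (hc 0) (hKs 0),
        partialDeriv_mul (hc 1) (hKs 1)] at h1
      linear_combination -h1
    have hai := hd ha (h.left_dualField r s)
    have hbi := hd hb (h.right_dualField r s)
    -- Closedness is used to swap the two indices in each derivative of `a` and `b`; the terms then
    -- match the differentiated constants `a(K)` and `b(K)`.
    have hg : ∀ k i j, partialDeriv k (fun y => g.comp y i j) x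
        = partialDeriv k Ω x * (a x i * b x j + a x j * b x i)
          + Ω x * (partialDeriv i (fun y => a y k) x * b x j
              + a x i * partialDeriv j (fun y => b y k) x
            + (partialDeriv j (fun y => a y k) x * b x i
              + a x j * partialDeriv i (fun y => b y k) x)) := by
      intro k i j
      have e : (fun y => g.comp y i j) = fun y => Ω y * (a y i * b y j + a y j * b y i) :=
        funext fun y => h.comp_eq y i j
      rw [e, partialDeriv_mul h.smooth (((ha i).mul (hb j)).add ((ha j).mul (hb i))),
        partialDeriv_add ((ha i).mul (hb j)) ((ha j).mul (hb i)),
        partialDeriv_mul (ha i) (hb j), partialDeriv_mul (ha j) (hb i),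
        h.left.partialDeriv_comm k i, h.left.partialDeriv_comm k j,
        h.right.partialDeriv_comm k i, h.right.partialDeriv_comm k j]
    have hΩ := (h.pos x).ne'
    simp only [lieDeriv, Fin.sum_univ_two, hg]
    simp only [h.comp_eq]
    have e2 : 2 * ((K x 0 * partialDeriv 0 Ω x + K x 1 * partialDeriv 1 Ω x) / (2 * Ω x)) *
        (Ω x * (a x i * b x j + a x j * b x i))
        = (K x 0 * partialDeriv 0 Ω x + K x 1 * partialDeriv 1 Ω x)
          * (a x i * b x j + a x j * b x i) := by
      field_simp
    rw [e2]
    linear_combination Ω x * b x j * hai i + Ω x * b x i * hai j + Ω x * a x j * hbi i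
      + Ω x * a x i * hbi j

theorem IsNullCoframe.inner_dualField (h : g.IsNullCoframe Ω a b) (r s x) :
    g.inner x (dualField a b r s x) (dualField a b r s x) = 2 * Ω x * r * s := by
  rw [h.inner_eq, h.left_dualField, h.right_dualField]; ring

end dual

end LorentzMetric

/-! ### From nowhere lightlike conformal fields to null coframes -/

theorem IsClosedForm.add {a b : Torus → Plane} (ha : IsClosedForm a) (hb : IsClosedForm b) :
    IsClosedForm (fun x => a x + b x) where
  smooth i := (ha.smooth i).add (hb.smooth i)
  closed x := by
    simp only [Pi.add_apply]
    rw [partialDeriv_add (ha.smooth _) (hb.smooth _), partialDeriv_add (ha.smooth _) (hb.smooth _),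
      ha.closed, hb.closed]

theorem IsClosedForm.const_smul {a : Torus → Plane} (ha : IsClosedForm a) (r : ℝ) :
    IsClosedForm (fun x => r • a x) where
  smooth i := (IsSmooth.const r).mul (ha.smooth i)
  closed x := by
    simp only [Pi.smul_apply, smul_eq_mul]
    rw [partialDeriv_const_mul (ha.smooth _), partialDeriv_const_mul (ha.smooth _), ha.closed]

theorem IsClosedForm.const (u : Plane) : IsClosedForm (fun _ => u) where
  smooth i := IsSmooth.const _
  closed x := by rw [partialDeriv_const, partialDeriv_const]

namespace LorentzMetric

variable {g : LorentzMetric}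

/-- A conformal field which is nowhere lightlike gives rise to a null coframe. -/
theorem IsConformalField.exists_isNullCoframe {K : Torus → Plane} (hK : g.IsConformalField K)
    {ε : ℝ} (hε : ε * ε = 1) (hpos : ∀ x, 0 < ε * g.inner x (K x) (K x)) :
    ∃ Ω a b, g.IsNullCoframe Ω a b := by
  obtain ⟨hKs, σ, -, hσ⟩ := hK
  have hg := g.smooth
  set n : Torus → ℝ := fun x => g.comp x 0 0 * (K x 0 * K x 0)
    + 2 * (g.comp x 0 1 * (K x 0 * K x 1)) + g.comp x 1 1 * (K x 1 * K x 1) with hn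
  have hinner : ∀ x, g.inner x (K x) (K x) = n x := by
    intro x
    simp only [inner, Fin.sum_univ_two, hn, g.comp_symm x 1 0]
    ring
  have hn0 : ∀ x, n x ≠ 0 := by
    intro x h0
    have := hpos x
    rw [hinner, h0] at this
    simp at this
  have h00 := (hg 0 0).mul ((hKs 0).mul (hKs 0))
  have h01 := (IsSmooth.const 2).mul ((hg 0 1).mul ((hKs 0).mul (hKs 1)))
  have h11 := (hg 1 1).mul ((hKs 1).mul (hKs 1))
  have hns : IsSmooth n := (h00.add h01).add h11
  set M : Torus → ℝ := fun x => (n x)⁻¹ with hM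
  have hMs : IsSmooth M := hns.inv hn0
  have hnM : ∀ x, n x * M x = 1 := fun x => mul_inv_cancel₀ (hn0 x)
  set D : Torus → ℝ := fun x => g.comp x 0 1 * g.comp x 0 1 - g.comp x 0 0 * g.comp x 1 1 with hD
  have hDs : IsSmooth D := ((hg 0 1).mul (hg 0 1)).sub ((hg 0 0).mul (hg 1 1))
  have hD0 : ∀ x, 0 < D x := fun x => by have := g.comp_det x; simp only [hD]; linarith
  set R : Torus → ℝ := fun x => √(D x) with hR
  have hRs : IsSmooth R := hDs.sqrt hD0
  have hRR : ∀ x, R x * R x = D x := fun x => Real.mul_self_sqrt (hD0 x).le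
  have hR0 : ∀ x, R x ≠ 0 := fun x => (Real.sqrt_pos.2 (hD0 x)).ne'
  -- derivatives
  have dM : ∀ i x, partialDeriv i n x * M x + n x * partialDeriv i M x = 0 := by
    intro i x
    rw [← partialDeriv_mul hns hMs, funext hnM, partialDeriv_const]
  have dR : ∀ i x, 2 * R x * partialDeriv i R x = partialDeriv i D x := by
    intro i x
    rw [← funext hRR, partialDeriv_mul hRs hRs]; ring
  have dD : ∀ i x, partialDeriv i D x = 2 * g.comp x 0 1 * partialDeriv i (fun y => g.comp y 0 1) x
      - partialDeriv i (fun y => g.comp y 0 0) x * g.comp x 1 1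
      - g.comp x 0 0 * partialDeriv i (fun y => g.comp y 1 1) x := by
    intro i x
    simp only [hD]
    rw [partialDeriv_sub ((hg 0 1).mul (hg 0 1)) ((hg 0 0).mul (hg 1 1)),
      partialDeriv_mul (hg 0 1) (hg 0 1), partialDeriv_mul (hg 0 0) (hg 1 1)]
    ring
  have dn : ∀ i x, partialDeriv i n x = partialDeriv i (fun y => g.comp y 0 0) x * (K x 0 * K x 0)
      + 2 * partialDeriv i (fun y => g.comp y 0 1) x * (K x 0 * K x 1)
      + partialDeriv i (fun y => g.comp y 1 1) x * (K x 1 * K x 1)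
      + 2 * (g.comp x 0 0 * K x 0 + g.comp x 0 1 * K x 1) * partialDeriv i (fun y => K y 0) x
      + 2 * (g.comp x 0 1 * K x 0 + g.comp x 1 1 * K x 1) * partialDeriv i (fun y => K y 1) x := by
    intro i x
    simp only [hn]
    rw [partialDeriv_add (h00.add h01) h11, partialDeriv_add h00 h01,
      partialDeriv_const_mul ((hg 0 1).mul ((hKs 0).mul (hKs 1))),
      partialDeriv_mul (hg 0 0) ((hKs 0).mul (hKs 0)),
      partialDeriv_mul (hg 0 1) ((hKs 0).mul (hKs 1)),
      partialDeriv_mul (hg 1 1) ((hKs 1).mul (hKs 1)),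
      partialDeriv_mul (hKs 0) (hKs 0), partialDeriv_mul (hKs 0) (hKs 1),
      partialDeriv_mul (hKs 1) (hKs 1)]
    ring
  have hE : ∀ i j x, g.lieDeriv K i j x - 2 * σ x * g.comp x i j = 0 :=
    fun i j x => sub_eq_zero.2 (hσ i j x)
  simp only [lieDeriv, Fin.sum_univ_two] at hE
  -- the metric dual of the normalized field is closed
  set L : Torus → Plane := fun x => ![g.comp x 0 0 * K x 0 + g.comp x 0 1 * K x 1,
    g.comp x 0 1 * K x 0 + g.comp x 1 1 * K x 1] with hL
  have hLs : ∀ i, IsSmooth fun x => L x i := by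
    intro i
    fin_cases i
    · exact ((hg 0 0).mul (hKs 0)).add ((hg 0 1).mul (hKs 1))
    · exact ((hg 0 1).mul (hKs 0)).add ((hg 1 1).mul (hKs 1))
  have dL0 : ∀ i x, partialDeriv i (fun y => L y 0) x
      = partialDeriv i (fun y => g.comp y 0 0) x * K x 0
        + g.comp x 0 0 * partialDeriv i (fun y => K y 0) x
        + (partialDeriv i (fun y => g.comp y 0 1) x * K x 1
        + g.comp x 0 1 * partialDeriv i (fun y => K y 1) x) := by
    intro i x
    change partialDeriv i (fun y => g.comp y 0 0 * K y 0 + g.comp y 0 1 * K y 1) x = _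
    rw [partialDeriv_add ((hg 0 0).mul (hKs 0)) ((hg 0 1).mul (hKs 1)),
      partialDeriv_mul (hg 0 0) (hKs 0), partialDeriv_mul (hg 0 1) (hKs 1)]
  have dL1 : ∀ i x, partialDeriv i (fun y => L y 1) x
      = partialDeriv i (fun y => g.comp y 0 1) x * K x 0
        + g.comp x 0 1 * partialDeriv i (fun y => K y 0) x
        + (partialDeriv i (fun y => g.comp y 1 1) x * K x 1
        + g.comp x 1 1 * partialDeriv i (fun y => K y 1) x) := by
    intro i x
    change partialDeriv i (fun y => g.comp y 0 1 * K y 0 + g.comp y 1 1 * K y 1) x = _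
    rw [partialDeriv_add ((hg 0 1).mul (hKs 0)) ((hg 1 1).mul (hKs 1)),
      partialDeriv_mul (hg 0 1) (hKs 0), partialDeriv_mul (hg 1 1) (hKs 1)]
  -- This is `θ = g(K, ·) / n`. Since `K` is Killing for `g / n` and `θ(K) = 1`, `ι_K dθ = L_K θ -
  -- d(θ(K)) = 0`; a two-form on a plane annihilated by `K ≠ 0` vanishes. Below, `Q` is the
  -- coefficient of `dθ`, and multiplying it by each component of `K` expresses `ι_K dθ = 0`.
  have hθ : IsClosedForm (fun x => M x • L x) := by
    refine ⟨fun i => hMs.mul (hLs i), fun x => ?_⟩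
    simp only [Pi.smul_apply, smul_eq_mul]
    rw [partialDeriv_mul hMs (hLs 1), partialDeriv_mul hMs (hLs 0), ← sub_eq_zero]
    set Q := partialDeriv 0 M x * L x 1 + M x * partialDeriv 0 (fun y => L y 1) x -
      (partialDeriv 1 M x * L x 0 + M x * partialDeriv 1 (fun y => L y 0) x) with hQ
    have hQ2 : n x * n x * Q = n x * (partialDeriv 0 (fun y => L y 1) x
        - partialDeriv 1 (fun y => L y 0) x)
        - partialDeriv 0 n x * L x 1 + partialDeriv 1 n x * L x 0 := by
      simp only [hQ]
      linear_combination n x * L x 1 * dM 0 x - n x * L x 0 * dM 1 x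
        + (n x * (partialDeriv 0 (fun y => L y 1) x - partialDeriv 1 (fun y => L y 0) x)
          - partialDeriv 0 n x * L x 1 + partialDeriv 1 n x * L x 0) * hnM x
    have e00 := hE 0 0 x
    have e01 := hE 0 1 x
    have e11 := hE 1 1 x
    simp only [g.comp_symm x 1 0] at e00 e01 e11
    have hL0 : L x 0 = g.comp x 0 0 * K x 0 + g.comp x 0 1 * K x 1 := rfl
    have hL1 : L x 1 = g.comp x 0 1 * K x 0 + g.comp x 1 1 * K x 1 := rfl
    have hnx : n x = g.comp x 0 0 * (K x 0 * K x 0) + 2 * (g.comp x 0 1 * (K x 0 * K x 1))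
      + g.comp x 1 1 * (K x 1 * K x 1) := rfl
    have hK0 : K x 0 * (n x * n x * Q) = 0 := by
      rw [hQ2, dL0, dL1, dn, dn]
      rw [hL0, hL1, hnx]
      linear_combination (g.comp x 0 0 * (K x 0 * K x 0) + 2 * (g.comp x 0 1 * (K x 0 * K x 1))
        + g.comp x 1 1 * (K x 1 * K x 1)) *
        (K x 0 * e01 + K x 1 * e11)
        - (g.comp x 0 1 * K x 0 + g.comp x 1 1 * K x 1) * (K x 0 * K x 0 * e00
        + 2 * K x 0 * K x 1 * e01 + K x 1 * K x 1 * e11)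
    have hK1 : K x 1 * (n x * n x * Q) = 0 := by
      rw [hQ2, dL0, dL1, dn, dn]
      rw [hL0, hL1, hnx]
      linear_combination -((g.comp x 0 0 * (K x 0 * K x 0) + 2 * (g.comp x 0 1 * (K x 0 * K x 1))
        + g.comp x 1 1 * (K x 1 * K x 1)) *
        (K x 0 * e00 + K x 1 * e01))
        + (g.comp x 0 0 * K x 0 + g.comp x 0 1 * K x 1) * (K x 0 * K x 0 * e00
        + 2 * K x 0 * K x 1 * e01 + K x 1 * K x 1 * e11)
    by_contra hne
    have hnn : n x * n x * Q ≠ 0 := mul_ne_zero (mul_ne_zero (hn0 x) (hn0 x)) hne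
    have k0 := (mul_eq_zero.1 hK0).resolve_right hnn
    have k1 := (mul_eq_zero.1 hK1).resolve_right hnn
    apply hn0 x
    simp only [hn, k0, k1]; ring
  -- Up to sign, this is `K` contracted with the area form of `g / n`, so it is closed because `K`
  -- preserves that area.
  have hψ : IsClosedForm (fun x => ![-(M x * (R x * K x 1)), M x * (R x * K x 0)]) := by
    have h0 := hMs.mul (hRs.mul (hKs 0))
    have h1 := hMs.mul (hRs.mul (hKs 1))
    refine ⟨fun i => ?_, fun x => ?_⟩
    · fin_cases i
      exacts [h1.neg, h0]
    · simp only [Matrix.cons_val_zero, Matrix.cons_val_one]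
      rw [partialDeriv_neg h1, partialDeriv_mul hMs (hRs.mul (hKs 0)),
        partialDeriv_mul hMs (hRs.mul (hKs 1)), partialDeriv_mul hRs (hKs 0),
        partialDeriv_mul hRs (hKs 1)]
      have e00 := hE 0 0 x
      have e01 := hE 0 1 x
      have e11 := hE 1 1 x
      simp only [g.comp_symm x 1 0] at e00 e01 e11
      -- The invariance of `D / n²` as a squared density: `K(D) + 2 D div K = 4 σ D` and `K(n) = 2 σ
      -- n`, with `σ` eliminated.
      have key : n x * (K x 0 * partialDeriv 0 D x + K x 1 * partialDeriv 1 D x)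
          + 2 * D x * n x * (partialDeriv 0 (fun y => K y 0) x + partialDeriv 1 (fun y => K y 1) x)
          - 2 * D x * (K x 0 * partialDeriv 0 n x + K x 1 * partialDeriv 1 n x) = 0 := by
        rw [dn, dn, dD, dD]
        linear_combination n x * (2 * g.comp x 0 1 * e01 - g.comp x 1 1 * e00
          - g.comp x 0 0 * e11) - 2 * D x * (K x 0 * K x 0 * e00
          + 2 * K x 0 * K x 1 * e01 + K x 1 * K x 1 * e11)
      have hne : 2 * R x * n x * n x ≠ 0 :=
        mul_ne_zero (mul_ne_zero (mul_ne_zero two_ne_zero (hR0 x)) (hn0 x)) (hn0 x)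
      apply mul_left_cancel₀ hne
      rw [← sub_eq_zero]
      rw [← dR, ← dR, ← hRR] at key
      linear_combination key + 2 * R x * n x * R x * (K x 0 * dM 0 x + K x 1 * dM 1 x)
        + (2 * R x * n x * (partialDeriv 0 R x * K x 0 + R x * partialDeriv 0 (fun y => K y 0) x
          + partialDeriv 1 R x * K x 1 + R x * partialDeriv 1 (fun y => K y 1) x)
          - 2 * R x * R x * (K x 0 * partialDeriv 0 n x + K x 1 * partialDeriv 1 n x)) * hnM x
  -- From `g = n (θ² - ψ²)`: the factors are `θ + ψ` and `θ - ψ`, the `1/2` accounts for the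
  -- symmetrization, and the two signs `ε` make the conformal factor positive without changing the
  -- product.
  refine ⟨fun x => ε * n x, _, _, (IsSmooth.const ε).mul hns,
    fun x => by have := hpos x; rwa [hinner] at this,
    (hθ.add hψ).const_smul (ε / 2), hθ.add (hψ.const_smul (-1)), fun x i j => ?_⟩
  have hMM : n x * (M x * M x) * n x = 1 := by linear_combination (n x * M x + 1) * hnM x
  have hl : ∀ c d : ℝ, n x * (M x * M x) * d = c ↔ d = c * n x := by
    intro c d
    have := hn0 x
    constructor
    · intro h; rw [← h]; linear_combination -d * hMM
    · intro h; rw [h]; linear_combination c * hMM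
  have hl' : ∀ c d : ℝ, d = c * n x → c = n x * (M x * M x) * d := fun c d h =>
    ((hl c d).2 h).symm
  have hRx := hRR x
  fin_cases i <;> fin_cases j <;>
    simp only [Fin.zero_eta, Fin.mk_one, Pi.add_apply, Pi.smul_apply, smul_eq_mul, hL,
      Matrix.cons_val_zero, Matrix.cons_val_one, g.comp_symm x 1 0]
  · refine (hl' _ _ (?_ : (g.comp x 0 0 * K x 0 + g.comp x 0 1 * K x 1) ^ 2
      - D x * (K x 1 * K x 1) = _)).trans ?_
    · simp only [hn, hD]; ring
    · rw [← hRx]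
      linear_combination (-(n x * (M x * M x)) * ((g.comp x 0 0 * K x 0 + g.comp x 0 1 * K x 1) ^ 2
        - R x * R x * (K x 1 * K x 1))) * hε
  · refine (hl' _ _ (?_ : (g.comp x 0 0 * K x 0 + g.comp x 0 1 * K x 1) *
      (g.comp x 0 1 * K x 0 + g.comp x 1 1 * K x 1) + D x * (K x 0 * K x 1) = _)).trans ?_
    · simp only [hn, hD]; ring
    · rw [← hRx]
      linear_combination (-(n x * (M x * M x)) * ((g.comp x 0 0 * K x 0 + g.comp x 0 1 * K x 1) *
      (g.comp x 0 1 * K x 0 + g.comp x 1 1 * K x 1) + R x * R x * (K x 0 * K x 1))) * hε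
  · refine (hl' _ _ (?_ : (g.comp x 0 0 * K x 0 + g.comp x 0 1 * K x 1) *
      (g.comp x 0 1 * K x 0 + g.comp x 1 1 * K x 1) + D x * (K x 0 * K x 1) = _)).trans ?_
    · simp only [hn, hD]; ring
    · rw [← hRx]
      linear_combination (-(n x * (M x * M x)) * ((g.comp x 0 0 * K x 0 + g.comp x 0 1 * K x 1) *
      (g.comp x 0 1 * K x 0 + g.comp x 1 1 * K x 1) + R x * R x * (K x 0 * K x 1))) * hε
  · refine (hl' _ _ (?_ : (g.comp x 0 1 * K x 0 + g.comp x 1 1 * K x 1) ^ 2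
      - D x * (K x 0 * K x 0) = _)).trans ?_
    · simp only [hn, hD]; ring
    · rw [← hRx]
      linear_combination (-(n x * (M x * M x)) * ((g.comp x 0 1 * K x 0 + g.comp x 1 1 * K x 1) ^ 2
        - R x * R x * (K x 0 * K x 0))) * hε

end LorentzMetric

/-! ### Primitives of closed forms on the plane -/

/-- The linear form with given coefficients. -/
def coform {V : Type*} [NormedAddCommGroup V] [NormedSpace ℝ V] (u w : V) : Plane →L[ℝ] V :=
  (ContinuousLinearMap.proj (R := ℝ) (φ := fun _ : Fin 2 => ℝ) 0).smulRight u
    + (ContinuousLinearMap.proj (R := ℝ) (φ := fun _ : Fin 2 => ℝ) 1).smulRight w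

theorem coform_apply {V : Type*} [NormedAddCommGroup V] [NormedSpace ℝ V] (u w : V) (v : Plane) :
    coform u w v = v 0 • u + v 1 • w := by simp [coform]

/-- The linear form as a linear function of its coefficients. -/
def coformL (V : Type*) [NormedAddCommGroup V] [NormedSpace ℝ V] : V × V →L[ℝ] (Plane →L[ℝ] V) :=
  ((ContinuousLinearMap.smulRightL ℝ Plane V
      (ContinuousLinearMap.proj (R := ℝ) (φ := fun _ : Fin 2 => ℝ) 0)).comp
      (ContinuousLinearMap.fst ℝ V V))
    + ((ContinuousLinearMap.smulRightL ℝ Plane V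
      (ContinuousLinearMap.proj (R := ℝ) (φ := fun _ : Fin 2 => ℝ) 1)).comp
      (ContinuousLinearMap.snd ℝ V V))

theorem coformL_apply {V : Type*} [NormedAddCommGroup V] [NormedSpace ℝ V] (u w : V) :
    coformL V (u, w) = coform u w := by
  ext v; simp [coformL, coform]

/-- The Poincaré lemma for one-forms on the plane. -/
theorem exists_primitive {V : Type*} [NormedAddCommGroup V] [NormedSpace ℝ V] [CompleteSpace V]
    {u w : Plane → V} (hu : ContDiff ℝ ∞ u)
    (hw : ContDiff ℝ ∞ w)
    (h : ∀ p, fderiv ℝ w p (Pi.single 0 1) = fderiv ℝ u p (Pi.single 1 1)) :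
    ∃ f : Plane → V, ContDiff ℝ ∞ f ∧ ∀ p, fderiv ℝ f p = coform (u p) (w p) := by
  set Θ : Plane → Plane →L[ℝ] V := fun p => coformL V (u p, w p) with hΘ
  have hs : ContDiff ℝ ∞ Θ := (coformL V).contDiff.comp (hu.prodMk hw)
  have hfd : ∀ p x, fderiv ℝ Θ p x = coform (fderiv ℝ u p x) (fderiv ℝ w p x) := by
    intro p x
    have h1 : HasFDerivAt (fun p => (u p, w p)) ((fderiv ℝ u p).prod (fderiv ℝ w p)) p :=
      (hu.contDiffAt.differentiableAt (by simp)).hasFDerivAt.prodMk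
        (hw.contDiffAt.differentiableAt (by simp)).hasFDerivAt
    have h2 := ((coformL V).hasFDerivAt (x := (u p, w p))).comp p h1
    have h3 : fderiv ℝ Θ p = (coformL V).comp ((fderiv ℝ u p).prod (fderiv ℝ w p)) := h2.fderiv
    rw [h3]
    simp [coformL_apply]
  have hdec : ∀ (l : Plane →L[ℝ] V) (v : Plane),
      l v = v 0 • l (Pi.single 0 1) + v 1 • l (Pi.single 1 1) := by
    intro l v
    have hv : v = v 0 • (Pi.single 0 1 : Plane) + v 1 • (Pi.single 1 1 : Plane) := by
      ext i; fin_cases i <;> simp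
    conv_lhs => rw [hv]
    rw [map_add, map_smul, map_smul]
  have hsymm : ∀ p ∈ (Set.univ : Set Plane), ∀ x y, fderiv ℝ Θ p x y = fderiv ℝ Θ p y x := by
    intro p _ x y
    rw [hfd, hfd, coform_apply, coform_apply, hdec _ x, hdec _ x, hdec _ y, hdec _ y, h p]
    module
  obtain ⟨f, hf⟩ := convex_univ.exists_forall_hasFDerivAt_of_fderiv_symmetric isOpen_univ
    (fun p _ => (hs.contDiffAt.differentiableAt (by simp)).differentiableWithinAt) hsymm
  have hfd' : fderiv ℝ f = Θ := funext fun p => (hf p trivial).fderiv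
  refine ⟨f, ?_, fun p => ?_⟩
  · have hd : Differentiable ℝ f := fun p => (hf p trivial).differentiableAt
    rw [contDiff_infty_iff_fderiv, hfd']
    exact ⟨hd, hs⟩
  · rw [hfd', hΘ]; simp only [coformL_apply]

theorem exists_real_primitive {a : Plane → Plane} (ha : ∀ i, ContDiff ℝ ∞ fun p => a p i)
    (h : ∀ p, pd 0 (fun q => a q 1) p = pd 1 (fun q => a q 0) p) :
    ∃ f : Plane → ℝ, ContDiff ℝ ∞ f ∧ ∀ p i, pd i f p = a p i := by
  obtain ⟨f, hf, hfa⟩ := exists_primitive (ha 0) (ha 1) h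
  refine ⟨f, hf, fun p i => ?_⟩
  rw [pd, hfa, coform_apply]
  fin_cases i <;> simp

/-- A nowhere vanishing smooth complex function on the plane has a smooth square root. -/
theorem exists_sqrt {z : Plane → ℂ} (hz : ContDiff ℝ ∞ z) (h0 : ∀ p, z p ≠ 0) :
    ∃ q : Plane → ℂ, ContDiff ℝ ∞ q ∧ ∀ p, q p * q p = z p := by
  have hi : ∀ v, ContDiff ℝ ∞ fun p => fderiv ℝ z p v := fun v =>
    (hz.fderiv_right (m := ∞) (by simp)).clm_apply contDiff_const
  have hdz : ∀ p, DifferentiableAt ℝ z p := fun p => hz.contDiffAt.differentiableAt (by simp)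
  have hinv : ContDiff ℝ ∞ fun p => (z p)⁻¹ := hz.inv h0
  have hu : ∀ v, ContDiff ℝ ∞ fun p => (z p)⁻¹ * fderiv ℝ z p v := fun v => hinv.mul (hi v)
  have hd : ∀ p v w, fderiv ℝ (fun p => (z p)⁻¹ * fderiv ℝ z p v) p w
      = (z p)⁻¹ * fderiv ℝ (fderiv ℝ z) p w v
        - (z p)⁻¹ * (z p)⁻¹ * fderiv ℝ z p w * fderiv ℝ z p v := by
    intro p v w
    have h1 : DifferentiableAt ℝ (fderiv ℝ z) p :=
      (hz.fderiv_right (m := ∞) (by simp)).contDiffAt.differentiableAt (by simp)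
    have e1 : HasFDerivAt (fun p => (z p)⁻¹) (-((z p)⁻¹ * (z p)⁻¹) • fderiv ℝ z p) p := by
      have := (hasDerivAt_inv (h0 p)).hasFDerivAt.restrictScalars ℝ |>.comp p (hdz p).hasFDerivAt
      refine this.congr_fderiv ?_
      ext v
      simp [pow_two]
      ring
    have e2 : HasFDerivAt (fun p => fderiv ℝ z p v) ((fderiv ℝ (fderiv ℝ z) p).flip v) p := by
      simpa using h1.hasFDerivAt.clm_apply (hasFDerivAt_const v p)
    rw [(e1.fun_mul e2).fderiv]
    simp
    ring
  -- A logarithm of `z` up to a constant: `dz / z` is closed because the second derivative of `z` is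
  -- symmetric.
  obtain ⟨l, hl, hlz⟩ := exists_primitive (hu (Pi.single 0 1)) (hu (Pi.single 1 1)) (by
    intro p
    rw [hd, hd, (hz.contDiffAt.isSymmSndFDerivAt (by simpa using ENat.LEInfty.out)).eq]
    ring)
  have hldz : ∀ p v, fderiv ℝ l p v = (z p)⁻¹ * fderiv ℝ z p v := by
    intro p v
    have hv : v = v 0 • (Pi.single 0 1 : Plane) + v 1 • (Pi.single 1 1 : Plane) := by
      ext i; fin_cases i <;> simp
    rw [hlz, coform_apply]
    conv_rhs => rw [hv]
    rw [map_add, map_smul, map_smul, mul_add, mul_smul_comm, mul_smul_comm]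
  have hconst : ∀ p, z p * Complex.exp (-l p) = z 0 * Complex.exp (-l 0) := by
    have hdiff : ∀ p, HasFDerivAt (fun p => z p * Complex.exp (-l p)) (0 : Plane →L[ℝ] ℂ) p := by
      intro p
      have hdl := (hl.contDiffAt.differentiableAt (x := p) (by simp)).hasFDerivAt
      refine ((hdz p).hasFDerivAt.mul (hdl.neg.cexp)).congr_fderiv ?_
      ext v
      have := h0 p
      simp [hldz]
      field_simp
      simp
    intro p
    exact is_const_of_fderiv_eq_zero (fun p => (hdiff p).differentiableAt)
      (fun p => (hdiff p).fderiv) p 0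
  -- A square root of the constant `z exp(-l)` corrects `exp(l / 2)`.
  obtain ⟨k, hk⟩ := IsAlgClosed.exists_eq_mul_self (z 0 * Complex.exp (-l 0))
  refine ⟨fun p => k * Complex.exp (l p / 2), contDiff_const.mul (hl.div_const 2).cexp,
    fun p => ?_⟩
  have h1 : Complex.exp (l p / 2) * Complex.exp (l p / 2) = Complex.exp (l p) := by
    rw [← Complex.exp_add]; ring_nf
  have h2 : Complex.exp (-l p) * Complex.exp (l p) = 1 := by
    rw [← Complex.exp_add]; simp
  linear_combination k * k * h1 - Complex.exp (l p) * hk - Complex.exp (l p) * hconst p + z p * h2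

/-! ### Flat metrics have global null coframes -/

theorem pd_translate (F : Plane → ℝ) (n : Plane) (i p) :
    pd i (fun q => F (q + n)) p = pd i F (p + n) := by
  simp only [pd]
  rw [fderiv_comp_add_right]

theorem contDiff_translate {F : Plane → ℝ} (hF : ContDiff ℝ ∞ F) (n : Plane) :
    ContDiff ℝ ∞ fun q => F (q + n) := hF.comp (contDiff_id.add contDiff_const)

theorem eq_of_pd_eq_zero {F : Plane → ℝ} (hF : ContDiff ℝ ∞ F) (h : ∀ i p, pd i F p = 0)
    (p q : Plane) : F p = F q := by
  refine is_const_of_fderiv_eq_zero (fun p => pd_differentiableAt hF p) (fun p => ?_) p q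
  ext1 v
  rw [fderiv_eq_pd, h, h]; simp

theorem exists_add_const {F G : Plane → ℝ} (hF : ContDiff ℝ ∞ F) (hG : ContDiff ℝ ∞ G)
    (h : ∀ i p, pd i F p = pd i G p) : ∃ c, ∀ p, F p = G p + c := by
  refine ⟨F 0 - G 0, fun p => ?_⟩
  have := eq_of_pd_eq_zero (hF.sub hG) (fun i p => by rw [pd_sub hF hG, h, sub_self]) p 0
  linarith

namespace LorentzMetric
variable {g : LorentzMetric}

/-- The null directions of a Lorentzian metric lift to global null forms on the plane. -/
theorem exists_null_forms (g : LorentzMetric) : ∃ a b : Plane → Plane,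
    (∀ i, ContDiff ℝ ∞ fun p => a p i) ∧ (∀ i, ContDiff ℝ ∞ fun p => b p i) ∧
    ∀ p i j, g.comp (proj p) i j = a p i * b p j + a p j * b p i := by
  have hg : ∀ i j, ContDiff ℝ ∞ fun p => g.comp (proj p) i j := g.smooth
  -- The matrix of `g` is `m` times the identity plus the traceless part with entries `x`, `y`. A
  -- square root `c + i d` of `x + i y` gives a global eigenvector `(c, d)` with eigenvalue `m + ρ`,
  -- where `ρ = c² + d²`; the orthogonal vector has eigenvalue `m - ρ`.
  set x : Plane → ℝ := fun p => (g.comp (proj p) 0 0 - g.comp (proj p) 1 1) / 2 with hx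
  set y : Plane → ℝ := fun p => g.comp (proj p) 0 1 with hy
  set m : Plane → ℝ := fun p => (g.comp (proj p) 0 0 + g.comp (proj p) 1 1) / 2 with hm
  have hxs : ContDiff ℝ ∞ x := ((hg 0 0).sub (hg 1 1)).div_const 2
  have hms : ContDiff ℝ ∞ m := ((hg 0 0).add (hg 1 1)).div_const 2
  have hpos : ∀ p, m p ^ 2 < x p ^ 2 + y p ^ 2 := by
    intro p
    have := g.comp_det (proj p)
    simp only [hx, hy, hm]
    nlinarith
  obtain ⟨q, hq, hqz⟩ := exists_sqrt (z := fun p => (x p : ℂ) + (y p : ℂ) * Complex.I)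
    ((Complex.ofRealCLM.contDiff.comp hxs).add
      ((Complex.ofRealCLM.contDiff.comp (hg 0 1)).mul contDiff_const)) (by
    intro p h
    have h1 := congrArg Complex.re h
    have h2 := congrArg Complex.im h
    simp at h1 h2
    have := hpos p
    rw [h1, h2] at this
    nlinarith [sq_nonneg (m p)])
  set c : Plane → ℝ := fun p => (q p).re with hc
  set d : Plane → ℝ := fun p => (q p).im with hd
  have hcs : ContDiff ℝ ∞ c := Complex.reCLM.contDiff.comp hq
  have hds : ContDiff ℝ ∞ d := Complex.imCLM.contDiff.comp hq
  have hre : ∀ p, c p ^ 2 - d p ^ 2 = x p := by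
    intro p
    have := congrArg Complex.re (hqz p)
    simp at this
    simp only [hc, hd]; linarith
  have him : ∀ p, 2 * c p * d p = y p := by
    intro p
    have := congrArg Complex.im (hqz p)
    simp at this
    simp only [hc, hd]; linarith
  set ρ : Plane → ℝ := fun p => c p ^ 2 + d p ^ 2 with hρ
  have hρs : ContDiff ℝ ∞ ρ := (hcs.pow 2).add (hds.pow 2)
  -- The Lorentzian signature: the eigenvalues `m + ρ` and `m - ρ` have opposite signs. Their
  -- absolute values are `A²` and `B²`, so `g` is a difference of two squares, and its linear
  -- factors are the null forms.
  have habs : ∀ p, |m p| < ρ p := by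
    intro p
    apply abs_lt_of_sq_lt_sq _ (by positivity)
    have := hpos p
    rw [← hre, ← him] at this
    simp only [hρ]
    linarith
  have h1 : ∀ p, 0 < ρ p + m p := fun p => by have := (abs_lt.1 (habs p)).1; linarith
  have h2 : ∀ p, 0 < ρ p - m p := fun p => by have := (abs_lt.1 (habs p)).2; linarith
  have hρ0 : ∀ p, ρ p ≠ 0 := fun p => ((abs_nonneg _).trans_lt (habs p)).ne'
  set A : Plane → ℝ := fun p => √(ρ p + m p) with hA
  set B : Plane → ℝ := fun p => √(ρ p - m p) with hB
  have hAs : ContDiff ℝ ∞ A := (hρs.add hms).sqrt fun p => (h1 p).ne'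
  have hBs : ContDiff ℝ ∞ B := (hρs.sub hms).sqrt fun p => (h2 p).ne'
  have hAA : ∀ p, A p ^ 2 = ρ p + m p := fun p => Real.sq_sqrt (h1 p).le
  have hBB : ∀ p, B p ^ 2 = ρ p - m p := fun p => Real.sq_sqrt (h2 p).le
  have h2ρ : ContDiff ℝ ∞ fun p => (2 * ρ p)⁻¹ :=
    (contDiff_const.mul hρs).inv fun p => mul_ne_zero two_ne_zero (hρ0 p)
  refine ⟨fun p => ![(2 * ρ p)⁻¹ * (A p * c p + B p * d p), (2 * ρ p)⁻¹ * (A p * d p - B p * c p)],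
    fun p => ![A p * c p - B p * d p, A p * d p + B p * c p], ?_, ?_, ?_⟩
  · intro i
    fin_cases i
    · exact h2ρ.mul ((hAs.mul hcs).add (hBs.mul hds))
    · exact h2ρ.mul ((hAs.mul hds).sub (hBs.mul hcs))
  · intro i
    fin_cases i
    · exact (hAs.mul hcs).sub (hBs.mul hds)
    · exact (hAs.mul hds).add (hBs.mul hcs)
  · intro p i j
    have e1 := hre p
    have e2 := him p
    have e3 := hAA p
    have e4 := hBB p
    have e5 : ρ p = c p ^ 2 + d p ^ 2 := rfl
    have e6 : x p = (g.comp (proj p) 0 0 - g.comp (proj p) 1 1) / 2 := rfl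
    have e7 : m p = (g.comp (proj p) 0 0 + g.comp (proj p) 1 1) / 2 := rfl
    have e8 : (2 * ρ p)⁻¹ * (2 * ρ p) = 1 :=
      inv_mul_cancel₀ (mul_ne_zero two_ne_zero (hρ0 p))
    have g00 : g.comp (proj p) 0 0 = c p ^ 2 - d p ^ 2 + m p := by linarith
    have g11 : g.comp (proj p) 1 1 = m p - (c p ^ 2 - d p ^ 2) := by linarith
    have g01 : g.comp (proj p) 0 1 = 2 * c p * d p := e2.symm
    set r := (2 * ρ p)⁻¹ with hr
    fin_cases i <;> fin_cases j <;> simp only [Fin.zero_eta, Fin.mk_one, Matrix.cons_val_zero,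
      Matrix.cons_val_one, g.comp_symm (proj p) 1 0, g00, g11, g01]
    · linear_combination -2 * r * c p ^ 2 * e3 + 2 * r * d p ^ 2 * e4
        - (c p ^ 2 - d p ^ 2 + m p) * e8 + 2 * r * m p * e5
    · linear_combination -2 * r * c p * d p * e3 - 2 * r * c p * d p * e4 - 2 * c p * d p * e8
    · linear_combination -2 * r * c p * d p * e3 - 2 * r * c p * d p * e4 - 2 * c p * d p * e8
    · linear_combination -2 * r * d p ^ 2 * e3 + 2 * r * c p ^ 2 * e4
        - (m p - (c p ^ 2 - d p ^ 2)) * e8 + 2 * r * m p * e5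

theorem wedge_ne_zero_of_comp_eq {a b : Plane → Plane}
    (h : ∀ p i j, g.comp (proj p) i j = a p i * b p j + a p j * b p i) (p) :
    a p 0 * b p 1 - a p 1 * b p 0 ≠ 0 := by
  intro h0
  have := g.comp_det (proj p)
  simp only [h] at this
  nlinarith

/-- A flat metric has a parallel null coframe on the universal covering. -/
theorem IsFlat.exists_parallel_null_forms (hflat : g.IsFlat) : ∃ a b : Plane → Plane,
    (∀ i, ContDiff ℝ ∞ fun p => a p i) ∧ (∀ i, ContDiff ℝ ∞ fun p => b p i) ∧
    (∀ p i j, g.comp (proj p) i j = a p i * b p j + a p j * b p i) ∧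
    (∀ p l i, pd l (fun q => a q i) p = ∑ k, g.christoffel k l i (proj p) * a p k) ∧
    (∀ p l i, pd l (fun q => b q i) p = ∑ k, g.christoffel k l i (proj p) * b p k) := by
  obtain ⟨a, b, ha, hb, hab⟩ := g.exists_null_forms
  obtain ⟨ν, hν, hνab⟩ := exists_connection_form ha hb hab
  have hΓ : ∀ k l i, ContDiff ℝ ∞ fun p => g.christoffel k l i (proj p) :=
    fun k l i => g.christoffel_smooth k l i
  -- Mixed derivatives of `a` show that the curvature acts on `a` through multiplication by `dν`.
  have hclosed : ∀ p, pd 0 (fun q => ν q 1) p = pd 1 (fun q => ν q 0) p := by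
    intro p
    have key : ∀ k, (pd 0 (fun q => ν q 1) p - pd 1 (fun q => ν q 0) p) * a p k = 0 := by
      intro k
      have e : ∀ l i, pd l (fun q => a q i) = fun p => (g.christoffel 0 l i (proj p) * a p 0
          + g.christoffel 1 l i (proj p) * a p 1) + ν p l * a p i := by
        intro l i; funext p; rw [(hνab p l i).1, Fin.sum_univ_two]
      have h := pd_comm (ha k) 0 1 p
      have hs : ∀ l i, ContDiff ℝ ∞ fun p => (g.christoffel 0 l i (proj p) * a p 0
          + g.christoffel 1 l i (proj p) * a p 1) := fun l i =>
        ((hΓ _ _ _).mul (ha _)).add ((hΓ _ _ _).mul (ha _))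
      rw [e, e] at h
      rw [pd_add (hs _ _) ((hν _).mul (ha _)), pd_add (hs _ _) ((hν _).mul (ha _)),
        pd_mul (hν _) (ha _), pd_mul (hν _) (ha _),
        pd_add ((hΓ _ _ _).mul (ha _)) ((hΓ _ _ _).mul (ha _)),
        pd_add ((hΓ _ _ _).mul (ha _)) ((hΓ _ _ _).mul (ha _)),
        pd_mul (hΓ _ _ _) (ha _), pd_mul (hΓ _ _ _) (ha _),
        pd_mul (hΓ _ _ _) (ha _), pd_mul (hΓ _ _ _) (ha _)] at h
      simp only [(hνab _ _ _).1, Fin.sum_univ_two] at h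
      have f0 := hflat 0 k 0 1 (proj p)
      have f1 := hflat 1 k 0 1 (proj p)
      simp only [curvature, Fin.sum_univ_two, partialDeriv_proj (g.christoffel_smooth _ _ _)]
        at f0 f1
      linear_combination h - a p 0 * f0 - a p 1 * f1
    by_contra hne
    have hne' := sub_ne_zero.2 hne
    have a0 := (mul_eq_zero.1 (key 0)).resolve_left hne'
    have a1 := (mul_eq_zero.1 (key 1)).resolve_left hne'
    apply wedge_ne_zero_of_comp_eq hab p
    rw [a0, a1]; ring
  obtain ⟨h, hh, hhν⟩ := exists_real_primitive hν hclosed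
  have hp : ContDiff ℝ ∞ fun p => Real.exp (h p) := hh.exp
  have hn : ContDiff ℝ ∞ fun p => Real.exp (-h p) := hh.neg.exp
  have dp : ∀ i p, pd i (fun p => Real.exp (h p)) p = Real.exp (h p) * ν p i := by
    intro i p
    rw [pd_comp hh (Real.hasDerivAt_exp _), hhν]
  have dn : ∀ i p, pd i (fun p => Real.exp (-h p)) p = -Real.exp (-h p) * ν p i := by
    intro i p
    rw [pd_comp (φ := fun s => Real.exp (-s)) hh ((hasDerivAt_neg _).exp), hhν]
    ring
  refine ⟨fun p => Real.exp (-h p) • a p, fun p => Real.exp (h p) • b p,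
    fun i => hn.mul (ha i), fun i => hp.mul (hb i), fun p i j => ?_, fun p l i => ?_,
    fun p l i => ?_⟩
  · have : Real.exp (-h p) * Real.exp (h p) = 1 := by rw [← Real.exp_add]; simp
    rw [hab]
    simp only [Pi.smul_apply, smul_eq_mul]
    linear_combination -(a p i * b p j + a p j * b p i) * this
  · simp only [Pi.smul_apply, smul_eq_mul]
    rw [pd_mul hn (ha i), dn, (hνab p l i).1]
    simp only [Fin.sum_univ_two]
    ring
  · simp only [Pi.smul_apply, smul_eq_mul]
    rw [pd_mul hp (hb i), dp, (hνab p l i).2]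
    simp only [Fin.sum_univ_two]
    ring

/-- Deck transformations rescale a parallel null coframe. -/
theorem exists_multiplier {a b : Plane → Plane}
    (ha : ∀ i, ContDiff ℝ ∞ fun p => a p i) (hb : ∀ i, ContDiff ℝ ∞ fun p => b p i)
    (hab : ∀ p i j, g.comp (proj p) i j = a p i * b p j + a p j * b p i)
    (hpa : ∀ p l i, pd l (fun q => a q i) p = ∑ k, g.christoffel k l i (proj p) * a p k)
    {n : Plane} (hn : proj n = 0) :
    ∃ c : ℝ, c ≠ 0 ∧ (∀ p i, a (p + n) i = c * a p i) ∧ ∀ p i, b (p + n) i = c⁻¹ * b p i := by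
  have hpn : ∀ p, proj (p + n) = proj p := fun p => by rw [proj_add, hn, add_zero]
  set w : Plane → ℝ := fun p => a p 0 * b p 1 - a p 1 * b p 0 with hw
  have hw0 : ∀ p, w p ≠ 0 := wedge_ne_zero_of_comp_eq hab
  have hws : ContDiff ℝ ∞ w := ((ha 0).mul (hb 1)).sub ((ha 1).mul (hb 0))
  -- `a ∧ b` never vanishes on the segment from `p` to `p + n`, so the translated coframe has the
  -- same orientation. This later excludes an exchange of the two null directions.
  have hsign : ∀ p, 0 < w (p + n) * w p := by
    intro p
    by_contra hneg
    push Not at hneg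
    have hc : Continuous fun s : ℝ => w (p + s • n) :=
      hws.continuous.comp (by fun_prop)
    have : ∃ s : ℝ, w (p + s • n) = 0 := by
      have h0 : w (p + (0 : ℝ) • n) = w p := by simp
      have h1 : w (p + (1 : ℝ) • n) = w (p + n) := by simp
      rcases le_total (w p) 0 with hp | hp
      · have hq : 0 ≤ w (p + n) := by
          by_contra hq
          push Not at hq
          have := mul_pos_of_neg_of_neg hq (lt_of_le_of_ne hp (hw0 p))
          linarith
        exact mem_range_of_exists_le_of_exists_ge hc ⟨0, by rw [h0]; exact hp⟩
          ⟨1, by rw [h1]; exact hq⟩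
      · have hq : w (p + n) ≤ 0 := by
          by_contra hq
          push Not at hq
          have := mul_pos hq (lt_of_le_of_ne hp (hw0 p).symm)
          linarith
        exact mem_range_of_exists_le_of_exists_ge hc ⟨1, by rw [h1]; exact hq⟩
          ⟨0, by rw [h0]; exact hp⟩
    obtain ⟨s, hs⟩ := this
    exact hw0 _ hs
  -- the coefficients of the translated coframe
  set l : Plane → ℝ := fun p => (a (p + n) 0 * b p 1 - a (p + n) 1 * b p 0) / w p with hl
  set l' : Plane → ℝ := fun p => (a p 0 * b (p + n) 1 - a p 1 * b (p + n) 0) / w p with hl'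
  set m : Plane → ℝ := fun p => (a p 0 * a (p + n) 1 - a p 1 * a (p + n) 0) / w p with hm
  set m' : Plane → ℝ := fun p => (b (p + n) 0 * b p 1 - b (p + n) 1 * b p 0) / w p with hm'
  have hA : ∀ p i, a (p + n) i = l p * a p i + m p * b p i := by
    intro p i
    have := hw0 p
    simp only [hl, hm]
    rw [div_mul_eq_mul_div, div_mul_eq_mul_div, ← add_div, eq_div_iff this]
    fin_cases i <;> simp [hw] <;> ring
  have hB : ∀ p i, b (p + n) i = l' p * b p i + m' p * a p i := by
    intro p i
    have := hw0 p
    simp only [hl', hm']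
    rw [div_mul_eq_mul_div, div_mul_eq_mul_div, ← add_div, eq_div_iff this]
    fin_cases i <;> simp [hw] <;> ring
  -- The translated coframe has the same symmetric product; these are the coefficients of `a²`, `b²`
  -- and `ab`.
  have hcoef : ∀ p, l p * m' p = 0 ∧ m p * l' p = 0 ∧ l p * l' p + m p * m' p = 1 := by
    intro p
    have h := fun i j => (hab (p + n) i j).symm.trans ((congrFun (congrFun
      (congrArg g.comp (hpn p)) i) j).trans (hab p i j))
    simp only [hA, hB] at h
    have h00 := h 0 0
    have h01 := h 0 1
    have h11 := h 1 1
    have hwp := hw0 p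
    have hw2 : w p * w p ≠ 0 := mul_ne_zero hwp hwp
    have ew : w p = a p 0 * b p 1 - a p 1 * b p 0 := rfl
    refine ⟨?_, ?_, ?_⟩
    · apply mul_left_cancel₀ hw2
      rw [ew]
      linear_combination (b p 1 ^ 2 / 2) * h00 - b p 0 * b p 1 * h01 + (b p 0 ^ 2 / 2) * h11
    · apply mul_left_cancel₀ hw2
      rw [ew]
      linear_combination (a p 1 ^ 2 / 2) * h00 - a p 0 * a p 1 * h01 + (a p 0 ^ 2 / 2) * h11
    · apply mul_left_cancel₀ hw2
      rw [ew]
      linear_combination -(a p 1 * b p 1) * h00 + (a p 0 * b p 1 + a p 1 * b p 0) * h01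
        - (a p 0 * b p 0) * h11
  have hdet : ∀ p, 0 < l p * l' p - m p * m' p := by
    intro p
    have e : w (p + n) = (l p * l' p - m p * m' p) * w p := by
      simp only [hw, hA, hB]; ring
    have := hsign p
    rw [e, mul_assoc] at this
    exact pos_of_mul_pos_left this (mul_self_nonneg _)
  have hll : ∀ p, l p * l' p = 1 ∧ m p = 0 ∧ m' p = 0 := by
    intro p
    obtain ⟨h1, h2, h3⟩ := hcoef p
    have h4 := hdet p
    have hl0 : l p ≠ 0 := by
      intro h0
      rw [h0] at h3 h4
      linarith
    have hl0' : l' p ≠ 0 := by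
      intro h0
      rw [h0] at h3 h4
      linarith
    have hm0 : m p = 0 := (mul_eq_zero.1 h2).resolve_right hl0'
    have hm0' : m' p = 0 := (mul_eq_zero.1 h1).resolve_left hl0
    refine ⟨?_, hm0, hm0'⟩
    rw [hm0] at h3; linarith
  have hls : ContDiff ℝ ∞ l :=
    (((contDiff_translate (ha 0) n).mul (hb 1)).sub ((contDiff_translate (ha 1) n).mul (hb 0))).div
      hws hw0
  have hal : ∀ p i, a (p + n) i = l p * a p i := by
    intro p i
    rw [hA, (hll p).2.1]; ring
  -- Both `a` and its translate are parallel, so their ratio is constant.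
  have hdl : ∀ j p, pd j l p = 0 := by
    intro j p
    have key : ∀ i, pd j l p * a p i = 0 := by
      intro i
      have h1 := pd_translate (fun q => a q i) n j p
      simp only [hal] at h1
      rw [pd_mul hls (ha i), hpa, hpa, hpn] at h1
      simp only [hal, Fin.sum_univ_two] at h1
      linear_combination h1
    by_contra hne
    apply hw0 p
    simp only [hw, (mul_eq_zero.1 (key 0)).resolve_left hne,
      (mul_eq_zero.1 (key 1)).resolve_left hne]
    ring
  have hconst : ∀ p, l p = l 0 := fun p => eq_of_pd_eq_zero hls hdl p 0
  have hl00 : l 0 ≠ 0 := fun h0 => by have := (hll 0).1; rw [h0] at this; simp at this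
  refine ⟨l 0, hl00, fun p i => by rw [hal, hconst], fun p i => ?_⟩
  have h1 := (hll p).1
  rw [hB, (hll p).2.2, ← hconst p, eq_inv_of_mul_eq_one_right h1]
  ring

end LorentzMetric

/-- If two functions on the plane with independent differentials are multiplied by reciprocal
factors, up to constants, by the deck transformations, then these factors are all equal to `1`. -/
theorem multiplier_eq_one {ξ η : Plane → ℝ} (hξ : ContDiff ℝ ∞ ξ) (hη : ContDiff ℝ ∞ η)
    (hw : ∀ p, pd 0 ξ p * pd 1 η p - pd 1 ξ p * pd 0 η p ≠ 0) {c : Plane → ℝ}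
    (hc : ∀ n, proj n = 0 → c n ≠ 0)
    (h1 : ∀ n, proj n = 0 → ∀ p i, pd i ξ (p + n) = c n * pd i ξ p)
    (h2 : ∀ n, proj n = 0 → ∀ p i, pd i η (p + n) = (c n)⁻¹ * pd i η p)
    {n : Plane} (hn : proj n = 0) : c n = 1 := by
  by_contra hne
  -- normalize both functions at the fixed point of the affine action of `n`
  have norm : ∀ {F : Plane → ℝ}, ContDiff ℝ ∞ F → ∀ {e : Plane → ℝ}, e n ≠ 1 →
      (∀ m, proj m = 0 → ∀ p i, pd i F (p + m) = e m * pd i F p) →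
      ∃ d, ∀ m, proj m = 0 → ∀ p, F (p + m) - d = e m * (F p - d) := by
    intro F hF e he hFe
    have hk : ∀ m, proj m = 0 → ∃ k, ∀ p, F (p + m) = e m * F p + k := by
      intro m hm
      refine exists_add_const (contDiff_translate hF m) (contDiff_const.mul hF) fun i p => ?_
      rw [pd_translate, hFe m hm, pd_mul contDiff_const hF, pd_const]; ring
    obtain ⟨k, hk0⟩ := hk n hn
    have he' : 1 - e n ≠ 0 := sub_ne_zero.2 (Ne.symm he)
    refine ⟨k / (1 - e n), fun m hm p => ?_⟩
    obtain ⟨k', hk'⟩ := hk m hm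
    have a1 := hk0 (p + m)
    have a2 := hk' (p + n)
    rw [hk'] at a1
    rw [hk0, add_right_comm] at a2
    rw [hk']
    -- The translations by `m` and `n` commute, hence so do their affine actions on values of `F`;
    -- therefore the fixed point of the action of `n` is fixed by every `m`.
    have e1 : k' * (1 - e n) = k * (1 - e m) := by linear_combination a1 - a2
    have : k' = k / (1 - e n) * (1 - e m) := by
      rw [div_mul_eq_mul_div, eq_div_iff he', e1]
    rw [this]; ring
  obtain ⟨d, hd⟩ := norm hξ hne h1
  obtain ⟨d', hd'⟩ := norm hη (e := fun m => (c m)⁻¹) (fun h => hne (inv_eq_one.1 h)) h2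
  set F : Plane → ℝ := fun p => (ξ p - d) * (η p - d') with hF
  have hFs : ContDiff ℝ ∞ F := (hξ.sub contDiff_const).mul (hη.sub contDiff_const)
  have hFper : ∀ p m, proj m = 0 → F (p + m) = F p := by
    intro p m hm
    simp only [hF, hd m hm, hd' m hm]
    have := hc m hm
    field_simp
  -- `dF = (η - d') dξ + (ξ - d) dη` with `dξ`, `dη` independent.
  have hcrit : ∀ p, (∀ i, pd i F p = 0) → ξ p - d = 0 ∧ η p - d' = 0 := by
    intro p hp
    have h := fun i => hp i
    simp only [hF] at h
    simp only [pd_mul (hξ.sub contDiff_const) (hη.sub contDiff_const), pd_sub hξ contDiff_const,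
      pd_sub hη contDiff_const, pd_const, sub_zero] at h
    have h0 := h 0
    have h1 := h 1
    constructor
    · apply mul_right_cancel₀ (hw p)
      linear_combination pd 0 ξ p * h1 - pd 1 ξ p * h0
    · apply mul_right_cancel₀ (hw p)
      linear_combination pd 1 η p * h0 - pd 0 η p * h1
  obtain ⟨f, hf⟩ := exists_descent hFper
  have hfc : Continuous f := by
    refine (isOpenQuotientMap_proj.isQuotientMap.continuous_iff).2 ?_
    have : f ∘ proj = F := funext hf
    rw [this]
    exact hFs.continuous
  have hext : ∀ p, IsLocalExtr F p → F p = 0 := by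
    intro p hp
    have : fderiv ℝ F p = 0 := hp.fderiv_eq_zero
    have h0 := (hcrit p fun i => by simp [pd, this]).1
    simp only [hF, h0, zero_mul]
  obtain ⟨x, -, hx⟩ := isCompact_univ.exists_isMaxOn Set.univ_nonempty hfc.continuousOn
  obtain ⟨y, -, hy⟩ := isCompact_univ.exists_isMinOn Set.univ_nonempty hfc.continuousOn
  obtain ⟨p, rfl⟩ := proj_surjective x
  obtain ⟨q, rfl⟩ := proj_surjective y
  have hp : ∀ r, F r ≤ F p := fun r => by
    rw [← hf, ← hf]; exact hx (Set.mem_univ _)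
  have hq : ∀ r, F q ≤ F r := fun r => by
    rw [← hf, ← hf]; exact hy (Set.mem_univ _)
  have hp0 := hext p (Or.inr (Filter.Eventually.of_forall hp))
  have hq0 := hext q (Or.inl (Filter.Eventually.of_forall hq))
  have hF0 : F = fun _ => 0 := funext fun r =>
    le_antisymm (hp0 ▸ hp r) (hq0 ▸ hq r)
  have hξ0 : ξ = fun _ => d := funext fun r =>
    sub_eq_zero.1 (hcrit r fun i => by rw [hF0, pd_const]).1
  apply hw 0
  rw [hξ0, pd_const, pd_const]; ring

/-- A flat Lorentzian metric on the torus is the symmetric product of two closed one-forms. -/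
theorem LorentzMetric.IsFlat.exists_isNullCoframe {g : LorentzMetric} (hflat : g.IsFlat) :
    ∃ a b, g.IsNullCoframe (fun _ => 1) a b := by
  obtain ⟨a, b, ha, hb, hab, hpa, hpb⟩ := hflat.exists_parallel_null_forms
  have hcl : ∀ {a : Plane → Plane},
      (∀ p l i, pd l (fun q => a q i) p = ∑ k, g.christoffel k l i (proj p) * a p k) →
      ∀ p, pd 0 (fun q => a q 1) p = pd 1 (fun q => a q 0) p := by
    intro a hpa p
    rw [hpa, hpa]
    exact Finset.sum_congr rfl fun k _ => by rw [g.christoffel_symm]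
  obtain ⟨ξ, hξ, hξa⟩ := exists_real_primitive ha (hcl hpa)
  obtain ⟨η, hη, hηb⟩ := exists_real_primitive hb (hcl hpb)
  have hmul : ∀ n, ∃ c : ℝ, proj n = 0 →
      c ≠ 0 ∧ (∀ p i, a (p + n) i = c * a p i) ∧ ∀ p i, b (p + n) i = c⁻¹ * b p i := by
    intro n
    by_cases hn : proj n = 0
    · obtain ⟨c, hc⟩ := exists_multiplier ha hb hab hpa hn
      exact ⟨c, fun _ => hc⟩
    · exact ⟨0, fun h => absurd h hn⟩
  choose c hc using hmul
  have hone : ∀ n, proj n = 0 → c n = 1 := fun n hn => multiplier_eq_one hξ hη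
    (fun p => by simp only [hξa, hηb]; exact wedge_ne_zero_of_comp_eq hab p)
    (fun n hn => (hc n hn).1) (fun n hn p i => by simp only [hξa]; exact (hc n hn).2.1 p i)
    (fun n hn p i => by simp only [hηb]; exact (hc n hn).2.2 p i) hn
  obtain ⟨a', ha'⟩ := exists_descent (F := a) fun p n hn => funext fun i => by
    rw [(hc n hn).2.1, hone n hn, one_mul]
  obtain ⟨b', hb'⟩ := exists_descent (F := b) fun p n hn => funext fun i => by
    rw [(hc n hn).2.2, hone n hn, inv_one, one_mul]
  have desc : ∀ {a : Plane → Plane} {a' : Torus → Plane}, (∀ i, ContDiff ℝ ∞ fun p => a p i) →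
      (∀ p, pd 0 (fun q => a q 1) p = pd 1 (fun q => a q 0) p) → (∀ p, a' (proj p) = a p) →
      IsClosedForm a' := by
    intro a a' ha hcl ha'
    have hs : ∀ i, IsSmooth fun x => a' x i := fun i => by
      simpa only [IsSmooth, ha'] using ha i
    refine ⟨hs, fun x => ?_⟩
    obtain ⟨p, rfl⟩ := proj_surjective x
    rw [partialDeriv_proj (hs _), partialDeriv_proj (hs _)]
    simpa only [ha'] using hcl p
  refine ⟨a', b', IsSmooth.const 1, fun _ => one_pos, desc ha (hcl hpa) ha',
    desc hb (hcl hpb) hb', fun x i j => ?_⟩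
  obtain ⟨p, rfl⟩ := proj_surjective x
  rw [ha', hb', hab, one_mul]

/-! ### Ordinary differential equations -/

/-- Global solvability for time-dependent vector fields which are, locally uniformly in time,
Lipschitz and bounded. -/
theorem exists_global_solution {E : Type*} [NormedAddCommGroup E] [NormedSpace ℝ E]
    [CompleteSpace E] {f : ℝ → E → E}
    (hf : ∀ T : ℝ, ∃ K L : NNReal, ∀ t, |t| ≤ T → LipschitzWith K (f t) ∧ ∀ x, ‖f t x‖ ≤ L)
    (hc : ∀ x, Continuous fun t => f t x) (x₀ : E) :
    ∃ α : ℝ → E, α 0 = x₀ ∧ ∀ t, HasDerivAt α (f t (α t)) t := by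
  have hloc : ∀ N : ℕ, ∃ α : ℝ → E, α 0 = x₀ ∧
      ∀ t : ℝ, |t| < N + 1 → HasDerivAt α (f t (α t)) t := by
    intro N
    have hN : (0 : ℝ) ≤ (N : ℝ) + 1 := by positivity
    obtain ⟨K, L, hKL⟩ := hf (N + 1)
    -- The bounds hold on the whole space, so the radius `L (N + 1)` can match the length of time
    -- and no subdivision is needed.
    have hp : IsPicardLindelof f (tmin := -((N : ℝ) + 1)) (tmax := (N : ℝ) + 1)
        ⟨0, by constructor <;> linarith⟩ x₀ (L * ((N : NNReal) + 1)) 0 L K :=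
      { lipschitzOnWith := fun t ht => (hKL t (abs_le.2 ht)).1.lipschitzOnWith
        continuousOn := fun x _ => (hc x).continuousOn
        norm_le := fun t ht x _ => (hKL t (abs_le.2 ht)).2 x
        mul_max_le := by simp }
    obtain ⟨α, h0, hα⟩ := hp.exists_eq_forall_mem_Icc_hasDerivWithinAt₀
    refine ⟨α, h0, fun t ht => ?_⟩
    have ht' := abs_lt.1 ht
    exact (hα t ⟨ht'.1.le, ht'.2.le⟩).hasDerivAt (Icc_mem_nhds ht'.1 ht'.2)
  choose α h0 hα using hloc
  have hagree : ∀ M N : ℕ, ∀ s : ℝ, |s| < M + 1 → |s| < N + 1 → α M s = α N s := by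
    intro M N s hM hN
    set r := min ((M : ℝ) + 1) (N + 1) with hr
    have hr0 : 0 < r := lt_min (by positivity) (by positivity)
    obtain ⟨K, L, hKL⟩ := hf r
    have key := ODE_solution_unique_of_mem_Ioo (v := f) (s := fun _ => Set.univ) (K := K)
      (a := -r) (b := r) (t₀ := 0) (f := α M) (g := α N)
      (fun t ht => (hKL t (abs_lt.2 ht).le).1.lipschitzOnWith)
      ⟨by linarith, hr0⟩
      (fun t ht => ⟨hα M t ((abs_lt.2 ht).trans_le (min_le_left _ _)), trivial⟩)
      (fun t ht => ⟨hα N t ((abs_lt.2 ht).trans_le (min_le_right _ _)), trivial⟩)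
      ((h0 M).trans (h0 N).symm)
    exact key (abs_lt.1 (lt_min hM hN))
  -- The solution with index `N` is valid for `|t| < N + 1`, so the ceiling leaves room for a
  -- neighbourhood of `t`, on which all eligible solutions agree.
  refine ⟨fun t => α ⌈|t|⌉₊ t, by simp [h0], fun t => ?_⟩
  have hlt : ∀ s : ℝ, |s| < (⌈|s|⌉₊ : ℝ) + 1 := fun s => (Nat.le_ceil _).trans_lt (lt_add_one _)
  refine (hα ⌈|t|⌉₊ t (hlt t)).congr_of_eventuallyEq ?_
  have : ∀ᶠ s in 𝓝 t, |s| < (⌈|t|⌉₊ : ℝ) + 1 :=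
    continuous_abs.continuousAt.eventually_lt continuousAt_const (hlt t)
  filter_upwards [this] with s hs
  exact hagree _ _ s (hlt s) hs

/-- A function with explicit Lipschitz constant and bound. -/
structure IsBddLip {X : Type*} [PseudoMetricSpace X] (K M : ℝ) (φ : X → ℝ) : Prop where
  nonneg_left : 0 ≤ K
  nonneg_right : 0 ≤ M
  lip : ∀ x y, |φ x - φ y| ≤ K * dist x y
  bdd : ∀ x, |φ x| ≤ M

namespace IsBddLip
variable {X : Type*} [PseudoMetricSpace X] {K M K' M' : ℝ} {φ ψ : X → ℝ}

theorem mul (h : IsBddLip K M φ) (h' : IsBddLip K' M' ψ) :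
    IsBddLip (K * M' + M * K') (M * M') fun x => φ x * ψ x where
  nonneg_left := by have := h.1; have := h.2; have := h'.1; have := h'.2; positivity
  nonneg_right := mul_nonneg h.2 h'.2
  lip x y := by
    have e : φ x * ψ x - φ y * ψ y = (φ x - φ y) * ψ x + φ y * (ψ x - ψ y) := by ring
    rw [e]
    refine (abs_add_le _ _).trans ?_
    rw [abs_mul, abs_mul]
    have h1 : |φ x - φ y| * |ψ x| ≤ (K * dist x y) * M' :=
      mul_le_mul (h.lip x y) (h'.bdd x) (abs_nonneg _) (mul_nonneg h.1 dist_nonneg)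
    have h2 : |φ y| * |ψ x - ψ y| ≤ M * (K' * dist x y) :=
      mul_le_mul (h.bdd y) (h'.lip x y) (abs_nonneg _) h.2
    linarith
  bdd x := by
    rw [abs_mul]
    exact mul_le_mul (h.bdd x) (h'.bdd x) (abs_nonneg _) h.2

theorem add (h : IsBddLip K M φ) (h' : IsBddLip K' M' ψ) :
    IsBddLip (K + K') (M + M') fun x => φ x + ψ x where
  nonneg_left := add_nonneg h.1 h'.1
  nonneg_right := add_nonneg h.2 h'.2
  lip x y := by
    have e : φ x + ψ x - (φ y + ψ y) = (φ x - φ y) + (ψ x - ψ y) := by ring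
    rw [e]
    have := abs_add_le (φ x - φ y) (ψ x - ψ y)
    have := h.lip x y
    have := h'.lip x y
    linarith
  bdd x := by
    have := abs_add_le (φ x) (ψ x)
    have := h.bdd x
    have := h'.bdd x
    linarith

theorem neg (h : IsBddLip K M φ) : IsBddLip K M fun x => -φ x where
  nonneg_left := h.1
  nonneg_right := h.2
  lip x y := by rw [neg_sub_neg, abs_sub_comm]; exact h.lip x y
  bdd x := by rw [abs_neg]; exact h.bdd x

theorem const_mul (h : IsBddLip K M φ) {c C : ℝ} (hc : |c| ≤ C) :
    IsBddLip (C * K) (C * M) fun x => c * φ x where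
  nonneg_left := mul_nonneg ((abs_nonneg c).trans hc) h.1
  nonneg_right := mul_nonneg ((abs_nonneg c).trans hc) h.2
  lip x y := by
    rw [← mul_sub, abs_mul, mul_assoc]
    exact mul_le_mul hc (h.lip x y) (abs_nonneg _) ((abs_nonneg c).trans hc)
  bdd x := by
    rw [abs_mul]
    exact mul_le_mul hc (h.bdd x) (abs_nonneg _) ((abs_nonneg c).trans hc)

theorem comp (h : IsBddLip K M φ) {Y : Type*} [PseudoMetricSpace Y] {u : Y → X}
    (hu : LipschitzWith 1 u) : IsBddLip K M fun y => φ (u y) where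
  nonneg_left := h.1
  nonneg_right := h.2
  lip x y := (h.lip _ _).trans (mul_le_mul_of_nonneg_left (by simpa using hu.dist_le_mul x y) h.1)
  bdd y := h.bdd _

end IsBddLip

theorem IsSmooth.exists_isBddLip {f : Torus → ℝ} (hf : IsSmooth f) :
    ∃ K M, IsBddLip K M fun p : Plane => f (proj p) := by
  obtain ⟨M, hM0, hM⟩ := exists_bound hf
  obtain ⟨C, hC0, hC⟩ := exists_bound (hf.partialDeriv 0)
  obtain ⟨D, hD0, hD⟩ := exists_bound (hf.partialDeriv 1)
  refine ⟨C + D, M, add_nonneg hC0 hD0, hM0, fun x y => ?_, fun x => hM _⟩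
  have hl := (convex_univ (𝕜 := ℝ) (E := Plane)).norm_image_sub_le_of_norm_fderiv_le
    (f := fun p : Plane => f (proj p)) (C := C + D) (fun p _ => pd_differentiableAt hf p)
    (fun p _ => by
      refine ContinuousLinearMap.opNorm_le_bound _ (add_nonneg hC0 hD0) fun v => ?_
      rw [fderiv_eq_pd, ← partialDeriv_proj hf, ← partialDeriv_proj hf]
      refine (norm_add_le _ _).trans ?_
      rw [norm_mul, norm_mul, add_mul]
      exact add_le_add (mul_le_mul (hC _) (norm_le_pi_norm v 0) (norm_nonneg _) hC0)
        (mul_le_mul (hD _) (norm_le_pi_norm v 1) (norm_nonneg _) hD0))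
    (Set.mem_univ y) (Set.mem_univ x)
  rw [dist_eq_norm]
  exact hl

/-- Integral curves of time-dependent combinations of two vector fields on the torus. -/
theorem exists_integral_curve {X Y : Torus → Plane} (hX : ∀ i, IsSmooth fun x => X x i)
    (hY : ∀ i, IsSmooth fun x => Y x i) {A B : ℝ → ℝ} (hA : Continuous A) (hB : Continuous B)
    (p₀ : Plane) : ∃ c : ℝ → Plane, c 0 = p₀ ∧
      ∀ t, HasDerivAt c (A t • X (proj (c t)) + B t • Y (proj (c t))) t := by
  refine exists_global_solution (f := fun t p => A t • X (proj p) + B t • Y (proj p)) ?_ ?_ p₀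
  · intro T
    choose K M hKM using fun i => (hX i).exists_isBddLip
    choose K' M' hKM' using fun i => (hY i).exists_isBddLip
    have hbd : ∀ {A : ℝ → ℝ}, Continuous A → ∃ C, 0 ≤ C ∧ ∀ t, |t| ≤ T → |A t| ≤ C := by
      intro A hA
      obtain ⟨C, hC⟩ := (isCompact_Icc (a := -T) (b := T)).exists_bound_of_continuousOn
        hA.continuousOn
      exact ⟨max C 0, le_max_right _ _, fun t ht =>
        (hC t (abs_le.1 ht)).trans (le_max_left _ _)⟩
    obtain ⟨C, hC0, hC⟩ := hbd hA
    obtain ⟨D, hD0, hD⟩ := hbd hB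
    have key : ∀ t, |t| ≤ T → ∀ i, IsBddLip (C * K i + D * K' i) (C * M i + D * M' i)
        fun p => (A t • X (proj p) + B t • Y (proj p)) i := fun t ht i =>
      ((hKM i).const_mul (hC t ht)).add ((hKM' i).const_mul (hD t ht))
    have hK0 : ∀ i, 0 ≤ C * K i + D * K' i := fun i =>
      add_nonneg (mul_nonneg hC0 (hKM i).1) (mul_nonneg hD0 (hKM' i).1)
    have hM0 : ∀ i, 0 ≤ C * M i + D * M' i := fun i =>
      add_nonneg (mul_nonneg hC0 (hKM i).2) (mul_nonneg hD0 (hKM' i).2)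
    refine ⟨⟨∑ i, (C * K i + D * K' i), Finset.sum_nonneg fun i _ => hK0 i⟩,
      ⟨∑ i, (C * M i + D * M' i), Finset.sum_nonneg fun i _ => hM0 i⟩, fun t ht => ⟨?_, ?_⟩⟩
    · refine LipschitzWith.of_dist_le_mul fun p q => ?_
      refine (dist_pi_le_iff (mul_nonneg (NNReal.coe_nonneg _) dist_nonneg)).2 fun i => ?_
      refine ((key t ht i).lip p q).trans (mul_le_mul_of_nonneg_right ?_ dist_nonneg)
      exact Finset.single_le_sum (f := fun i => C * K i + D * K' i) (fun i _ => hK0 i)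
        (Finset.mem_univ i)
    · intro p
      refine (pi_norm_le_iff_of_nonneg (NNReal.coe_nonneg _)).2 fun i =>
        ((key t ht i).bdd p).trans ?_
      exact Finset.single_le_sum (f := fun i => C * M i + D * M' i) (fun i _ => hM0 i)
        (Finset.mem_univ i)
  · intro p
    fun_prop

/-! ### Velocities and lifts of curves -/

/-- Characters of the torus do not depend on the chosen local lift. They turn velocities into
ordinary complex derivatives, which yields uniqueness of velocities and the lifting of curves. -/
theorem HasVelocityAt.hasDerivAt_toCircle {γ : ℝ → Torus} {v : Plane} {t : ℝ}
    (h : HasVelocityAt γ v t) (k : Fin 2) :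
    HasDerivAt (fun s => (AddCircle.toCircle (γ s k) : ℂ))
      (2 * Real.pi * Complex.I * v k * AddCircle.toCircle (γ t k)) t := by
  obtain ⟨c, hc, hcγ⟩ := h
  have e : ∀ s, proj (c s) = γ s →
      (AddCircle.toCircle (γ s k) : ℂ) = Complex.exp (2 * Real.pi * Complex.I * c s k) := by
    intro s hs
    rw [← hs]
    simp only [proj, AddCircle.toCircle_apply_mk, Circle.coe_exp]
    congr 1
    push_cast
    ring
  have hck : HasDerivAt (fun s => ((c s k : ℝ) : ℂ)) (v k : ℂ) t :=
    ((hasDerivAt_pi.1 hc) k).ofReal_comp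
  have h1 := (hck.const_mul (2 * Real.pi * Complex.I)).cexp
  rw [e t hcγ.self_of_nhds]
  refine (h1.congr_of_eventuallyEq (hcγ.mono fun s hs => e s hs)).congr_deriv ?_
  ring

theorem HasVelocityAt.unique {γ γ' : ℝ → Torus} {v v' : Plane} {t : ℝ}
    (h : HasVelocityAt γ v t) (h' : HasVelocityAt γ' v' t) (e : γ =ᶠ[𝓝 t] γ') : v = v' := by
  funext k
  have h1 := h.hasDerivAt_toCircle k
  have h2 := (h'.hasDerivAt_toCircle k).congr_of_eventuallyEq
    (f₁ := fun s => (AddCircle.toCircle (γ s k) : ℂ))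
    (e.mono fun s hs => by simp only [hs])
  have h3 := h1.unique h2
  rw [← e.self_of_nhds] at h3
  have hne : (AddCircle.toCircle (γ t k) : ℂ) ≠ 0 := Circle.coe_ne_zero _
  have h4 := mul_right_cancel₀ hne h3
  have h5 := mul_left_cancel₀ Complex.two_pi_I_ne_zero h4
  exact_mod_cast h5

/-- The lift is the integral of the velocity. Its projection and `γ` have the same logarithmic
derivative under each character, so the quotient of the characters is constant on `I`. -/
theorem exists_lift {I : Set ℝ} (hI : IsOpen I) (hI' : I.OrdConnected) {γ : ℝ → Torus}
    {v : ℝ → Plane} (hγ : ∀ t ∈ I, HasVelocityAt γ (v t) t) (hv : ContinuousOn v I) {t₀ : ℝ}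
    (ht₀ : t₀ ∈ I) {p₀ : Plane} (hp₀ : proj p₀ = γ t₀) :
    ∃ c : ℝ → Plane, c t₀ = p₀ ∧ ∀ t ∈ I, HasDerivAt c (v t) t ∧ proj (c t) = γ t := by
  set c : ℝ → Plane := fun t => p₀ + ∫ s in t₀..t, v s with hc
  have hct₀ : c t₀ = p₀ := by simp [hc]
  have hcd : ∀ t ∈ I, HasDerivAt c (v t) t := by
    intro t ht
    have hsub : Set.uIcc t₀ t ⊆ I := hI'.uIcc_subset ht₀ ht
    exact (intervalIntegral.integral_hasDerivAt_right ((hv.mono hsub).intervalIntegrable)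
      (hv.stronglyMeasurableAtFilter hI t ht) (hv.continuousAt (hI.mem_nhds ht))).const_add p₀
  refine ⟨c, hct₀, fun t ht => ⟨hcd t ht, ?_⟩⟩
  funext k
  have hvel : ∀ t ∈ I, HasVelocityAt (fun s => proj (c s)) (v t) t := fun t ht =>
    ⟨c, hcd t ht, Filter.Eventually.of_forall fun _ => rfl⟩
  set F : ℝ → ℂ := fun s => (AddCircle.toCircle (γ s k) : ℂ) with hF
  set G : ℝ → ℂ := fun s => (AddCircle.toCircle (proj (c s) k) : ℂ) with hG
  have hG0 : ∀ s, G s ≠ 0 := fun s => Circle.coe_ne_zero _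
  have hd : ∀ t ∈ I, HasDerivAt (fun s => F s / G s) 0 t := by
    intro t ht
    have h1 := (hγ t ht).hasDerivAt_toCircle k
    have h2 := (hvel t ht).hasDerivAt_toCircle k
    refine (h1.fun_div h2 (hG0 t)).congr_deriv ?_
    rw [div_eq_zero_iff]
    left
    ring
  have hconst := hI.is_const_of_deriv_eq_zero hI'.isPreconnected (𝕜 := ℝ)
    (f := fun s => F s / G s)
    (fun s hs => (hd s hs).differentiableAt.differentiableWithinAt)
    (fun s hs => (hd s hs).deriv) ht ht₀
  have h0 : F t₀ / G t₀ = 1 := by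
    simp only [hF, hG, hct₀, hp₀]
    exact div_self (Circle.coe_ne_zero _)
  have h1 : G t = F t := by
    have : F t / G t = 1 := hconst.trans h0
    rw [div_eq_one_iff_eq (hG0 t)] at this
    exact this.symm
  exact AddCircle.injective_toCircle one_ne_zero (Circle.ext h1)

/-! ### Geodesics and completeness -/

/-- Truncation to the interval `[-r, r]`. -/
def clamp (r x : ℝ) : ℝ := max (-r) (min r x)

theorem clamp_eq_self {r x : ℝ} (h : |x| ≤ r) : clamp r x = x := by
  have := abs_le.1 h
  rw [clamp, min_eq_right this.2, max_eq_right this.1]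

theorem abs_clamp_le {r : ℝ} (hr : 0 ≤ r) (x : ℝ) : |clamp r x| ≤ r :=
  abs_le.2 ⟨le_max_left _ _, max_le (by linarith) (min_le_left _ _)⟩

theorem abs_clamp_sub_clamp_le (r x y : ℝ) : |clamp r x - clamp r y| ≤ |x - y| := by
  unfold clamp
  rw [max_comm, max_comm (-r)]
  refine (abs_max_sub_max_le_abs _ _ _).trans ?_
  rw [min_comm, min_comm r]
  simpa using abs_min_sub_min_le_max x r y r

/-- The derivative is controlled only for `|t| < r` while the conclusion reaches `|t| = r`: this is
what an argument at a first bad time needs. -/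
theorem abs_sub_le_of_hasDerivAt {P P' : ℝ → ℝ} (hP : Continuous P) {r C : ℝ}
    (hd : ∀ t, |t| < r → HasDerivAt P (P' t) t) (hb : ∀ t, |t| < r → |P' t| ≤ C) {t : ℝ}
    (ht : |t| ≤ r) : |P t - P 0| ≤ C * |t| := by
  rcases lt_trichotomy t 0 with h | h | h
  · rw [abs_of_neg h] at ht
    have hmem : ∀ s ∈ Set.Ioo t 0, |s| < r := fun s hs => by
      rw [abs_of_neg hs.2]; linarith [hs.1]
    obtain ⟨s, hs, e⟩ := exists_hasDerivAt_eq_slope P P' h hP.continuousOn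
      (fun s hs => hd s (hmem s hs))
    have h1 := hb s (hmem s hs)
    rw [eq_div_iff (by linarith)] at e
    rw [abs_sub_comm, ← e, abs_mul, zero_sub, abs_neg]
    exact mul_le_mul_of_nonneg_right h1 (abs_nonneg _)
  · simp [h]
  · rw [abs_of_pos h] at ht
    have hmem : ∀ s ∈ Set.Ioo 0 t, |s| < r := fun s hs => by
      rw [abs_of_pos hs.1]; linarith [hs.2]
    obtain ⟨s, hs, e⟩ := exists_hasDerivAt_eq_slope P P' h hP.continuousOn
      (fun s hs => hd s (hmem s hs))
    have h1 := hb s (hmem s hs)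
    rw [eq_div_iff (by linarith)] at e
    rw [← e, abs_mul, sub_zero]
    exact mul_le_mul_of_nonneg_right h1 (abs_nonneg _)

namespace LorentzMetric
variable {g : LorentzMetric}

/-- The acceleration of a geodesic with velocity `u`. -/
def accel (g : LorentzMetric) (x : Torus) (u : Plane) : Plane :=
  fun k => -∑ i, ∑ j, g.christoffel k i j x * u i * u j

theorem hasDerivAt_comp (g : LorentzMetric) {c : ℝ → Plane} {u : Plane} {t : ℝ}
    (hc : HasDerivAt c u t) (i j) : HasDerivAt (fun s => g.comp (proj (c s)) i j)
      (∑ l, (∑ k, (g.christoffel k l i (proj (c t)) * g.comp (proj (c t)) k j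
        + g.christoffel k l j (proj (c t)) * g.comp (proj (c t)) i k)) * u l) t := by
  refine (hasDerivAt_plane_comp (g.smooth i j) hc).congr_deriv ?_
  rw [← partialDeriv_proj (g.smooth i j), ← partialDeriv_proj (g.smooth i j),
    g.partialDeriv_comp, g.partialDeriv_comp]
  simp only [Fin.sum_univ_two]

/-- The scalar product with a conformal field along a geodesic. -/
theorem hasDerivAt_inner_conformal {K : Torus → Plane} (hK : ∀ k, IsSmooth fun x => K x k)
    {σ : Torus → ℝ} (hσ : ∀ i j x, g.lieDeriv K i j x = 2 * σ x * g.comp x i j)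
    {c v : ℝ → Plane} {t : ℝ} (hc : HasDerivAt c (v t) t)
    (hv : HasDerivAt v (g.accel (proj (c t)) (v t)) t) :
    HasDerivAt (fun s => g.inner (proj (c s)) (v s) (K (proj (c s))))
      (σ (proj (c t)) * g.inner (proj (c t)) (v t) (v t)) t := by
  have hvk := hasDerivAt_pi.1 hv
  have hKk := fun k => hasDerivAt_plane_comp (hK k) hc
  have hterm := fun i j => ((g.hasDerivAt_comp hc i j).mul (hvk i)).mul (hKk j)
  have hsum := ((hterm 0 0).add (hterm 0 1)).add ((hterm 1 0).add (hterm 1 1))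
  have e : (fun s => g.inner (proj (c s)) (v s) (K (proj (c s)))) = fun s =>
      (g.comp (proj (c s)) 0 0 * v s 0 * K (proj (c s)) 0
        + g.comp (proj (c s)) 0 1 * v s 0 * K (proj (c s)) 1)
      + (g.comp (proj (c s)) 1 0 * v s 1 * K (proj (c s)) 0
        + g.comp (proj (c s)) 1 1 * v s 1 * K (proj (c s)) 1) := by
    funext s; simp only [inner, Fin.sum_univ_two]
  rw [e]
  refine hsum.congr_deriv ?_
  have h00 := hσ 0 0 (proj (c t))
  have h01 := hσ 0 1 (proj (c t))
  have h11 := hσ 1 1 (proj (c t))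
  simp only [lieDeriv, Fin.sum_univ_two, g.partialDeriv_comp, g.comp_symm _ 1 0,
    g.christoffel_symm _ 1 0, partialDeriv_proj (hK _)] at h00 h01 h11
  simp only [inner, accel, Fin.sum_univ_two, g.comp_symm _ 1 0, g.christoffel_symm _ 1 0,
    Pi.mul_apply]
  linear_combination (v t 0 * v t 0 / 2) * h00 + v t 0 * v t 1 * h01 + (v t 1 * v t 1 / 2) * h11

/-- The energy of a geodesic is constant. -/
theorem hasDerivAt_inner_self {c v : ℝ → Plane} {t : ℝ} (hc : HasDerivAt c (v t) t)
    (hv : HasDerivAt v (g.accel (proj (c t)) (v t)) t) :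
    HasDerivAt (fun s => g.inner (proj (c s)) (v s) (v s)) 0 t := by
  have hvk := hasDerivAt_pi.1 hv
  have hterm := fun i j => ((g.hasDerivAt_comp hc i j).mul (hvk i)).mul (hvk j)
  have hsum := ((hterm 0 0).add (hterm 0 1)).add ((hterm 1 0).add (hterm 1 1))
  have e : (fun s => g.inner (proj (c s)) (v s) (v s)) = fun s =>
      (g.comp (proj (c s)) 0 0 * v s 0 * v s 0
        + g.comp (proj (c s)) 0 1 * v s 0 * v s 1)
      + (g.comp (proj (c s)) 1 0 * v s 1 * v s 0
        + g.comp (proj (c s)) 1 1 * v s 1 * v s 1) := by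
    funext s; simp only [inner, Fin.sum_univ_two]
  rw [e]
  refine hsum.congr_deriv ?_
  simp only [accel, Fin.sum_univ_two, g.comp_symm _ 1 0, g.christoffel_symm _ 1 0,
    Pi.mul_apply]
  ring

/-- The geodesic field on the tangent bundle of the plane, with truncated velocities. -/
def geodesicField (g : LorentzMetric) (R : ℝ) (z : Plane × Plane) : Plane × Plane :=
  (fun i => clamp R (z.2 i), g.accel (proj z.1) fun i => clamp R (z.2 i))

theorem geodesicField_eq {R : ℝ} {z : Plane × Plane} (h : ‖z.2‖ ≤ R) :
    g.geodesicField R z = (z.2, g.accel (proj z.1) z.2) := by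
  have : (fun i => clamp R (z.2 i)) = z.2 := funext fun i =>
    clamp_eq_self ((norm_le_pi_norm z.2 i).trans h)
  rw [geodesicField, this]

/-- Uniformity in `R` allows a truncation radius that varies with time. -/
theorem geodesicField_bounds (g : LorentzMetric) (T : ℝ) : ∃ K L : NNReal, ∀ R, 0 ≤ R → R ≤ T →
    LipschitzWith K (g.geodesicField R) ∧ ∀ z, ‖g.geodesicField R z‖ ≤ L := by
  choose K M hKM using fun k i j => (g.christoffel_smooth k i j).exists_isBddLip
  have hΓ : ∀ k i j, IsBddLip (K k i j) (M k i j)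
      fun z : Plane × Plane => g.christoffel k i j (proj z.1) := fun k i j =>
    (hKM k i j).comp LipschitzWith.prod_fst
  have hcl : ∀ i R, 0 ≤ R → R ≤ T → IsBddLip 1 T fun z : Plane × Plane => clamp R (z.2 i) := by
    intro i R h0 hT
    refine ⟨zero_le_one, h0.trans hT, fun x y => ?_, fun z => (abs_clamp_le h0 _).trans hT⟩
    rw [one_mul]
    refine (abs_clamp_sub_clamp_le _ _ _).trans ?_
    exact (dist_le_pi_dist x.2 y.2 i).trans (le_max_right _ _)
  have hac : ∀ k, ∃ K M, ∀ R, 0 ≤ R → R ≤ T →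
      IsBddLip K M fun z : Plane × Plane => (g.geodesicField R z).2 k := by
    intro k
    have key := fun (R : ℝ) (h0 : 0 ≤ R) (hT : R ≤ T) =>
      (((((hΓ k 0 0).mul (hcl 0 R h0 hT)).mul (hcl 0 R h0 hT)).add
        (((hΓ k 0 1).mul (hcl 0 R h0 hT)).mul (hcl 1 R h0 hT))).add
      ((((hΓ k 1 0).mul (hcl 1 R h0 hT)).mul (hcl 0 R h0 hT)).add
        (((hΓ k 1 1).mul (hcl 1 R h0 hT)).mul (hcl 1 R h0 hT)))).neg
    exact ⟨_, _, fun R h0 hT => by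
      simpa only [geodesicField, accel, Fin.sum_univ_two] using key R h0 hT⟩
  choose K' M' hKM' using hac
  refine ⟨Real.toNNReal (1 + |K' 0| + |K' 1|), Real.toNNReal (|T| + |M' 0| + |M' 1|),
    fun R h0 hT => ?_⟩
  have hK' : ∀ k, K' k ≤ 1 + |K' 0| + |K' 1| := by
    intro k
    have := le_abs_self (K' 0)
    have := le_abs_self (K' 1)
    have := abs_nonneg (K' 0)
    have := abs_nonneg (K' 1)
    fin_cases k <;> simp <;> linarith
  have hM' : ∀ k, M' k ≤ |T| + |M' 0| + |M' 1| := by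
    intro k
    have := le_abs_self (M' 0)
    have := le_abs_self (M' 1)
    have := abs_nonneg (M' 0)
    have := abs_nonneg (M' 1)
    have := abs_nonneg T
    fin_cases k <;> simp <;> linarith
  have hK1 : (1 : ℝ) ≤ 1 + |K' 0| + |K' 1| := by
    have := abs_nonneg (K' 0)
    have := abs_nonneg (K' 1)
    linarith
  have hMT : T ≤ |T| + |M' 0| + |M' 1| := by
    have := abs_nonneg (M' 0)
    have := abs_nonneg (M' 1)
    have := le_abs_self T
    linarith
  constructor
  · refine LipschitzWith.of_dist_le_mul fun x y => ?_
    rw [Real.coe_toNNReal _ (by positivity)]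
    have hnn : 0 ≤ (1 + |K' 0| + |K' 1|) * dist x y := by positivity
    refine max_le ((dist_pi_le_iff hnn).2 fun i => ?_) ((dist_pi_le_iff hnn).2 fun i => ?_)
    · exact ((hcl i R h0 hT).lip x y).trans (mul_le_mul_of_nonneg_right hK1 dist_nonneg)
    · exact ((hKM' i R h0 hT).lip x y).trans (mul_le_mul_of_nonneg_right (hK' i) dist_nonneg)
  · intro z
    rw [Real.coe_toNNReal _ (by positivity)]
    have hnn : 0 ≤ |T| + |M' 0| + |M' 1| := by positivity
    refine max_le ((pi_norm_le_iff_of_nonneg hnn).2 fun i => ?_)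
      ((pi_norm_le_iff_of_nonneg hnn).2 fun i => ?_)
    · exact ((hcl i R h0 hT).bdd z).trans hMT
    · exact ((hKM' i R h0 hT).bdd z).trans (hM' i)

/-- Geodesics are determined by their initial data. -/
theorem geodesic_unique {I : Set ℝ} (hI : I.OrdConnected) {c v c' v' : ℝ → Plane}
    (h : ∀ t ∈ I, HasDerivAt c (v t) t ∧ HasDerivAt v (g.accel (proj (c t)) (v t)) t)
    (h' : ∀ t ∈ I, HasDerivAt c' (v' t) t ∧ HasDerivAt v' (g.accel (proj (c' t)) (v' t)) t)
    {t₀ t₁ : ℝ} (ht₀ : t₀ ∈ I) (ht₁ : t₁ ∈ I) (hc : c t₀ = c' t₀) (hv : v t₀ = v' t₀) :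
    c t₁ = c' t₁ := by
  have hsub : Set.uIcc t₀ t₁ ⊆ I := hI.uIcc_subset ht₀ ht₁
  have hcont : ∀ {c v : ℝ → Plane},
      (∀ t ∈ I, HasDerivAt c (v t) t ∧ HasDerivAt v (g.accel (proj (c t)) (v t)) t) →
      ContinuousOn (fun t => (c t, v t)) (Set.uIcc t₀ t₁) := fun h t ht =>
    ((h t (hsub ht)).1.prodMk (h t (hsub ht)).2).continuousAt.continuousWithinAt
  have hbd : ∀ {c v : ℝ → Plane},
      (∀ t ∈ I, HasDerivAt c (v t) t ∧ HasDerivAt v (g.accel (proj (c t)) (v t)) t) →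
      ∃ R, ∀ t ∈ Set.uIcc t₀ t₁, ‖v t‖ ≤ R := fun h =>
    isCompact_uIcc.exists_bound_of_continuousOn
      fun t ht => (h t (hsub ht)).2.continuousAt.continuousWithinAt
  obtain ⟨R₁, hR₁⟩ := hbd h
  obtain ⟨R₂, hR₂⟩ := hbd h'
  -- Both velocities are bounded on the compact segment, so at this radius neither curve notices the
  -- truncation and uniqueness for a Lipschitz field applies.
  set R := max R₁ R₂ with hR
  have hR0 : 0 ≤ R := (norm_nonneg _).trans
    ((hR₁ t₀ Set.left_mem_uIcc).trans (le_max_left _ _))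
  obtain ⟨K, L, hKL⟩ := g.geodesicField_bounds R
  have hlip := (hKL R hR0 le_rfl).1
  have hd : ∀ t ∈ Set.uIcc t₀ t₁,
      HasDerivAt (fun t => (c t, v t)) (g.geodesicField R (c t, v t)) t := fun t ht => by
    rw [geodesicField_eq (z := (c t, v t)) ((hR₁ t ht).trans (le_max_left _ _))]
    exact (h t (hsub ht)).1.prodMk (h t (hsub ht)).2
  have hd' : ∀ t ∈ Set.uIcc t₀ t₁,
      HasDerivAt (fun t => (c' t, v' t)) (g.geodesicField R (c' t, v' t)) t := fun t ht => by
    rw [geodesicField_eq (z := (c' t, v' t)) ((hR₂ t ht).trans (le_max_right _ _))]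
    exact (h' t (hsub ht)).1.prodMk (h' t (hsub ht)).2
  have h0 : (c t₀, v t₀) = (c' t₀, v' t₀) := by rw [hc, hv]
  have hk := hcont h
  have hk' := hcont h'
  have key : (c t₁, v t₁) = (c' t₁, v' t₁) := by
    rcases le_total t₀ t₁ with hle | hle
    · rw [Set.uIcc_of_le hle] at hd hd' hk hk'
      exact ODE_solution_unique_of_mem_Icc_right (v := fun _ => g.geodesicField R)
        (s := fun _ => Set.univ) (K := K) (fun _ _ => hlip.lipschitzOnWith) hk
        (fun t ht => (hd t (Set.Ico_subset_Icc_self ht)).hasDerivWithinAt) (fun _ _ => trivial) hk'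
        (fun t ht => (hd' t (Set.Ico_subset_Icc_self ht)).hasDerivWithinAt) (fun _ _ => trivial)
        h0 (Set.right_mem_Icc.2 hle)
    · rw [Set.uIcc_of_ge hle] at hd hd' hk hk'
      exact ODE_solution_unique_of_mem_Icc_left (v := fun _ => g.geodesicField R)
        (s := fun _ => Set.univ) (K := K) (fun _ _ => hlip.lipschitzOnWith) hk
        (fun t ht => (hd t (Set.Ioc_subset_Icc_self ht)).hasDerivWithinAt) (fun _ _ => trivial) hk'
        (fun t ht => (hd' t (Set.Ioc_subset_Icc_self ht)).hasDerivWithinAt) (fun _ _ => trivial)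
        h0 (Set.left_mem_Icc.2 hle)
  exact congrArg Prod.fst key

theorem continuous_inner {c u w : ℝ → Plane} (hc : Continuous c) (hu : Continuous u)
    (hw : Continuous w) : Continuous fun t => g.inner (proj (c t)) (u t) (w t) := by
  have hg : ∀ i j, Continuous fun t => g.comp (proj (c t)) i j := fun i j =>
    (g.smooth i j).continuous.comp (continuous_proj.comp hc)
  have hu' : ∀ i, Continuous fun t => u t i := fun i => (continuous_apply i).comp hu
  have hw' : ∀ i, Continuous fun t => w t i := fun i => (continuous_apply i).comp hw
  simp only [inner]
  exact continuous_finsetSum _ fun i _ => continuous_finsetSum _ fun j _ =>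
    ((hg i j).mul (hu' i)).mul (hw' j)

/-- In the null frame dual to `a`, `b`, the coefficients of `u` are its two scalar products,
interchanged and divided by `Ω`; compactness bounds the frame and `1 / Ω`. -/
theorem IsNullCoframe.exists_norm_le {Ω a b} (h : g.IsNullCoframe Ω a b) : ∃ M, 0 ≤ M ∧ ∀ x u,
    ‖u‖ ≤ M * (|g.inner x u (dualField a b 1 0 x)| + |g.inner x u (dualField a b 0 1 x)|) := by
  have hΩ : ∀ x, Ω x ≠ 0 := fun x => (h.pos x).ne'
  choose M hM0 hM using fun k => exists_bound ((h.dualField_smooth 1 0 k).div h.smooth hΩ)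
  choose N hN0 hN using fun k => exists_bound ((h.dualField_smooth 0 1 k).div h.smooth hΩ)
  refine ⟨∑ k, (M k + N k), Finset.sum_nonneg fun k _ => add_nonneg (hM0 k) (hN0 k),
    fun x u => ?_⟩
  have hle : ∀ k, M k + N k ≤ ∑ k, (M k + N k) := fun k =>
    Finset.single_le_sum (f := fun k => M k + N k) (fun k _ => add_nonneg (hM0 k) (hN0 k))
      (Finset.mem_univ k)
  set P := g.inner x u (dualField a b 1 0 x) with hP
  set Q := g.inner x u (dualField a b 0 1 x) with hQ
  have hS0 : 0 ≤ ∑ k, (M k + N k) := Finset.sum_nonneg fun k _ => add_nonneg (hM0 k) (hN0 k)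
  refine (pi_norm_le_iff_of_nonneg (mul_nonneg hS0 (by positivity))).2 fun k => ?_
  have e : u k = dualField a b 1 0 x k / Ω x * Q + dualField a b 0 1 x k / Ω x * P := by
    rw [hP, hQ, h.inner_eq, h.inner_eq, h.left_dualField, h.left_dualField, h.right_dualField,
      h.right_dualField]
    have hw := h.wedge_ne_zero x
    have hΩ := hΩ x
    simp only [dualField]
    set w := a x 0 * b x 1 - a x 1 * b x 0 with hwdef
    fin_cases k
    · simp only [Fin.zero_eta, Matrix.cons_val_zero]
      field_simp
      rw [hwdef]
      ring
    · simp only [Fin.mk_one, Matrix.cons_val_one, Matrix.cons_val_zero]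
      field_simp
      rw [hwdef]
      ring
  rw [e]
  refine (norm_add_le _ _).trans ?_
  rw [norm_mul, norm_mul]
  have h1 : ‖dualField a b 1 0 x k / Ω x‖ * ‖Q‖ ≤ M k * |Q| :=
    mul_le_mul_of_nonneg_right (hM k x) (norm_nonneg _)
  have h2 : ‖dualField a b 0 1 x k / Ω x‖ * ‖P‖ ≤ N k * |P| :=
    mul_le_mul_of_nonneg_right (hN k x) (norm_nonneg _)
  have h3 := mul_le_mul_of_nonneg_right (hle k) (add_nonneg (abs_nonneg P) (abs_nonneg Q))
  have h4 := mul_nonneg (hM0 k) (abs_nonneg P)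
  have h5 := mul_nonneg (hN0 k) (abs_nonneg Q)
  linarith

/-- Geodesics of a metric with a null coframe exist for all times. -/
theorem IsNullCoframe.exists_geodesic {Ω a b} (h : g.IsNullCoframe Ω a b) (p₀ v₀ : Plane) :
    ∃ c v : ℝ → Plane, c 0 = p₀ ∧ v 0 = v₀ ∧ ∀ t, HasDerivAt c (v t) t ∧
      HasDerivAt v (g.accel (proj (c t)) (v t)) t := by
  obtain ⟨M, hM0, hM⟩ := h.exists_norm_le
  obtain ⟨hXs, σ, hσs, hσ⟩ := h.isConformalField_dualField 1 0
  obtain ⟨hYs, τ, hτs, hτ⟩ := h.isConformalField_dualField 0 1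
  obtain ⟨S, hS0, hS⟩ := exists_bound hσs
  obtain ⟨S', hS0', hS'⟩ := exists_bound hτs
  set X := dualField a b 1 0 with hX
  set Y := dualField a b 0 1 with hY
  set E₀ := g.inner (proj p₀) v₀ v₀ with hE₀
  set P₀ := g.inner (proj p₀) v₀ (X (proj p₀)) with hP₀
  set Q₀ := g.inner (proj p₀) v₀ (Y (proj p₀)) with hQ₀
  -- The a priori bound on the velocity at time `t`, plus `1` so that the truncation is never
  -- reached.
  set R : ℝ → ℝ := fun t => M * ((|P₀| + S * |E₀| * |t|) + (|Q₀| + S' * |E₀| * |t|)) + 1 with hR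
  have hR0 : ∀ t, 0 ≤ R t := fun t => by positivity
  have hRmono : ∀ T t, |t| ≤ T → R t ≤ R T := by
    intro T t ht
    have : |t| ≤ |T| := ht.trans (le_abs_self T)
    simp only [hR]
    gcongr
  have hRc : Continuous R := by fun_prop
  obtain ⟨α, hα0, hα⟩ := exists_global_solution (f := fun t => g.geodesicField (R t)) (by
    intro T
    obtain ⟨K, L, hKL⟩ := g.geodesicField_bounds (R T)
    exact ⟨K, L, fun t ht => hKL (R t) (hR0 t) (hRmono T t ht)⟩) (by
    intro z
    have hcl : ∀ i, Continuous fun t => clamp (R t) (z.2 i) := fun i => by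
      unfold clamp; fun_prop
    refine (continuous_pi hcl).prodMk (continuous_pi fun k => ?_)
    simp only [accel]
    fun_prop) (p₀, v₀)
  set c : ℝ → Plane := fun t => (α t).1 with hc
  set v : ℝ → Plane := fun t => (α t).2 with hv
  have hαc : Continuous α := continuous_iff_continuousAt.2 fun t => (hα t).continuousAt
  have hcc : Continuous c := continuous_fst.comp hαc
  have hvc : Continuous v := continuous_snd.comp hαc
  have hgeo : ∀ t, ‖v t‖ ≤ R t → HasDerivAt c (v t) t ∧
      HasDerivAt v (g.accel (proj (c t)) (v t)) t := by
    intro t ht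
    have := hα t
    simp only [geodesicField_eq ht] at this
    exact ⟨(ContinuousLinearMap.fst ℝ Plane Plane).hasFDerivAt.comp_hasDerivAt t this,
      (ContinuousLinearMap.snd ℝ Plane Plane).hasFDerivAt.comp_hasDerivAt t this⟩
  have hXc : ∀ {X : Torus → Plane}, (∀ k, IsSmooth fun x => X x k) →
      Continuous fun t => X (proj (c t)) := fun hX =>
    continuous_pi fun k => (hX k).continuous.comp (continuous_proj.comp hcc)
  have hlt : ∀ t, ‖v t‖ < R t := by
    by_contra hcon
    push Not at hcon
    have hcl : IsClosed {t | R t ≤ ‖v t‖} := isClosed_le hRc hvc.norm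
    -- A bad time closest to `0`: for `|t| < |s|` the curve is a true geodesic, so the conservation
    -- laws hold up to `s` and contradict `R s ≤ ‖v s‖`.
    obtain ⟨s, hs, hsd⟩ := hcl.exists_infDist_eq_dist hcon 0
    have hin : ∀ t, |t| < |s| → ‖v t‖ ≤ R t := by
      intro t ht
      by_contra hbad
      push Not at hbad
      have := Metric.infDist_le_dist_of_mem (x := (0 : ℝ)) (s := {t | R t ≤ ‖v t‖}) hbad.le
      rw [hsd, dist_zero_left, dist_zero_left] at this
      exact absurd ht (not_lt.2 this)
    have hE : ∀ t, |t| ≤ |s| → g.inner (proj (c t)) (v t) (v t) = E₀ := by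
      intro t ht
      have h1 := abs_sub_le_of_hasDerivAt (C := 0) (continuous_inner (g := g) hcc hvc hvc)
        (fun t ht => hasDerivAt_inner_self (hgeo t (hin t ht)).1 (hgeo t (hin t ht)).2)
        (fun t _ => by simp) ht
      rw [zero_mul] at h1
      have h2 := sub_eq_zero.1 (abs_nonpos_iff.1 h1)
      rw [h2]
      simp only [hc, hv, hα0, hE₀]
    have hbd : ∀ {X : Torus → Plane} {σ : Torus → ℝ} {S : ℝ}, (∀ k, IsSmooth fun x => X x k) →
        (∀ i j x, g.lieDeriv X i j x = 2 * σ x * g.comp x i j) → (∀ x, |σ x| ≤ S) →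
        |g.inner (proj (c s)) (v s) (X (proj (c s)))|
          ≤ |g.inner (proj p₀) v₀ (X (proj p₀))| + S * |E₀| * |s| := by
      intro X σ S hXs hσ hS
      have h1 := abs_sub_le_of_hasDerivAt (C := S * |E₀|) (t := s) (r := |s|)
        (continuous_inner (g := g) hcc hvc (hXc hXs))
        (fun t ht => hasDerivAt_inner_conformal hXs hσ (hgeo t (hin t ht)).1 (hgeo t (hin t ht)).2)
        (fun t ht => by
          rw [hE t ht.le, abs_mul]
          exact mul_le_mul_of_nonneg_right (hS _) (abs_nonneg _)) le_rfl
      have h0 : g.inner (proj (c 0)) (v 0) (X (proj (c 0)))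
          = g.inner (proj p₀) v₀ (X (proj p₀)) := by simp only [hc, hv, hα0]
      rw [h0] at h1
      have h2 := abs_sub_abs_le_abs_sub (g.inner (proj (c s)) (v s) (X (proj (c s))))
        (g.inner (proj p₀) v₀ (X (proj p₀)))
      linarith
    have hP := hbd hXs hσ hS
    have hQ := hbd hYs hτ hS'
    have h1 := hM (proj (c s)) (v s)
    have h2 := mul_le_mul_of_nonneg_left (add_le_add hP hQ) hM0
    have h3 : R s ≤ ‖v s‖ := hs
    simp only [hR] at h3
    linarith
  exact ⟨c, v, by simp only [hc, hα0], by simp only [hv, hα0], fun t => hgeo t (hlt t).le⟩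

theorem IsNullCoframe.isComplete {Ω a b} (h : g.IsNullCoframe Ω a b) : g.IsComplete := by
  intro I γ v hI hI' ⟨t₀, ht₀⟩ hγ
  obtain ⟨p₀, hp₀⟩ := proj_surjective (γ t₀)
  have hvd : ∀ t ∈ I, HasDerivAt v (g.accel (γ t) (v t)) t := fun t ht =>
    hasDerivAt_pi.2 fun k => (hγ t ht).2 k
  obtain ⟨c, hc0, hc⟩ := exists_lift hI hI' (fun t ht => (hγ t ht).1)
    (fun t ht => (hvd t ht).continuousAt.continuousWithinAt) ht₀ hp₀
  obtain ⟨d, w, hd0, hw0, hdw⟩ := h.exists_geodesic p₀ (v t₀)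
  have hsh : ∀ t, HasDerivAt (fun s => d (s - t₀)) (w (t - t₀)) t ∧
      HasDerivAt (fun s => w (s - t₀)) (g.accel (proj (d (t - t₀))) (w (t - t₀))) t := fun t =>
    ⟨(hdw (t - t₀)).1.comp_sub_const t t₀, (hdw (t - t₀)).2.comp_sub_const t t₀⟩
  refine ⟨fun t => proj (d (t - t₀)), fun t => w (t - t₀), fun t _ => ⟨⟨fun s => d (s - t₀),
    (hsh t).1, Filter.Eventually.of_forall fun _ => rfl⟩, fun k => hasDerivAt_pi.1 (hsh t).2 k⟩,
    fun t ht => ?_⟩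
  rw [← (hc t ht).2]
  refine congrArg proj (geodesic_unique (g := g) hI' (v := fun s => w (s - t₀)) (v' := v)
    (fun t _ => hsh t) (fun t ht => ⟨(hc t ht).1, ?_⟩) ht₀ ht ?_ ?_)
  · rw [(hc t ht).2]; exact hvd t ht
  · simp [hd0, hc0]
  · simp [hw0]

end LorentzMetric

/-! ### Small perturbations -/

/-- The norm of the derivative is periodic, hence a continuous function on a compact torus. -/
theorem exists_bound_iteratedFDeriv {f : Torus → ℝ} (hf : IsSmooth f) (k : ℕ) :
    ∃ C, ∀ p : Plane, ‖iteratedFDeriv ℝ k (fun q : Plane => f (proj q)) p‖ ≤ C := by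
  have hper : ∀ p n : Plane, proj n = 0 →
      ‖iteratedFDeriv ℝ k (fun q : Plane => f (proj q)) (p + n)‖
        = ‖iteratedFDeriv ℝ k (fun q : Plane => f (proj q)) p‖ := by
    intro p n hn
    rw [← iteratedFDeriv_comp_add_right]
    simp only [proj_add, hn, add_zero]
  obtain ⟨N, hN⟩ := exists_descent
    (F := fun p : Plane => ‖iteratedFDeriv ℝ k (fun q : Plane => f (proj q)) p‖) hper
  have hcont : Continuous N := by
    refine (isOpenQuotientMap_proj.isQuotientMap.continuous_iff).2 ?_
    have e : N ∘ proj = fun p => ‖iteratedFDeriv ℝ k (fun q : Plane => f (proj q)) p‖ :=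
      funext hN
    rw [e]
    exact (ContDiff.continuous_iteratedFDeriv (m := k) (n := ∞) ENat.LEInfty.out hf).norm
  obtain ⟨C, hC⟩ := (isCompact_range hcont).isBounded.exists_norm_le
  refine ⟨C, fun p => ?_⟩
  rw [← hN]
  exact (le_abs_self _).trans (hC _ ⟨_, rfl⟩)

namespace LorentzMetric
variable {g : LorentzMetric}

/-- For a fixed smooth `φ` every derivative is bounded, so `t φ` tends to `0` with all derivatives
as `t → 0`. One-parameter families thus handle every `r` at once. -/
theorem mem_closure_of_perturbation {S : Set LorentzMetric} {φ : Fin 2 → Fin 2 → Torus → ℝ}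
    (hφ : ∀ i j, IsSmooth (φ i j))
    (h : ∀ η : ℝ, 0 < η → ∃ t : ℝ, |t| < η ∧ ∃ h ∈ S, ∀ x i j,
      h.comp x i j = g.comp x i j + t * φ i j x) (r : ℕ∞) :
    g ∈ closure[crTopology r] S := by
  have hn : ∀ n : ℕ, ∃ t : ℝ, |t| < 1 / ((n : ℝ) + 1) ∧ ∃ h ∈ S, ∀ x i j,
      h.comp x i j = g.comp x i j + t * φ i j x := fun n => h _ (by positivity)
  choose t ht hm hmS hm' using hn
  have ht0 : Filter.Tendsto (fun n => |t n|) Filter.atTop (𝓝 0) :=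
    squeeze_zero (fun n => abs_nonneg _) (fun n => (ht n).le)
      tendsto_one_div_add_atTop_nhds_zero_nat
  let : TopologicalSpace LorentzMetric := crTopology r
  have htend : Filter.Tendsto hm Filter.atTop (𝓝 g) := by
    rw [nhds_induced, Filter.tendsto_comap_iff, tendsto_pi_nhds]
    intro k
    rw [tendsto_pi_nhds]
    intro i
    rw [tendsto_pi_nhds]
    intro j
    rw [UniformFun.tendsto_iff_tendstoUniformly, Metric.tendstoUniformly_iff]
    intro ε hε
    obtain ⟨C, hC⟩ := exists_bound_iteratedFDeriv (hφ i j) k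
    have hC1 : 0 < |C| + 1 := by positivity
    have hev : ∀ᶠ n in Filter.atTop, |t n| < ε / (|C| + 1) :=
      (tendsto_order.1 ht0).2 _ (by positivity)
    filter_upwards [hev] with n hn p
    have hk : ((k : ℕ) : WithTop ℕ∞) ≤ ∞ := ENat.LEInfty.out
    have e : (fun q : Plane => (hm n).comp (proj q) i j)
        = (fun q : Plane => g.comp (proj q) i j) + t n • (fun q : Plane => φ i j (proj q)) := by
      funext q; simp [hm']
    have h1 : ContDiff ℝ (k : ℕ) fun q : Plane => g.comp (proj q) i j := (g.smooth i j).of_le hk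
    have h2 : ContDiff ℝ (k : ℕ) fun q : Plane => φ i j (proj q) := (hφ i j).of_le hk
    have h3 : ContDiff ℝ (k : ℕ) (t n • fun q : Plane => φ i j (proj q)) := h2.const_smul (t n)
    change dist (iteratedFDeriv ℝ k (fun q : Plane => g.comp (proj q) i j) p)
      (iteratedFDeriv ℝ k (fun q : Plane => (hm n).comp (proj q) i j) p) < ε
    rw [e, iteratedFDeriv_add_apply h1.contDiffAt h3.contDiffAt,
      iteratedFDeriv_const_smul_apply h2.contDiffAt, dist_self_add_right, norm_smul,
      Real.norm_eq_abs]
    have h4 : |t n| * ‖iteratedFDeriv ℝ k (fun q : Plane => φ i j (proj q)) p‖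
        ≤ |t n| * (|C| + 1) :=
      mul_le_mul_of_nonneg_left ((hC p).trans ((le_abs_self C).trans (by linarith)))
        (abs_nonneg _)
    exact h4.trans_lt ((lt_div_iff₀ hC1).1 hn)
  exact mem_closure_of_tendsto htend (Filter.Eventually.of_forall hmS)

/-- The metric which is the symmetric product of two one-forms. -/
def symProd (a b : Torus → Plane) (ha : ∀ i, IsSmooth fun x => a x i)
    (hb : ∀ i, IsSmooth fun x => b x i) (hw : ∀ x, a x 0 * b x 1 - a x 1 * b x 0 ≠ 0) :
    LorentzMetric where
  comp x := Matrix.of fun i j => a x i * b x j + a x j * b x i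
  smooth i j := ((ha i).mul (hb j)).add ((ha j).mul (hb i))
  symm x := by ext i j; simp [add_comm]
  lorentzian x := by
    have := mul_self_pos.2 (hw x)
    rw [Matrix.det_fin_two]
    simp only [Matrix.of_apply]
    nlinarith

/-- A curve whose momentum satisfies the Euler-Lagrange equations is a geodesic. -/
theorem hasDerivAt_accel_of_momentum {c v : ℝ → Plane} {t : ℝ} (hc : HasDerivAt c (v t) t)
    (hv : DifferentiableAt ℝ v t)
    (hmom : ∀ l, HasDerivAt (fun s => ∑ j, g.comp (proj (c s)) l j * v s j)
      ((1 / 2) * ∑ i, ∑ j, partialDeriv l (fun y => g.comp y i j) (proj (c t)) * v t i * v t j) t) :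
    HasDerivAt v (g.accel (proj (c t)) (v t)) t := by
  have hw := hv.hasDerivAt
  set w := deriv v t with hwdef
  have hwk := hasDerivAt_pi.1 hw
  suffices w = g.accel (proj (c t)) (v t) by rwa [← this]
  have key : ∀ l, g.comp (proj (c t)) l 0 * (w 0 - g.accel (proj (c t)) (v t) 0)
      + g.comp (proj (c t)) l 1 * (w 1 - g.accel (proj (c t)) (v t) 1) = 0 := by
    intro l
    have h1 := ((g.hasDerivAt_comp hc l 0).fun_mul (hwk 0)).fun_add
      ((g.hasDerivAt_comp hc l 1).fun_mul (hwk 1))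
    have h2 := hmom l
    simp only [Fin.sum_univ_two] at h1 h2
    have h3 := h1.unique h2
    simp only [g.partialDeriv_comp, Fin.sum_univ_two] at h3
    simp only [accel, Fin.sum_univ_two]
    fin_cases l <;> simp only [Fin.zero_eta, Fin.mk_one, g.comp_symm _ 1 0,
      g.christoffel_symm _ 1 0] at h3 ⊢ <;> linear_combination h3
  have k0 := key 0
  have k1 := key 1
  rw [g.comp_symm _ 1 0] at k1
  have hdet := (g.comp_det (proj (c t))).ne
  funext k
  fin_cases k
  · apply sub_eq_zero.1
    apply mul_left_cancel₀ hdet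
    simp only [Fin.zero_eta]
    linear_combination g.comp (proj (c t)) 1 1 * k0 - g.comp (proj (c t)) 0 1 * k1
  · apply sub_eq_zero.1
    apply mul_left_cancel₀ hdet
    simp only [Fin.mk_one]
    linear_combination g.comp (proj (c t)) 0 0 * k1 - g.comp (proj (c t)) 0 1 * k0

/-- Geodesics of `2 a B + f B²`, with `a` closed and `df` proportional to `a`, on which the
`B`-component of the momentum vanishes. -/
theorem hasDerivAt_accel_of_profile {a B : Torus → Plane} (ha : IsClosedForm a)
    (hB : ∀ i, IsSmooth fun x => B x i) {f : Torus → ℝ} (hf : IsSmooth f)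
    (hg : ∀ x i j, g.comp x i j = a x i * B x j + a x j * B x i + f x * (B x i * B x j))
    {c v : ℝ → Plane} {A β : ℝ → ℝ} {t f' : ℝ} (hc : HasDerivAt c (v t) t)
    (hv : DifferentiableAt ℝ v t)
    (hf' : ∀ l, partialDeriv l f (proj (c t)) = f' * a (proj (c t)) l)
    (hA : ∀ᶠ s in 𝓝 t, a (proj (c s)) 0 * v s 0 + a (proj (c s)) 1 * v s 1 = A s)
    (hβ : ∀ᶠ s in 𝓝 t, B (proj (c s)) 0 * v s 0 + B (proj (c s)) 1 * v s 1 = β s)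
    (hP : ∀ᶠ s in 𝓝 t, A s + f (proj (c s)) * β s = 0)
    (hβ' : HasDerivAt β (f' / 2 * β t ^ 2) t) :
    HasDerivAt v (g.accel (proj (c t)) (v t)) t := by
  refine hasDerivAt_accel_of_momentum hc hv fun l => ?_
  -- The momentum is `β a + (A + f β) B`, and the second term vanishes.
  have e : (fun s => ∑ j, g.comp (proj (c s)) l j * v s j)
      =ᶠ[𝓝 t] fun s => β s * a (proj (c s)) l := by
    filter_upwards [hA, hβ, hP] with s h1 h2 h3
    simp only [hg, Fin.sum_univ_two]
    linear_combination B (proj (c s)) l * h1 + (a (proj (c s)) l + f (proj (c s)) *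
      B (proj (c s)) l) * h2 + B (proj (c s)) l * h3
  refine ((hβ'.mul (hasDerivAt_plane_comp (ha.smooth l) hc)).congr_of_eventuallyEq e).congr_deriv ?_
  rw [ha.pd_comm 0 l, ha.pd_comm 1 l, ← partialDeriv_proj (ha.smooth 0),
    ← partialDeriv_proj (ha.smooth 1)]
  set x := proj (c t) with hx
  have hd : ∀ i j, partialDeriv l (fun y => g.comp y i j) x
      = partialDeriv l (fun y => a y i) x * B x j + a x i * partialDeriv l (fun y => B y j) x
        + (partialDeriv l (fun y => a y j) x * B x i + a x j * partialDeriv l (fun y => B y i) x)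
        + (f' * a x l * (B x i * B x j) + f x * (partialDeriv l (fun y => B y i) x * B x j
          + B x i * partialDeriv l (fun y => B y j) x)) := by
    intro i j
    have e : (fun y => g.comp y i j)
        = fun y => a y i * B y j + a y j * B y i + f y * (B y i * B y j) :=
      funext fun y => hg y i j
    rw [e, partialDeriv_add (((ha.smooth i).mul (hB j)).add ((ha.smooth j).mul (hB i)))
        (hf.mul ((hB i).mul (hB j))),
      partialDeriv_add ((ha.smooth i).mul (hB j)) ((ha.smooth j).mul (hB i)),
      partialDeriv_mul (ha.smooth i) (hB j), partialDeriv_mul (ha.smooth j) (hB i),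
      partialDeriv_mul hf ((hB i).mul (hB j)), partialDeriv_mul (hB i) (hB j), hf']
  have h1 := hA.self_of_nhds
  have h2 := hβ.self_of_nhds
  have h3 := hP.self_of_nhds
  simp only [hd, Fin.sum_univ_two]
  rw [← h2]
  rw [← h1, ← h2] at h3
  -- The derivatives of `B` enter only multiplied by the vanishing momentum `A + f β`, which is why
  -- `B` need not be closed.
  linear_combination -(partialDeriv l (fun y => B y 0) x * v t 0
    + partialDeriv l (fun y => B y 1) x * v t 1) * h3

end LorentzMetric

/-! ### Incomplete perturbations -/

/-- The profile `sin · cos³` becomes rational after the substitution `arctan`, which makes the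
incomplete geodesics explicit. -/
theorem sin_mul_cos_cube_arctan (x : ℝ) :
    Real.sin (Real.arctan x) * Real.cos (Real.arctan x) ^ 3 * (1 + x ^ 2) ^ 2 = x := by
  have hpos : 0 < 1 + x ^ 2 := by positivity
  have hs : √(1 + x ^ 2) ^ 2 = 1 + x ^ 2 := Real.sq_sqrt hpos.le
  have h0 : √(1 + x ^ 2) ≠ 0 := (Real.sqrt_pos.2 hpos).ne'
  rw [Real.sin_arctan, Real.cos_arctan]
  nth_rewrite 3 [← hs]
  field_simp

theorem deriv_profile_arctan (x : ℝ) :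
    (Real.cos (Real.arctan x) ^ 4 - 3 * Real.sin (Real.arctan x) ^ 2 * Real.cos (Real.arctan x) ^ 2)
      * (1 + x ^ 2) ^ 2 = 1 - 3 * x ^ 2 := by
  have hpos : 0 < 1 + x ^ 2 := by positivity
  have hc : Real.cos (Real.arctan x) ^ 2 = 1 / (1 + x ^ 2) := Real.cos_sq_arctan x
  have hs : Real.sin (Real.arctan x) ^ 2 = x ^ 2 / (1 + x ^ 2) := by
    rw [Real.sin_sq, hc]; field_simp; ring
  have h4 : Real.cos (Real.arctan x) ^ 4 = (Real.cos (Real.arctan x) ^ 2) ^ 2 := by ring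
  rw [h4, hs, hc]
  field_simp

theorem hasDerivAt_profile (y : ℝ) :
    HasDerivAt (fun y => Real.sin (Real.pi * y) * Real.cos (Real.pi * y) ^ 3)
      (Real.pi * (Real.cos (Real.pi * y) ^ 4
        - 3 * Real.sin (Real.pi * y) ^ 2 * Real.cos (Real.pi * y) ^ 2)) y := by
  have h0 : HasDerivAt (fun y => Real.pi * y) Real.pi y := by
    simpa using (hasDerivAt_id' y).const_mul Real.pi
  refine (h0.sin.fun_mul (h0.cos.fun_pow 3)).congr_deriv ?_
  simp
  ring

namespace LorentzMetric
variable {g : LorentzMetric}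

/-- The one-form `a` is the differential of a function on the plane which changes by integers
under deck transformations. -/
def HasIntegralPrimitive (a : Torus → Plane) (u : Plane → ℝ) : Prop :=
  ContDiff ℝ ∞ u ∧ (∀ i p, pd i u p = a (proj p) i) ∧
    ∀ p n, proj n = 0 → ∃ z : ℤ, u (p + n) = u p + z

/-- With `B = Ω b`, the metric is `a B + B a + 2 ε f(u) B²`. Geodesics with `A + 2 ε f β = 0`, where
`A = a(v)` and `β = B(v)`, have energy `A β` and satisfy `β' = ε f'(u) β²`. Near the zero `u = 0`
this is a Riccati blow-up; the solution is `u = arctan(s t²) / π`, `β = m (1 + s² t⁴) / t`, with `s`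
fixing the energy. In the time `-log t` the coefficients of the curve's equation have no
singularity, so the curve exists for all `t > 0`. -/
theorem exists_incomplete_geodesic {Ω f : Torus → ℝ} {a b : Torus → Plane}
    (h : g.IsNullCoframe Ω a b) {u : Plane → ℝ} (hu : HasIntegralPrimitive a u) (hf : IsSmooth f)
    (hfu : ∀ p, f (proj p) = Real.sin (Real.pi * u p) * Real.cos (Real.pi * u p) ^ 3)
    {ε : ℝ} (hε : ε ≠ 0) {k : LorentzMetric}
    (hk : ∀ x i j, k.comp x i j
      = g.comp x i j + ε * (2 * f x * (Ω x * b x i) * (Ω x * b x j)))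
    {C : Torus → Plane → Prop} {s : ℝ}
    (hC : ∀ x w, k.inner x w w = -2 * s / (ε * Real.pi ^ 2) → w ≠ 0 → C x w) :
    k.IsIncompleteFor C := by
  obtain ⟨hus, hua, -⟩ := hu
  have hπ := Real.pi_pos
  have hΩ : ∀ x, Ω x ≠ 0 := fun x => (h.pos x).ne'
  set X := dualField a b 1 0 with hX
  set Y : Torus → Plane := fun x => (Ω x)⁻¹ • dualField a b 0 1 x with hY
  set B : Torus → Plane := fun x => Ω x • b x with hB
  have hXs := h.dualField_smooth 1 0
  have hYs : ∀ i, IsSmooth fun x => Y x i := fun i =>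
    (h.smooth.inv hΩ).mul (h.dualField_smooth 0 1 i)
  have hBs : ∀ i, IsSmooth fun x => B x i := fun i => h.smooth.mul (h.right.smooth i)
  -- For `s = 0` the curve stays on `u = 0`, where `f' = π`; then `β = m / t` solves `β' = ε π β²`
  -- exactly for this `m`.
  obtain ⟨m, hmε⟩ : ∃ m : ℝ, m * ε * Real.pi = -1 :=
    ⟨-1 / (Real.pi * ε), by field_simp⟩
  have hm0 : m ≠ 0 := fun h0 => by rw [h0] at hmε; norm_num at hmε
  set U : ℝ → ℝ := fun t => Real.arctan (s * t ^ 2) / Real.pi with hU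
  set A : ℝ → ℝ := fun t => 2 * s * t / Real.pi / (1 + (s * t ^ 2) ^ 2) with hA
  set β : ℝ → ℝ := fun t => m * (1 + (s * t ^ 2) ^ 2) / t with hβ
  have hden : ∀ t, 0 < 1 + (s * t ^ 2) ^ 2 := fun t => by positivity
  have hUd : ∀ t, HasDerivAt U (A t) t := by
    intro t
    have h1 : HasDerivAt (fun t : ℝ => s * t ^ 2) (s * (2 * t)) t := by
      simpa using (hasDerivAt_pow 2 t).const_mul s
    refine (h1.arctan.div_const Real.pi).congr_deriv ?_
    simp only [hA]
    have := (hden t).ne'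
    field_simp
  have hβd : ∀ t, t ≠ 0 → HasDerivAt β (-m * (1 - 3 * (s * t ^ 2) ^ 2) / t ^ 2) t := by
    intro t ht
    have h1 : HasDerivAt (fun t : ℝ => m * (1 + (s * t ^ 2) ^ 2)) (m * (4 * s ^ 2 * t ^ 3)) t := by
      have h2 : HasDerivAt (fun t : ℝ => s * t ^ 2) (s * (2 * t)) t := by
        simpa using (hasDerivAt_pow 2 t).const_mul s
      refine (((h2.fun_pow 2).const_add 1).const_mul m).congr_deriv ?_
      simp only [Nat.cast_ofNat, Nat.add_one_sub_one, pow_one]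
      ring
    refine (h1.fun_div (hasDerivAt_id' t) ht).congr_deriv ?_
    field_simp
    ring
  -- a point with the right initial value
  obtain ⟨p₁, hp₁⟩ : ∃ p, u p = U 1 := by
    obtain ⟨q, hq0, hq⟩ := exists_integral_curve hXs hXs (A := fun _ => U 1 - u 0)
      (B := fun _ => 0) continuous_const continuous_const 0
    have hd : ∀ t, HasDerivAt (fun t => u (q t) - (U 1 - u 0) * t) 0 t := by
      intro t
      refine ((hasDerivAt_plane_comp hus (hq t)).sub
        ((hasDerivAt_id' t).const_mul (U 1 - u 0))).congr_deriv ?_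
      have := h.left_dualField 1 0 (proj (q t))
      simp only [hua, zero_smul, add_zero, Pi.smul_apply, smul_eq_mul]
      linear_combination (U 1 - u 0) * this
    have := is_const_of_deriv_eq_zero (fun t => (hd t).differentiableAt)
      (fun t => (hd t).deriv) 1 0
    refine ⟨q 1, ?_⟩
    rw [hq0] at this
    linarith
  -- the curve, in logarithmic time
  obtain ⟨q, hq0, hq⟩ := exists_integral_curve hXs hYs
    (A := fun τ => -(Real.exp (-τ) * A (Real.exp (-τ))))
    (B := fun τ => -(m * (1 + (s * Real.exp (-τ) ^ 2) ^ 2)))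
    (by
      have : Continuous A := by
        simp only [hA]
        exact Continuous.div (by fun_prop) (by fun_prop) fun t => (hden t).ne'
      fun_prop) (by fun_prop) p₁
  have huq : ∀ τ, u (q τ) = U (Real.exp (-τ)) := by
    have hd : ∀ τ, HasDerivAt (fun τ => u (q τ) - U (Real.exp (-τ))) 0 τ := by
      intro τ
      have h1 : HasDerivAt (fun τ : ℝ => Real.exp (-τ)) (-Real.exp (-τ)) τ := by
        simpa using (hasDerivAt_neg τ).exp
      refine ((hasDerivAt_plane_comp hus (hq τ)).sub ((hUd _).comp τ h1)).congr_deriv ?_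
      have e1 := h.left_dualField 1 0 (proj (q τ))
      have e2 := h.left_dualField 0 1 (proj (q τ))
      simp only [hua, hY, Pi.add_apply, Pi.smul_apply, smul_eq_mul]
      linear_combination -(Real.exp (-τ) * A (Real.exp (-τ))) * e1
        - (m * (1 + (s * Real.exp (-τ) ^ 2) ^ 2)) * (Ω (proj (q τ)))⁻¹ * e2
    intro τ
    have := is_const_of_deriv_eq_zero (fun t => (hd t).differentiableAt)
      (fun t => (hd t).deriv) τ 0
    rw [hq0, neg_zero, Real.exp_zero, hp₁, sub_self] at this
    linarith
  set c : ℝ → Plane := fun t => q (-Real.log t) with hc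
  set v : ℝ → Plane := fun t => A t • X (proj (c t)) + β t • Y (proj (c t)) with hv
  have hcd : ∀ t, 0 < t → HasDerivAt c (v t) t := by
    intro t ht
    have h1 : HasDerivAt (fun t => -Real.log t) (-t⁻¹) t := (Real.hasDerivAt_log ht.ne').neg
    refine (HasDerivAt.scomp t (hq _) h1).congr_deriv ?_
    simp only [neg_neg, Real.exp_log ht, hv, hβ, hc]
    rw [smul_add, smul_smul, smul_smul]
    congr 2
    · have := ht.ne'
      field_simp
    · have := ht.ne'
      field_simp
  have huc : ∀ t, 0 < t → u (c t) = U t := by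
    intro t ht
    simp only [hc]
    rw [huq, neg_neg, Real.exp_log ht]
  have hvd : ∀ t, 0 < t → DifferentiableAt ℝ v t := by
    intro t ht
    have h1 : ∀ {Z : Torus → Plane}, (∀ i, IsSmooth fun x => Z x i) →
        DifferentiableAt ℝ (fun t => Z (proj (c t))) t := fun hZ =>
      differentiableAt_pi.2 fun i =>
        (hasDerivAt_plane_comp (hZ i) (hcd t ht)).differentiableAt
    have h2 : DifferentiableAt ℝ A t := by
      simp only [hA]
      exact DifferentiableAt.div (by fun_prop) (by fun_prop) (hden t).ne'
    exact (h2.smul (h1 hXs)).add ((hβd t ht.ne').differentiableAt.smul (h1 hYs))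
  have hav : ∀ t, a (proj (c t)) 0 * v t 0 + a (proj (c t)) 1 * v t 1 = A t := by
    intro t
    have e1 := h.left_dualField 1 0 (proj (c t))
    have e2 := h.left_dualField 0 1 (proj (c t))
    simp only [hv, hX, hY, Pi.add_apply, Pi.smul_apply, smul_eq_mul]
    linear_combination A t * e1 + β t * (Ω (proj (c t)))⁻¹ * e2
  have hBv : ∀ t, B (proj (c t)) 0 * v t 0 + B (proj (c t)) 1 * v t 1 = β t := by
    intro t
    have e1 := h.right_dualField 1 0 (proj (c t))
    have e2 := h.right_dualField 0 1 (proj (c t))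
    have e3 : Ω (proj (c t)) * (Ω (proj (c t)))⁻¹ = 1 := mul_inv_cancel₀ (hΩ _)
    simp only [hv, hX, hY, hB, Pi.add_apply, Pi.smul_apply, smul_eq_mul]
    linear_combination Ω (proj (c t)) * A t * e1 + Ω (proj (c t)) * β t * (Ω (proj (c t)))⁻¹ * e2
      + β t * e3
  have hπU : ∀ t, Real.pi * U t = Real.arctan (s * t ^ 2) := fun t => by
    simp only [hU]; field_simp
  have hfc : ∀ t, 0 < t → f (proj (c t)) * (1 + (s * t ^ 2) ^ 2) ^ 2 = s * t ^ 2 := by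
    intro t ht
    rw [hfu, huc t ht, hπU, sin_mul_cos_cube_arctan]
  have hzero : ∀ t, 0 < t → A t + 2 * ε * f (proj (c t)) * β t = 0 := by
    intro t ht
    have h1 := hfc t ht
    have h2 := (hden t).ne'
    simp only [hA, hβ]
    set D := 1 + (s * t ^ 2) ^ 2 with hD
    have h3 : f (proj (c t)) = s * t ^ 2 / D ^ 2 := by
      rw [eq_div_iff (pow_ne_zero 2 h2), h1]
    rw [h3]
    have := ht.ne'
    field_simp
    linear_combination 2 * s * t * hmε
  have hgeo : ∀ t, 0 < t → HasDerivAt v (k.accel (proj (c t)) (v t)) t := by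
    intro t ht
    have hpos : ∀ᶠ r in 𝓝 t, 0 < r := lt_mem_nhds ht
    refine hasDerivAt_accel_of_profile (a := a) (B := B) (f := fun x => 2 * ε * f x)
      (A := A) (β := β) (f' := 2 * ε * (Real.pi * (Real.cos (Real.pi * u (c t)) ^ 4
        - 3 * Real.sin (Real.pi * u (c t)) ^ 2 * Real.cos (Real.pi * u (c t)) ^ 2)))
      h.left hBs ((IsSmooth.const (2 * ε)).mul hf) ?_ (hcd t ht) (hvd t ht) ?_
      (Filter.Eventually.of_forall hav) (Filter.Eventually.of_forall hBv)
      (hpos.mono fun r hr => hzero r hr) ?_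
    · intro x i j
      rw [hk, h.comp_eq]
      simp only [hB, Pi.smul_apply, smul_eq_mul]
      ring
    · intro l
      rw [partialDeriv_const_mul hf, partialDeriv_proj hf]
      simp only [hfu]
      rw [pd_comp (φ := fun y => Real.sin (Real.pi * y) * Real.cos (Real.pi * y) ^ 3) hus
        (hasDerivAt_profile _), hua]
      ring
    · refine (hβd t ht.ne').congr_deriv ?_
      rw [huc t ht, hπU]
      have h1 := deriv_profile_arctan (s * t ^ 2)
      have h2 := ht.ne'
      simp only [hβ]
      rw [div_pow, mul_pow, ← sub_eq_zero]
      field_simp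
      linear_combination -ε * Real.pi * m ^ 2 * h1 - (1 - 3 * (s * t ^ 2) ^ 2) * m * hmε
  have henergy : ∀ t, 0 < t → k.inner (proj (c t)) (v t) (v t) = -2 * s / (ε * Real.pi ^ 2) := by
    intro t ht
    have e : k.inner (proj (c t)) (v t) (v t) = 2 * A t * β t
        + 2 * ε * f (proj (c t)) * β t ^ 2 := by
      rw [← hav t, ← hBv t]
      simp only [inner, Fin.sum_univ_two, hk, h.comp_eq, hB, Pi.smul_apply, smul_eq_mul]
      ring
    have e2 : k.inner (proj (c t)) (v t) (v t) = A t * β t := by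
      rw [e]; linear_combination β t * hzero t ht
    have h1 := (hden t).ne'
    have h2 := ht.ne'
    rw [e2, eq_div_iff (by positivity)]
    simp only [hA, hβ]
    field_simp
    linear_combination s * hmε
  have hβ0 : ∀ t, 0 < t → |m| / t ≤ |β t| := by
    intro t ht
    simp only [hβ]
    rw [abs_div, abs_mul, abs_of_pos ht, abs_of_pos (hden t)]
    gcongr
    nlinarith [abs_nonneg m, sq_nonneg (s * t ^ 2)]
  have hvel : ∀ t, 0 < t → HasVelocityAt (fun s => proj (c s)) (v t) t := fun t ht =>
    ⟨c, hcd t ht, Filter.Eventually.of_forall fun _ => rfl⟩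
  refine ⟨Set.Ioi 0, fun t => proj (c t), v, isOpen_Ioi, Set.ordConnected_Ioi,
    ⟨1, Set.mem_Ioi.2 one_pos⟩,
    fun t ht => ⟨hvel t ht, fun l => hasDerivAt_pi.1 (hgeo t ht) l⟩, fun t ht => ?_, ?_⟩
  · refine hC _ _ (henergy t ht) fun h0 => ?_
    have h1 := hBv t
    have h2 := hβ0 t ht
    rw [h0] at h1
    simp only [Pi.zero_apply, mul_zero, add_zero] at h1
    rw [← h1, abs_zero] at h2
    exact absurd h2 (not_le.2 (div_pos (abs_pos.2 hm0) ht))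
  -- An extension would have a continuous velocity, bounded on `[0, 1]`, whereas `|β| ≥ |m| / t`.
  · rintro ⟨γ', v', hγ', heq⟩
    have hvv : ∀ t, 0 < t → v' t = v t := fun t ht =>
      (hγ' t trivial).1.unique (hvel t ht)
        (Filter.eventually_of_mem (Ioi_mem_nhds ht) fun r hr => heq hr)
    have hv'c : Continuous v' := continuous_iff_continuousAt.2 fun t =>
      (hasDerivAt_pi.2 fun l => (hγ' t trivial).2 l).continuousAt
    obtain ⟨R, hR⟩ := (isCompact_Icc (a := (0 : ℝ)) (b := 1)).exists_bound_of_continuousOn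
      hv'c.continuousOn
    obtain ⟨M, hM0, hM⟩ := exists_bound (hBs 0)
    obtain ⟨N, hN0, hN⟩ := exists_bound (hBs 1)
    have hR0 : 0 ≤ R := (norm_nonneg _).trans (hR 0 ⟨le_rfl, zero_le_one⟩)
    have hbd : ∀ t, 0 < t → t ≤ 1 → |m| / t ≤ (M + N) * R := by
      intro t ht ht1
      refine (hβ0 t ht).trans ?_
      rw [← hBv t, ← hvv t ht]
      have h1 := hR t ⟨ht.le, ht1⟩
      refine (abs_add_le _ _).trans ?_
      rw [abs_mul, abs_mul, add_mul]
      exact add_le_add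
        (mul_le_mul (hM _) ((norm_le_pi_norm (v' t) 0).trans h1) (abs_nonneg _) hM0)
        (mul_le_mul (hN _) ((norm_le_pi_norm (v' t) 1).trans h1) (abs_nonneg _) hN0)
    have hm1 : 0 < |m| := abs_pos.2 hm0
    have hQ : 0 ≤ (M + N) * R := by positivity
    -- At this time `|m| / t` exceeds the bound; the term `|m|` in the denominator keeps the time
    -- below `1`.
    have ht : 0 < |m| / ((M + N) * R + |m| + 1) := by positivity
    have h1 := hbd _ ht (by rw [div_le_one (by positivity)]; linarith)
    rw [div_div_cancel₀ hm1.ne'] at h1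
    linarith

/-- A metric with a null coframe, one of whose forms has an integral primitive, is a limit of
metrics which are incomplete in all three causal senses. -/
theorem mem_closure_of_hasIntegralPrimitive {Ω : Torus → ℝ} {a b : Torus → Plane}
    (h : g.IsNullCoframe Ω a b) {u : Plane → ℝ} (hu : HasIntegralPrimitive a u) (r : ℕ∞) :
    g ∈ closure[crTopology r] {k : LorentzMetric |
      k.IsTimelikeIncomplete ∧ k.IsLightlikeIncomplete ∧ k.IsSpacelikeIncomplete} := by
  obtain ⟨f, hfu⟩ := exists_descent
    (F := fun p => Real.sin (Real.pi * u p) * Real.cos (Real.pi * u p) ^ 3) (by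
    intro p n hn
    obtain ⟨z, hz⟩ := hu.2.2 p n hn
    -- In terms of `2 y` the profile visibly has period `π`, that is, period `1` in `u`.
    have e : ∀ y : ℝ, Real.sin y * Real.cos y ^ 3
        = Real.sin (2 * y) * (1 + Real.cos (2 * y)) / 4 := by
      intro y; rw [Real.sin_two_mul, Real.cos_two_mul]; ring
    have e2 : 2 * (Real.pi * (u p + z)) = 2 * (Real.pi * u p) + z * (2 * Real.pi) := by ring
    simp only [hz]
    rw [e, e, e2, Real.sin_add_int_mul_two_pi, Real.cos_add_int_mul_two_pi])
  have hf : IsSmooth f := by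
    unfold IsSmooth
    simp only [hfu]
    have h1 : ContDiff ℝ ∞ fun p => Real.pi * u p := contDiff_const.mul hu.1
    exact h1.sin.mul (h1.cos.pow 3)
  have hBs : ∀ i, IsSmooth fun x => Ω x * b x i := fun i => h.smooth.mul (h.right.smooth i)
  refine mem_closure_of_perturbation
    (φ := fun i j x => 2 * f x * (Ω x * b x i) * (Ω x * b x j))
    (fun i j => (((IsSmooth.const 2).mul hf).mul (hBs i)).mul (hBs j)) (fun η hη => ?_) r
  set ε := η / 2 with hεdef
  have hε : 0 < ε := by positivity
  -- Adding a multiple of `b` to `a` does not change `a ∧ b`, so the perturbed metric is Lorentzian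
  -- for every `ε`.
  set k : LorentzMetric := symProd (fun x => a x + (ε * f x) • (Ω x • b x)) (fun x => Ω x • b x)
    (fun i => (h.left.smooth i).add (((IsSmooth.const ε).mul hf).mul (hBs i))) hBs (by
      intro x
      have h1 := mul_ne_zero (h.pos x).ne' (h.wedge_ne_zero x)
      simp only [Pi.add_apply, Pi.smul_apply, smul_eq_mul]
      contrapose! h1
      linear_combination h1) with hk
  have hk' : ∀ x i j, k.comp x i j
      = g.comp x i j + ε * (2 * f x * (Ω x * b x i) * (Ω x * b x j)) := by
    intro x i j
    rw [h.comp_eq]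
    simp only [hk, symProd, Matrix.of_apply, Pi.add_apply, Pi.smul_apply, smul_eq_mul]
    ring
  refine ⟨ε, by rw [abs_of_pos hε]; linarith, k, ⟨?_, ?_, ?_⟩, hk'⟩
  · refine exists_incomplete_geodesic h hu hf hfu hε.ne' hk' (s := 1) fun x w hw _ => ?_
    rw [IsTimelike, hw]
    exact div_neg_of_neg_of_pos (by norm_num) (by positivity)
  · refine exists_incomplete_geodesic h hu hf hfu hε.ne' hk' (s := 0) fun x w hw h0 => ?_
    exact ⟨by rw [hw]; simp, h0⟩
  · refine exists_incomplete_geodesic h hu hf hfu hε.ne' hk' (s := -1) fun x w hw _ => ?_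
    rw [IsSpacelike, hw]
    exact div_pos (by norm_num) (by positivity)

end LorentzMetric

/-! ### Periods of closed one-forms -/

theorem proj_single_intCast (i : Fin 2) (z : ℤ) : proj (Pi.single i (z : ℝ)) = 0 := by
  refine proj_eq_zero_iff.2 fun j => ?_
  by_cases hj : j = i
  · subst hj; exact ⟨z, by simp⟩
  · exact ⟨0, by simp [Pi.single_eq_of_ne hj]⟩

/-- A closed one-form on the torus has a primitive on the plane, additive up to two periods. -/
theorem IsClosedForm.exists_primitive_periods {a : Torus → Plane} (ha : IsClosedForm a) :
    ∃ (u : Plane → ℝ) (l : Plane), ContDiff ℝ ∞ u ∧ (∀ i p, pd i u p = a (proj p) i) ∧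
      ∀ p (z : Fin 2 → ℤ), u (p + fun i => (z i : ℝ)) = u p + z 0 * l 0 + z 1 * l 1 := by
  obtain ⟨u, hu, hua⟩ := exists_real_primitive (a := fun p => a (proj p)) ha.smooth
    (ha.pd_comm 0 1)
  have hper : ∀ n, proj n = 0 → ∃ c, ∀ p, u (p + n) = u p + c := fun n hn =>
    exists_add_const (contDiff_translate hu n) hu fun i p => by
      rw [pd_translate, hua, hua, proj_add, hn, add_zero]
  have h1 : ∀ i, ∃ c, ∀ p, u (p + Pi.single i 1) = u p + c := fun i =>
    hper _ (by simpa using proj_single_intCast i 1)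
  choose l hl using h1
  have hz : ∀ i (z : ℤ) p, u (p + Pi.single i (z : ℝ)) = u p + z * l i := by
    intro i z
    induction z using Int.induction_on with
    | zero => intro p; simp
    | succ k ih =>
      intro p
      have e : p + Pi.single i (((k : ℤ) + 1 : ℤ) : ℝ) = p + Pi.single i ((k : ℤ) : ℝ)
          + Pi.single i 1 := by
        rw [add_assoc, ← Pi.single_add]; push_cast; rfl
      rw [e, hl, ih]; push_cast; ring
    | pred k ih =>
      intro p
      have e : p + Pi.single i ((-(k : ℤ) - 1 : ℤ) : ℝ) + Pi.single i 1
          = p + Pi.single i ((-(k : ℤ) : ℤ) : ℝ) := by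
        rw [add_assoc, ← Pi.single_add]; push_cast; ring_nf
      have h2 := hl i (p + Pi.single i ((-(k : ℤ) - 1 : ℤ) : ℝ))
      rw [e, ih] at h2
      push_cast at h2 ⊢
      linarith
  refine ⟨u, l, hu, fun i p => hua p i, fun p z => ?_⟩
  have e : p + (fun i => (z i : ℝ)) = p + Pi.single 0 (z 0 : ℝ) + Pi.single 1 (z 1 : ℝ) := by
    ext i; fin_cases i <;> simp
  rw [e, hz, hz]

/-- Two real numbers become integral multiples of a common number after an arbitrarily small
change of the first one. -/
theorem exists_integral_multiples (l : Plane) {η : ℝ} (hη : 0 < η) :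
    ∃ t : ℝ, |t| < η ∧ ∃ r : ℝ, r ≠ 0 ∧ ∃ m : Fin 2 → ℤ, r * (l 0 + t) = m 0 ∧ r * l 1 = m 1 := by
  by_cases h1 : l 1 = 0
  · refine ⟨0, by simpa using hη, ?_⟩
    by_cases h0 : l 0 = 0
    · exact ⟨1, one_ne_zero, ![0, 0], by simp [h0], by simp [h1]⟩
    · exact ⟨(l 0)⁻¹, inv_ne_zero h0, ![1, 0], by simp [h0], by simp [h1]⟩
  · have hl : 0 < |l 1| := abs_pos.2 h1
    -- A rational slope close to `l 0 / l 1`; the factor `q.den / l 1` then clears denominators.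
    obtain ⟨q, hq1, hq2⟩ := exists_rat_btwn
      (show l 0 / l 1 < l 0 / l 1 + η / |l 1| by linarith [div_pos hη hl])
    have hd : (q.den : ℝ) ≠ 0 := Nat.cast_ne_zero.2 q.den_ne_zero
    have hqd : (q : ℝ) * q.den = q.num := by
      exact_mod_cast Rat.mul_den_eq_num q
    refine ⟨(q - l 0 / l 1) * l 1, ?_, q.den / l 1, div_ne_zero hd h1, ![q.num, q.den], ?_, ?_⟩
    · rw [abs_mul, abs_of_pos (by linarith), ← lt_div_iff₀ hl]
      linarith
    · simp only [Matrix.cons_val_zero]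
      rw [← hqd]
      field_simp
      ring
    · simp only [Matrix.cons_val_one, Matrix.cons_val_fin_one, Int.cast_natCast]
      field_simp

/-! ### Density of integral periods, and the conclusions -/

namespace LorentzMetric

variable {g : LorentzMetric}

/-- A metric with a null coframe is a limit of metrics with a null coframe one of whose forms has an
integral primitive. -/
theorem IsNullCoframe.mem_closure_hasIntegralPrimitive {Ω : Torus → ℝ} {a b : Torus → Plane}
    (h : g.IsNullCoframe Ω a b) (r : ℕ∞) :
    g ∈ closure[crTopology r] {k : LorentzMetric |
      ∃ Ω a b u, k.IsNullCoframe Ω a b ∧ HasIntegralPrimitive a u} := by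
  obtain ⟨u, l, hu, hua, hul⟩ := h.left.exists_primitive_periods
  have hBs : ∀ i, IsSmooth fun x => Ω x * b x i := fun i => h.smooth.mul (h.right.smooth i)
  set e : Plane := Pi.single 0 1 with he
  have hws : IsSmooth fun x => a x 0 * b x 1 - a x 1 * b x 0 :=
    ((h.left.smooth 0).mul (h.right.smooth 1)).sub ((h.left.smooth 1).mul (h.right.smooth 0))
  -- Adding `t dx₀` to `a` changes `a ∧ b` by the relative amount `t b₁ / (a ∧ b)`, which stays
  -- below `1` in absolute value once `|t| < 1 / (N + 1)`.
  obtain ⟨N, hN0, hN⟩ := exists_bound ((h.right.smooth 1).mul (hws.inv h.wedge_ne_zero))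
  refine mem_closure_of_perturbation
    (φ := fun i j x => e i * (Ω x * b x j) + e j * (Ω x * b x i))
    (fun i j => ((IsSmooth.const _).mul (hBs j)).add ((IsSmooth.const _).mul (hBs i)))
    (fun η hη => ?_) r
  obtain ⟨t, ht, ρ, hρ, m, hm0, hm1⟩ := exists_integral_multiples l
    (lt_min hη (show 0 < 1 / (N + 1) by positivity))
  have hA : IsClosedForm fun x => a x + t • e := h.left.add (IsClosedForm.const (t • e))
  set k : LorentzMetric := symProd (fun x => a x + t • e) (fun x => Ω x • b x) hA.smooth hBs (by
    intro x hx
    have h1 := h.wedge_ne_zero x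
    have h2 : t * (b x 1 * (a x 0 * b x 1 - a x 1 * b x 0)⁻¹) = -1 := by
      have h3 : Ω x * (a x 0 * b x 1 - a x 1 * b x 0 + t * b x 1) = 0 := by
        simp only [Pi.add_apply, Pi.smul_apply, smul_eq_mul, he, Pi.single_eq_same,
          Pi.single_eq_of_ne (one_ne_zero : (1 : Fin 2) ≠ 0)] at hx
        linear_combination hx
      have h4 := (mul_eq_zero.1 h3).resolve_left (h.pos x).ne'
      rw [← mul_assoc, ← div_eq_mul_inv, div_eq_iff h1]
      linear_combination h4
    have h3 : |t| * (N + 1) < 1 := by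
      rw [← lt_div_iff₀ (by positivity)]; exact ht.trans_le (min_le_right _ _)
    have h4 := congrArg abs h2
    rw [abs_mul, abs_neg, abs_one] at h4
    nlinarith [mul_le_mul_of_nonneg_left (hN x) (abs_nonneg t), abs_nonneg t]) with hk
  -- The reciprocal factors `ρ` and `ρ⁻¹` make the periods integral without changing the metric.
  refine ⟨t, ht.trans_le (min_le_left _ _), k, ⟨Ω, fun x => ρ • (a x + t • e),
    fun x => ρ⁻¹ • b x, fun p => ρ * (u p + t * p 0),
    ⟨h.smooth, h.pos, hA.const_smul ρ, h.right.const_smul ρ⁻¹, fun x i j => ?_⟩,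
    ?_, fun i p => ?_, fun p n hn => ?_⟩, fun x i j => ?_⟩
  · simp only [hk, symProd, Matrix.of_apply, Pi.smul_apply, smul_eq_mul]
    field_simp
  · exact contDiff_const.mul (hu.add (contDiff_const.mul (contDiff_apply ℝ ℝ 0)))
  · have hd : HasFDerivAt (fun p : Plane => ρ * (u p + t * p 0))
        (ρ • (fderiv ℝ u p + t • ContinuousLinearMap.proj (R := ℝ) (φ := fun _ : Fin 2 => ℝ) 0))
        p :=
      (((pd_differentiableAt hu p).hasFDerivAt).add
        ((ContinuousLinearMap.proj (R := ℝ) (φ := fun _ : Fin 2 => ℝ) 0).hasFDerivAt.const_mul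
          t)).const_mul ρ
    have h1 := hua i p
    rw [pd] at h1 ⊢
    rw [hd.fderiv]
    fin_cases i <;> simp [he] at h1 ⊢ <;> simp [h1, mul_add]
  · choose z hz using proj_eq_zero_iff.1 hn
    obtain rfl : n = fun i => (z i : ℝ) := funext hz
    refine ⟨z 0 * m 0 + z 1 * m 1, ?_⟩
    simp only [hul, Pi.add_apply]
    push_cast
    rw [← hm0, ← hm1]
    ring
  · rw [h.comp_eq]
    simp only [hk, symProd, Matrix.of_apply, Pi.add_apply, Pi.smul_apply, smul_eq_mul]
    ring

/-- Two successive approximations, of the periods and then of the metric, combine because a closure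
is closed. -/
theorem IsNullCoframe.mem_closure_incomplete {Ω : Torus → ℝ} {a b : Torus → Plane}
    (h : g.IsNullCoframe Ω a b) (r : ℕ∞) :
    g ∈ closure[crTopology r] {k : LorentzMetric |
      k.IsTimelikeIncomplete ∧ k.IsLightlikeIncomplete ∧ k.IsSpacelikeIncomplete} := by
  let _ : TopologicalSpace LorentzMetric := crTopology r
  refine closure_minimal ?_ isClosed_closure (h.mem_closure_hasIntegralPrimitive r)
  rintro k ⟨Ω', a', b', u, hk, hu⟩
  exact mem_closure_of_hasIntegralPrimitive hk hu r

theorem IsConformallyFlat.exists_isNullCoframe (h : g.IsConformallyFlat) :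
    ∃ Ω a b, g.IsNullCoframe Ω a b := by
  obtain ⟨g₀, h₀, hc⟩ := h
  obtain ⟨a, b, hab⟩ := h₀.exists_isNullCoframe
  obtain ⟨Ω, hΩ⟩ := hc.isNullCoframe hab
  exact ⟨Ω, a, b, hΩ⟩

theorem isConformallyFlat_iff_exists_timelike : g.IsConformallyFlat ↔
    ∃ K : Torus → Plane, g.IsConformalField K ∧ ∀ x, g.IsTimelike x (K x) := by
  constructor
  · intro h
    obtain ⟨Ω, a, b, h⟩ := h.exists_isNullCoframe
    refine ⟨_, h.isConformalField_dualField 1 (-1), fun x => ?_⟩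
    rw [IsTimelike, h.inner_dualField]
    linarith [h.pos x]
  · rintro ⟨K, hK, ht⟩
    obtain ⟨Ω, a, b, h⟩ := hK.exists_isNullCoframe (ε := -1) (by norm_num) fun x => by
      have := ht x
      rw [IsTimelike] at this
      linarith
    exact h.isConformallyFlat

theorem isConformallyFlat_iff_exists_spacelike : g.IsConformallyFlat ↔
    ∃ K : Torus → Plane, g.IsConformalField K ∧ ∀ x, g.IsSpacelike x (K x) := by
  constructor
  · intro h
    obtain ⟨Ω, a, b, h⟩ := h.exists_isNullCoframe
    refine ⟨_, h.isConformalField_dualField 1 1, fun x => ?_⟩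
    rw [IsSpacelike, h.inner_dualField]
    linarith [h.pos x]
  · rintro ⟨K, hK, ht⟩
    obtain ⟨Ω, a, b, h⟩ := hK.exists_isNullCoframe (ε := 1) (by norm_num) fun x => by
      have := ht x
      rw [IsSpacelike] at this
      linarith
    exact h.isConformallyFlat

end LorentzMetric

end LorentzTorus

end

theorem mainTheorem7 (g : LorentzTorus.LorentzMetric) :
    ((g.IsConformallyFlat ↔
        ∃ K : LorentzTorus.Torus → LorentzTorus.Plane,
          g.IsConformalField K ∧ ∀ x, g.IsTimelike x (K x)) ∧
      (g.IsConformallyFlat ↔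
        ∃ K : LorentzTorus.Torus → LorentzTorus.Plane,
          g.IsConformalField K ∧ ∀ x, g.IsSpacelike x (K x)) ∧
      (g.IsConformallyFlat → g.IsComplete)) ∧
    (∀ r : ℕ∞,
      (g.IsConformallyFlat →
        g ∈ closure[LorentzTorus.LorentzMetric.crTopology r]
          {h | h.IsLightlikeIncomplete}) ∧
      (g.IsFlat →
        g ∈ closure[LorentzTorus.LorentzMetric.crTopology r]
          {h | h.IsTimelikeIncomplete ∧ h.IsLightlikeIncomplete ∧ h.IsSpacelikeIncomplete})) := by
  refine ⟨⟨LorentzTorus.LorentzMetric.isConformallyFlat_iff_exists_timelike,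
    LorentzTorus.LorentzMetric.isConformallyFlat_iff_exists_spacelike, fun hg => ?_⟩,
    fun r => ⟨fun hg => ?_, fun hg => ?_⟩⟩
  · obtain ⟨Ω, a, b, h⟩ := hg.exists_isNullCoframe
    exact h.isComplete
  · obtain ⟨Ω, a, b, h⟩ := hg.exists_isNullCoframe
    let _ : TopologicalSpace LorentzTorus.LorentzMetric :=
      LorentzTorus.LorentzMetric.crTopology r
    exact closure_mono (fun k hk => hk.2.1) (h.mem_closure_incomplete r)
  · obtain ⟨a, b, h⟩ := hg.exists_isNullCoframe
    exact h.mem_closure_incomplete r
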